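/- Let $Q$ be a finite-dimensional smooth manifold, $k\ge 1$, and let $T^rQ$ denote the bundle of $r$-jets at $0$ of smooth curves in $Q$, with natural coordinates $(q_0^i,\dots,q_r^i)$, where $q_\alpha^i=\frac{d^\alpha c^i}{dt^\alpha}(0)$; let $z$ be the coordinate of the factor $\mathbb R$ in $T^rQ\times\mathbb R$. Functions and forms are pulled back along the projections $T^sQ\times\mathbb R\to T^rQ\times\mathbb R$, $r\le s$, without change of notation. Let $L\in C^\infty(T^kQ\times\mathbb R)$ be a regular Lagrangian, i.e. the Hessian matrix $\big(\partial^2L/\partial q_k^i\partial q_k^j\big)$ is everywhere nonsingular in natural coordinates. For $1\le\beta\le k$ let $\Delta_\beta=\sum_{\alpha=0}^{k-\beta}\frac{(\beta+\alpha)!}{\alpha!}\,q^i_{\alpha+1}\,\partial/\partial q^i_{\beta+\alpha}$ and $J_\beta=\sum_{\alpha=0}^{k-\beta}\frac{(\beta+\alpha)!}{\alpha!}\,dq^i_\alpha\otimes\partial/\partial q^i_{\beta+\alpha}$ on $T^kQ\times\mathbb R$. For $r\ge k$ and a function or a $1$-form $\xi$ on $T^rQ\times\mathbb R$ let $D_L\xi=\mathcal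 L_\Gamma\xi-\frac{\partial L}{\partial z}\,\xi$ on $T^{r+1}Q\times\mathbb R$, where $\Gamma$ is any vector field on $T^{r+1}Q\times\mathbb R$ of the form $\sum_{\alpha=0}^{r}q^i_{\alpha+1}\,\partial/\partial q^i_\alpha+X^i\,\partial/\partial q^i_{r+1}+L\,\partial/\partial z$ (the result does not depend on $\Gamma$). On $T^{2k-1}Q\times\mathbb R$ put $$E_L=\sum_{\beta=1}^k\frac{(-1)^{\beta-1}}{\beta!}D_L^{\beta-1}(\Delta_\beta L)-L,\qquad \theta_L=\sum_{\beta=1}^k\frac{(-1)^{\beta-1}}{\beta!}D_L^{\beta-1}\big(dL\circ J_\beta\big),\qquad \eta_L=dz-\theta_L .$$ Then there is a unique smooth vector field $R_L$ on $T^{2k-1}Q\times\mathbb R$ with $i(R_L)d\eta_L=0$ and $i(R_L)\eta_L=1$ (the Reeb field), and there is a unique smooth vector field $X_L$ on $T^{2k-1}Q\times\mathbb R$ with $$i(X_L)d\eta_L=dE_L-R_L(E_L)\,\eta_L,\qquad i(X_L)\eta_L=-E_L .$$ The field $X_L$ is holonomic (a semispray of type $1$): each of its integral curves, defined on an open interval,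 is the prolongation to $T^{2k-1}Q\times\mathbb R$ of a smooth curve $(c,z)$ in $Q\times\mathbb R$. Moreover, the integral curves of $X_L$ on an open interval are exactly the prolongations to $T^{2k-1}Q\times\mathbb R$ of the smooth curves $(c,z)$ in $Q\times\mathbb R$ that satisfy the higher-order Herglotz equations together with the equation for $z$: $$\sum_{\alpha=0}^k(-1)^\alpha D_L^\alpha\Big(\frac{\partial L}{\partial q^i_\alpha}\Big)=0\ \text{ along the prolongation of }(c,z)\text{ to }T^{2k}Q\times\mathbb R,\qquad \frac{dz}{dt}=L .$$ -/

import Mathlib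

open Set Topology
open scoped Manifold ContDiff

noncomputable section

namespace HOContact

section Prolongation

variable {E G : Type*} [NormedAddCommGroup E] [NormedSpace ℝ E]
  [NormedAddCommGroup G] [NormedSpace ℝ G]

/-- The total derivative `∑ q_{α+1} ∂F/∂q_α` of a function of `(q₀, …, q_r)`. -/
def totalDeriv {r : ℕ} (F : (Fin (r + 1) → E) → G) : (Fin (r + 2) → E) → G :=
  fun q => fderiv ℝ F (fun j => q j.castSucc) (fun j => q j.succ)

/-- The `j`-th derivative of `g` along a curve, as a function of the derivatives `(q₀, …, q_j)` of
the curve. -/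
def prolongMap (g : E → G) : (j : ℕ) → (Fin (j + 1) → E) → G
  | 0 => fun q => g (q 0)
  | j + 1 => totalDeriv (prolongMap g j)

theorem contDiffOn_prolongMap {g : E → G} {U : Set E} (hU : IsOpen U) (hg : ContDiffOn ℝ ∞ g U) :
    ∀ j : ℕ, ContDiffOn ℝ ∞ (prolongMap g j) {q : Fin (j + 1) → E | q 0 ∈ U}
  | 0 => hg.comp (by fun_prop) (fun _ h => h)
  | j + 1 => by
    have ih := contDiffOn_prolongMap hU hg j
    have ho : IsOpen {q : Fin (j + 1) → E | q 0 ∈ U} := hU.preimage (continuous_apply 0)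
    have h1 := ih.fderiv_of_isOpen (m := ∞) ho (by simp)
    have h2 : ContDiffOn ℝ ∞ (fun q : Fin (j + 2) → E =>
        fderiv ℝ (prolongMap g j) (fun i => q i.castSucc)) {q | q 0 ∈ U} :=
      h1.comp (f := fun (q : Fin (j + 2) → E) (i : Fin (j + 1)) => q i.castSucc)
        (by fun_prop) (fun _ h => h)
    exact h2.clm_apply (by fun_prop)

theorem contDiffOn_iteratedDeriv {u : ℝ → E} {s : Set ℝ} (hs : IsOpen s)
    (hu : ContDiffOn ℝ ∞ u s) (m : ℕ) : ContDiffOn ℝ ∞ (iteratedDeriv m u) s := by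
  induction m with
  | zero => simpa using hu
  | succ m ih =>
    rw [iteratedDeriv_succ]
    exact ((contDiffOn_infty_iff_deriv_of_isOpen hs).1 ih).2

theorem iteratedDeriv_comp_eq_prolongMap {g : E → G} {U : Set E} (hU : IsOpen U)
    (hg : ContDiffOn ℝ ∞ g U) {u : ℝ → E} {s : Set ℝ} (hs : IsOpen s) (hu : ContDiffOn ℝ ∞ u s)
    (hsU : ∀ t ∈ s, u t ∈ U) (j : ℕ) :
    ∀ t ∈ s, iteratedDeriv j (fun x => g (u x)) t =
      prolongMap g j (fun i : Fin (j + 1) => iteratedDeriv (i : ℕ) u t) := by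
  induction j with
  | zero => intro t _; simp [prolongMap]
  | succ j ih =>
    intro t ht
    rw [iteratedDeriv_succ]
    have hev : iteratedDeriv j (fun x => g (u x)) =ᶠ[𝓝 t]
        fun t => prolongMap g j (fun i : Fin (j + 1) => iteratedDeriv (i : ℕ) u t) :=
      Filter.eventuallyEq_of_mem (hs.mem_nhds ht) ih
    rw [hev.deriv_eq]
    have hd : HasDerivAt (fun t => (fun i : Fin (j + 1) => iteratedDeriv (i : ℕ) u t))
        (fun i : Fin (j + 1) => iteratedDeriv ((i : ℕ) + 1) u t) t := by
      rw [hasDerivAt_pi]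
      intro i
      rw [iteratedDeriv_succ]
      exact (((contDiffOn_iteratedDeriv hs hu i).contDiffAt (hs.mem_nhds ht)).differentiableAt
        (by simp)).hasDerivAt
    have ho : IsOpen {q : Fin (j + 1) → E | q 0 ∈ U} := hU.preimage (continuous_apply 0)
    have hF : DifferentiableAt ℝ (prolongMap g j)
        (fun i : Fin (j + 1) => iteratedDeriv (i : ℕ) u t) :=
      ((contDiffOn_prolongMap hU hg j).contDiffAt
        (ho.mem_nhds (by simpa using hsU t ht))).differentiableAt (by simp)
    exact (hF.hasFDerivAt.comp_hasDerivAt t hd).deriv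

/-- The polynomial curve with prescribed derivatives at `0`. -/
def polyCurve {r : ℕ} (q : Fin (r + 1) → E) : ℝ → E :=
  fun t => ∑ j : Fin (r + 1), (((j : ℕ).factorial : ℝ)⁻¹ * t ^ (j : ℕ)) • q j

theorem contDiff_polyCurve {r : ℕ} (q : Fin (r + 1) → E) : ContDiff ℝ ∞ (polyCurve q) := by
  unfold polyCurve; fun_prop

theorem iteratedDeriv_smul_vec (v : E) (m : ℕ) :
    ∀ {f : ℝ → ℝ}, ContDiff ℝ ∞ f → ∀ t : ℝ,
      iteratedDeriv m (fun t => f t • v) t = iteratedDeriv m f t • v := by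
  induction m with
  | zero => intro f _ t; simp
  | succ m ih =>
    intro f hf t
    rw [iteratedDeriv_succ', iteratedDeriv_succ']
    have h : deriv (fun t => f t • v) = fun t => deriv f t • v := by
      funext x
      exact ((hf.differentiable (by simp) x).hasDerivAt.smul_const v).deriv
    rw [h]
    exact ih (contDiff_infty_iff_deriv.1 hf).2 t

theorem iteratedDeriv_polyCurve {r : ℕ} (q : Fin (r + 1) → E) (i : Fin (r + 1)) :
    iteratedDeriv (i : ℕ) (polyCurve q) 0 = q i := by
  unfold polyCurve
  have := iteratedDeriv_sum (n := (i : ℕ)) (x := (0 : ℝ)) (I := Finset.univ)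
    (f := fun (j : Fin (r + 1)) (t : ℝ) => (((j : ℕ).factorial : ℝ)⁻¹ * t ^ (j : ℕ)) • q j)
    (fun j _ => by fun_prop)
  have e : (fun t : ℝ => ∑ j : Fin (r + 1), (((j : ℕ).factorial : ℝ)⁻¹ * t ^ (j : ℕ)) • q j)
      = ∑ j : Fin (r + 1), fun t : ℝ => (((j : ℕ).factorial : ℝ)⁻¹ * t ^ (j : ℕ)) • q j := by
    funext t; simp
  rw [e, this, Finset.sum_eq_single i]
  · rw [iteratedDeriv_smul_vec _ _ (by fun_prop), iteratedDeriv_const_mul_field,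
      iteratedDeriv_fun_pow_zero]
    simp [Nat.factorial_ne_zero]
  · intro j _ hj
    rw [iteratedDeriv_smul_vec _ _ (by fun_prop), iteratedDeriv_const_mul_field,
      iteratedDeriv_fun_pow_zero]
    have : (i : ℕ) ≠ j := fun h => hj (Fin.ext h.symm)
    simp [this]
  · simp

end Prolongation


section Jets

variable (E : Type*) [NormedAddCommGroup E] [NormedSpace ℝ E]
  (Q : Type*) [TopologicalSpace Q] [ChartedSpace E Q]

variable {Q} in
/-- Smoothness of a curve in a neighbourhood of `0`. -/
def SmoothNearZero (c : ℝ → Q) : Prop :=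
  ∀ᶠ t in 𝓝 (0 : ℝ), ContMDiffAt 𝓘(ℝ, ℝ) 𝓘(ℝ, E) ∞ c t

/-- Curves in `Q`, smooth in a neighbourhood of `0`. -/
structure CurveAtZero where
  toFun : ℝ → Q
  smooth : SmoothNearZero E toFun

variable {E Q} in
/-- The derivatives at `0`, up to order `r`, of a curve read in a chart. -/
def curveCoords (r : ℕ) (e : OpenPartialHomeomorph Q E) (c : ℝ → Q) : Fin (r + 1) → E :=
  fun j => iteratedDeriv (j : ℕ) (fun t => e (c t)) 0

/-- Two curves have the same `r`-jet at `0` if they pass through the same point at time `0` and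
have the same derivatives up to order `r` there, in the charts of the atlas around that point. -/
def jetSetoid (r : ℕ) : Setoid (CurveAtZero E Q) where
  r c₁ c₂ := c₁.toFun 0 = c₂.toFun 0 ∧ ∀ e ∈ atlas E Q, c₁.toFun 0 ∈ e.source →
    curveCoords r e c₁.toFun = curveCoords r e c₂.toFun
  iseqv :=
    { refl := fun _ => ⟨rfl, fun _ _ _ => rfl⟩
      symm := fun h => ⟨h.1.symm, fun e he hx => (h.2 e he (h.1 ▸ hx)).symm⟩
      trans := fun h h' => ⟨h.1.trans h'.1, fun e he hx =>
        (h.2 e he hx).trans (h'.2 e he (h.1 ▸ hx))⟩ }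

/-- The tangent bundle of order `r` of `Q`: the `r`-jets at `0` of smooth curves in `Q`. -/
def TJet (r : ℕ) : Type _ := Quotient (jetSetoid E Q r)

variable {E Q}

open Classical in
/-- A curve smooth near `0`, with a constant curve as junk value if `c` is not smooth near `0`. -/
def CurveAtZero.ofFun (c : ℝ → Q) : CurveAtZero E Q :=
  if h : SmoothNearZero E c then ⟨c, h⟩
  else ⟨fun _ => c 0, Filter.Eventually.of_forall fun _ => contMDiffAt_const⟩

namespace TJet

variable {r s : ℕ}

/-- The `r`-jet at `0` of a curve. -/
def mk (r : ℕ) (c : CurveAtZero E Q) : TJet E Q r := Quotient.mk (jetSetoid E Q r) c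

/-- The canonical projection to `Q`. -/
def base : TJet E Q r → Q := Quotient.lift (fun c => c.toFun 0) fun _ _ h => h.1

/-- The canonical projection between tangent bundles of different orders. -/
def proj (h : r ≤ s) : TJet E Q s → TJet E Q r :=
  Quotient.lift (fun c => mk r c) fun _ _ hc => Quotient.sound ⟨hc.1, fun e he hx => by
    funext j
    exact congrFun (hc.2 e he hx) ⟨j, by omega⟩⟩

/-- The coordinates `(q₀, …, q_r)` of a jet in the natural chart induced by the chart `e`. -/
def coords (e : OpenPartialHomeomorph Q E) (p : TJet E Q r) : Fin (r + 1) → E :=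
  curveCoords r e (Quotient.out p).toFun

variable (E r) in
/-- The `r`-jet at `0` of a curve. -/
def ofCurve (c : ℝ → Q) : TJet E Q r := mk r (CurveAtZero.ofFun c)

@[simp] theorem base_mk (c : CurveAtZero E Q) : base (mk r c) = c.toFun 0 := rfl

@[simp] theorem proj_mk (h : r ≤ s) (c : CurveAtZero E Q) : proj h (mk s c) = mk r c := rfl

theorem ind {P : TJet E Q r → Prop} (h : ∀ c, P (mk r c)) (p : TJet E Q r) : P p :=
  Quotient.ind h p

theorem mk_eq_mk {c₁ c₂ : CurveAtZero E Q} : mk r c₁ = mk r c₂ ↔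
    c₁.toFun 0 = c₂.toFun 0 ∧ ∀ e ∈ atlas E Q, c₁.toFun 0 ∈ e.source →
      curveCoords r e c₁.toFun = curveCoords r e c₂.toFun :=
  Quotient.eq (r := jetSetoid E Q r)

theorem coords_mk {e : OpenPartialHomeomorph Q E} (he : e ∈ atlas E Q) (c : CurveAtZero E Q)
    (hx : c.toFun 0 ∈ e.source) : coords e (mk r c) = curveCoords r e c.toFun := by
  have := Quotient.exact (Quotient.out_eq (mk r c))
  exact this.2 e he (by rw [this.1]; exact hx)

theorem ofFun_eq {c : ℝ → Q} (h : SmoothNearZero E c) : CurveAtZero.ofFun c = ⟨c, h⟩ := by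
  rw [CurveAtZero.ofFun, dif_pos h]

@[simp] theorem ofFun_zero (c : ℝ → Q) : (CurveAtZero.ofFun (E := E) c).toFun 0 = c 0 := by
  unfold CurveAtZero.ofFun; split_ifs <;> rfl

theorem ofCurve_eq {c : ℝ → Q} (h : SmoothNearZero E c) : ofCurve E r c = mk r ⟨c, h⟩ := by
  rw [ofCurve, ofFun_eq h]

@[simp] theorem base_ofCurve (c : ℝ → Q) : base (ofCurve E r c) = c 0 := by
  simp [ofCurve]

theorem polyCurve_zero (q : Fin (r + 1) → E) : polyCurve q 0 = q 0 := by
  simpa using iteratedDeriv_polyCurve q 0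

theorem curveCoords_poly {Q : Type*} [TopologicalSpace Q] {e : OpenPartialHomeomorph Q E}
    {q : Fin (r + 1) → E} (hq : q 0 ∈ e.target) :
    curveCoords r e (fun t => e.symm (polyCurve q t)) = q := by
  funext j
  have hcont : ContinuousAt (polyCurve q) 0 := (contDiff_polyCurve q).continuous.continuousAt
  have := hcont.eventually (e.open_target.mem_nhds (by rw [polyCurve_zero]; exact hq))
  have hev : (fun t => e (e.symm (polyCurve q t))) =ᶠ[𝓝 0] polyCurve q := by
    filter_upwards [this] with t ht
    exact e.right_inv ht
  unfold curveCoords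
  rw [hev.iteratedDeriv_eq, iteratedDeriv_polyCurve]

variable [IsManifold 𝓘(ℝ, E) ∞ Q]

theorem contDiffOn_transition {e e' : OpenPartialHomeomorph Q E} (he : e ∈ atlas E Q)
    (he' : e' ∈ atlas E Q) : ContDiffOn ℝ ∞ (fun x => e' (e.symm x)) (e.symm.trans e').source := by
  have h := HasGroupoid.compatible (G := contDiffGroupoid ∞ 𝓘(ℝ, E)) he he'
  have := (contDiffGroupoid ∞ 𝓘(ℝ, E)).mem_of_eqOnSource h (Setoid.refl _)
  simpa [contDiffGroupoid, contDiffPregroupoid, Function.comp_def] using h.1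

/-- Change of natural coordinates for jets of curves. -/
theorem curveCoords_change {e e' : OpenPartialHomeomorph Q E} (he : e ∈ atlas E Q)
    (he' : e' ∈ atlas E Q) {c : ℝ → Q} (hc : SmoothNearZero E c) (hx : c 0 ∈ e.source)
    (hx' : c 0 ∈ e'.source) (j : Fin (r + 1)) :
    curveCoords r e' c j = prolongMap (fun x => e' (e.symm x)) j
      (fun i => curveCoords r e c ⟨i, by omega⟩) := by
  have hcont : ContinuousAt c 0 := hc.self_of_nhds.continuousAt
  have h1 : ∀ᶠ t in 𝓝 (0 : ℝ), ContMDiffAt 𝓘(ℝ, ℝ) 𝓘(ℝ, E) ∞ c t ∧ c t ∈ e.source ∧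
      c t ∈ e'.source :=
    hc.and ((hcont.eventually (e.open_source.mem_nhds hx)).and
      (hcont.eventually (e'.open_source.mem_nhds hx')))
  obtain ⟨s, hs, hso, hs0⟩ := eventually_nhds_iff.1 h1
  have hu : ContDiffOn ℝ ∞ (fun t => e (c t)) s := fun t ht => by
    have : ContMDiffAt 𝓘(ℝ, ℝ) 𝓘(ℝ, E) ∞ (fun t => e (c t)) t :=
      (contMDiffAt_of_mem_maximalAtlas (IsManifold.subset_maximalAtlas he)
        (hs t ht).2.1).comp t (hs t ht).1
    exact this.contDiffAt.contDiffWithinAt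
  have key := iteratedDeriv_comp_eq_prolongMap (e.symm.trans e').open_source
    (contDiffOn_transition he he') hso hu (fun t ht => by
      simp [e.map_source (hs t ht).2.1, e.left_inv (hs t ht).2.1, (hs t ht).2.2]) j 0 hs0
  have hev : (fun t => e' (c t)) =ᶠ[𝓝 0] fun t => e' (e.symm (e (c t))) :=
    Filter.eventuallyEq_of_mem (hso.mem_nhds hs0) fun t ht => by
      simp [e.left_inv (hs t ht).2.1]
  unfold curveCoords
  rw [hev.iteratedDeriv_eq, key]

theorem smoothNearZero_poly {e : OpenPartialHomeomorph Q E} (he : e ∈ atlas E Q)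
    {q : Fin (r + 1) → E} (hq : q 0 ∈ e.target) :
    SmoothNearZero E (fun t => e.symm (polyCurve q t)) := by
  have hcont : ContinuousAt (polyCurve q) 0 := (contDiff_polyCurve q).continuous.continuousAt
  have := hcont.eventually (e.open_target.mem_nhds (by rw [polyCurve_zero]; exact hq))
  filter_upwards [this] with t ht
  exact (contMDiffAt_symm_of_mem_maximalAtlas (IsManifold.subset_maximalAtlas he) ht).comp t
    (contDiff_polyCurve q).contMDiff.contMDiffAt

theorem mk_eq_mk_of_chart {e : OpenPartialHomeomorph Q E} (he : e ∈ atlas E Q)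
    {c₁ c₂ : CurveAtZero E Q} (h0 : c₁.toFun 0 = c₂.toFun 0) (hx : c₁.toFun 0 ∈ e.source)
    (h : curveCoords r e c₁.toFun = curveCoords r e c₂.toFun) : mk r c₁ = mk r c₂ := by
  rw [mk_eq_mk]
  refine ⟨h0, fun e' he' hx' => ?_⟩
  funext j
  rw [curveCoords_change he he' c₁.smooth hx hx', h,
    ← curveCoords_change he he' c₂.smooth (h0 ▸ hx) (h0 ▸ hx')]

variable (r) in
/-- The natural chart of the tangent bundle of order `r` induced by a chart of `Q`, with
coordinates `(q₀, …, q_r)`. -/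
def natChart (e : atlas E Q) : PartialEquiv (TJet E Q r) (Fin (r + 1) → E) where
  toFun := coords e.1
  invFun q := ofCurve E r fun t => e.1.symm (polyCurve q t)
  source := {p | base p ∈ e.1.source}
  target := {q | q 0 ∈ e.1.target}
  map_source' p hp := by
    induction p using ind with
    | h c =>
      rw [mem_ofPred_eq, base_mk] at hp
      rw [mem_ofPred_eq, coords_mk e.2 c hp]
      simpa [curveCoords] using e.1.map_source hp
  map_target' q hq := by
    simpa [polyCurve_zero] using e.1.map_target hq
  left_inv' p hp := by
    induction p using ind with
    | h c =>
      rw [mem_ofPred_eq, base_mk] at hp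
      have h0 : curveCoords r e.1 c.toFun 0 = e.1 (c.toFun 0) := by simp [curveCoords]
      have hq : curveCoords r e.1 c.toFun 0 ∈ e.1.target := h0 ▸ e.1.map_source hp
      rw [coords_mk e.2 c hp, ofCurve_eq (smoothNearZero_poly e.2 hq)]
      have hb : e.1.symm (polyCurve (curveCoords r e.1 c.toFun) 0) = c.toFun 0 := by
        rw [polyCurve_zero, h0, e.1.left_inv hp]
      refine mk_eq_mk_of_chart e.2 hb ?_ (curveCoords_poly hq)
      simpa only [hb] using hp
  right_inv' q hq := by
    rw [ofCurve_eq (smoothNearZero_poly e.2 hq), coords_mk e.2, curveCoords_poly hq]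
    simpa [polyCurve_zero] using e.1.map_target hq

theorem natChart_trans_source (e e' : atlas E Q) :
    ((natChart r e).symm.trans (natChart r e')).source =
      {q | q 0 ∈ (e.1.symm.trans e'.1).source} := by
  ext q
  simp only [natChart, PartialEquiv.trans_source, PartialEquiv.symm_source, mem_inter_iff,
    mem_ofPred_eq, mem_preimage, OpenPartialHomeomorph.trans_source]
  refine and_congr_right fun hq => ?_
  simp [polyCurve_zero]

theorem isOpen_natChart_trans_source (e e' : atlas E Q) :
    IsOpen ((natChart r e).symm.trans (natChart r e')).source := by
  rw [natChart_trans_source]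
  exact (e.1.symm.trans e'.1).open_source.preimage (continuous_apply 0)

/-- The changes of natural coordinates are smooth. -/
theorem contDiffOn_natChart_trans (e e' : atlas E Q) :
    ContDiffOn ℝ ∞ ((natChart r e).symm.trans (natChart r e'))
      ((natChart r e).symm.trans (natChart r e')).source := by
  have h : ContDiffOn ℝ ∞ (fun (q : Fin (r + 1) → E) (j : Fin (r + 1)) =>
      prolongMap (fun x => e'.1 (e.1.symm x)) j (fun i : Fin (j + 1) => q ⟨i, by omega⟩))
      ((natChart r e).symm.trans (natChart r e')).source := by
    rw [contDiffOn_pi, natChart_trans_source]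
    intro j
    exact (contDiffOn_prolongMap (e.1.symm.trans e'.1).open_source
      (contDiffOn_transition e.2 e'.2) j).comp
      (f := fun (q : Fin (r + 1) → E) (i : Fin (j + 1)) => q ⟨i, by omega⟩)
      (by fun_prop) (fun _ h => h)
  refine h.congr fun q hq => ?_
  rw [natChart_trans_source] at hq
  have hq1 : q 0 ∈ e.1.target := by
    simp at hq; exact hq.1
  have hq2 : e.1.symm (q 0) ∈ e'.1.source := by
    simp at hq; exact hq.2
  funext j
  have hx : e.1.symm (polyCurve q 0) ∈ e.1.source := by
    simpa [polyCurve_zero] using e.1.map_target hq1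
  have hx' : e.1.symm (polyCurve q 0) ∈ e'.1.source := by simpa [polyCurve_zero] using hq2
  change coords e'.1 (ofCurve E r fun t => e.1.symm (polyCurve q t)) j = _
  rw [ofCurve_eq (smoothNearZero_poly e.2 hq1), coords_mk e'.2 _ hx',
    curveCoords_change e.2 e'.2 (smoothNearZero_poly e.2 hq1) hx hx' j, curveCoords_poly hq1]

variable (E Q r) in
/-- The natural atlas of the tangent bundle of order `r`. -/
def chartedSpaceCore : ChartedSpaceCore (Fin (r + 1) → E) (TJet E Q r) where
  atlas := Set.range (natChart r)
  chartAt p := natChart r ⟨chartAt E (base p), chart_mem_atlas E (base p)⟩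
  mem_chart_source p := mem_chart_source E (base p)
  chart_mem_atlas _ := mem_range_self _
  open_source := by
    rintro _ _ ⟨e, rfl⟩ ⟨e', rfl⟩
    exact isOpen_natChart_trans_source e e'
  continuousOn_toFun := by
    rintro _ _ ⟨e, rfl⟩ ⟨e', rfl⟩
    exact (contDiffOn_natChart_trans e e').continuousOn

instance : TopologicalSpace (TJet E Q r) := (chartedSpaceCore E Q r).toTopologicalSpace

instance : ChartedSpace (Fin (r + 1) → E) (TJet E Q r) := (chartedSpaceCore E Q r).toChartedSpace

instance : IsManifold 𝓘(ℝ, Fin (r + 1) → E) ∞ (TJet E Q r) := by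
  refine isManifold_of_contDiffOn _ _ _ fun e e' he he' => ?_
  simp only [atlas, ChartedSpace.atlas, chartedSpaceCore, mem_iUnion, mem_range] at he he'
  obtain ⟨_, ⟨f, rfl⟩, rfl⟩ := he
  obtain ⟨_, ⟨f', rfl⟩, rfl⟩ := he'
  have h := contDiffOn_natChart_trans (r := r) f f'
  simp only [modelWithCornersSelf_coe, modelWithCornersSelf_coe_symm, range_id, inter_univ,
    preimage_id, Function.id_comp, Function.comp_id]
  exact h

/-- The preferred chart at `p` is the natural chart of the preferred chart at the base point. -/
theorem chartAt_apply (p p' : TJet E Q r) :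
    chartAt (Fin (r + 1) → E) p p' = coords (chartAt E (base p)) p' := rfl

variable (E r) in
/-- The canonical lift of a curve `c` to the tangent bundle of order `r`: at time `t` it is the
`r`-jet at `0` of `s ↦ c (t + s)`. -/
def lift (c : ℝ → Q) (t : ℝ) : TJet E Q r := ofCurve E r fun s => c (t + s)

end TJet

end Jets

section Forms

variable {V : Type*} [NormedAddCommGroup V] [NormedSpace ℝ V] {H : Type*} [TopologicalSpace H]
  {M : Type*} [TopologicalSpace M] [ChartedSpace H M]

/-- The differential at `p` of a function on a manifold. -/
def diff (I : ModelWithCorners ℝ V H) {G : Type*} [NormedAddCommGroup G] [NormedSpace ℝ G]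
    (F : M → G) (p : M) : TangentSpace I p →L[ℝ] G :=
  mfderiv I 𝓘(ℝ, G) F p

/-- The exterior derivative of a `1`-form `ξ` on a manifold without boundary, in the form
`u ↦ i(u) dξ` at the point `p`. It is computed in the chart `φ` at `p`: with `ξ' = (φ⁻¹)^* ξ`,
one has `dξ (u, v) = D ξ' (Dφ u) (Dφ v) - D ξ' (Dφ v) (Dφ u)`. -/
def extDerivOneForm (I : ModelWithCorners ℝ V H) (ξ : ∀ p : M, TangentSpace I p →L[ℝ] ℝ) (p : M)
    (u : TangentSpace I p) : TangentSpace I p →L[ℝ] ℝ :=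
  let ξ' : V → V →L[ℝ] ℝ := fun y =>
    (ξ ((extChartAt I p).symm y)).comp (mfderiv 𝓘(ℝ, V) I (extChartAt I p).symm y)
  let A : V →L[ℝ] V →L[ℝ] ℝ := fderiv ℝ ξ' (extChartAt I p p)
  let D : TangentSpace I p →L[ℝ] V := mfderiv I 𝓘(ℝ, V) (extChartAt I p) p
  ((A - A.flip) (D u)).comp D

/-- Smooth vector fields on a manifold. -/
def IsSmoothField (I : ModelWithCorners ℝ V H) [IsManifold I 1 M]
    (X : ∀ p : M, TangentSpace I p) : Prop :=
  ContMDiff I I.tangent ∞ fun p => (⟨p, X p⟩ : TangentBundle I M)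

end Forms

section Lagrangian

variable (E : Type*) [NormedAddCommGroup E] [NormedSpace ℝ E]
  (Q : Type*) [TopologicalSpace Q] [ChartedSpace E Q]

/-- The extended tangent bundle of order `r`, that is `T^r Q × ℝ`. -/
abbrev Ext (r : ℕ) : Type _ := TJet E Q r × ℝ

/-- The model with corners of `T^r Q × ℝ`. -/
abbrev extModel (r : ℕ) :
    ModelWithCorners ℝ ((Fin (r + 1) → E) × ℝ) (ModelProd (Fin (r + 1) → E) ℝ) :=
  𝓘(ℝ, Fin (r + 1) → E).prod 𝓘(ℝ, ℝ)

variable {E Q}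

/-- The canonical projection `T^s Q × ℝ → T^r Q × ℝ`. -/
def extProj {r s : ℕ} (h : r ≤ s) (p : Ext E Q s) : Ext E Q r := (TJet.proj h p.1, p.2)

variable [IsManifold 𝓘(ℝ, E) ∞ Q] {G : Type*} [NormedAddCommGroup G] [NormedSpace ℝ G]

/- The tangent space at `p` of a manifold is, in Mathlib, the model vector space, by means of the
preferred chart at `p`. So a tangent vector to `T^r Q × ℝ` at `p` is a pair of a family
`(v₀, …, v_r)` and a number `w`, its components with respect to `∂/∂q_α` and `∂/∂z` in the natural
coordinates induced by the preferred chart of `Q` at the base point of `p`. -/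

/-- The vertical endomorphism `J_r` of `T(T^k Q × ℝ)`: the component of `J_r v` along `∂/∂q_a`
is `a! / (a - r)! v_{a-r}` for `r ≤ a`, and zero for `a < r`; the component along `∂/∂z` is
zero. -/
def vertEnd {k : ℕ} (r : ℕ) (p : Ext E Q k) :
    TangentSpace (extModel E k) p →L[ℝ] TangentSpace (extModel E k) p :=
  let A : (Fin (k + 1) → E) →L[ℝ] (Fin (k + 1) → E) :=
    ContinuousLinearMap.pi fun a => if r ≤ (a : ℕ) then
      ((a : ℕ).factorial / ((a : ℕ) - r).factorial : ℝ) •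
        ContinuousLinearMap.proj (R := ℝ) (φ := fun _ => E) ⟨(a : ℕ) - r, by omega⟩
      else 0
  A.prodMap (0 : ℝ →L[ℝ] ℝ)

/-- The canonical vector fields `Δ_{r+1}` on `T^k Q × ℝ`: the component along `∂/∂q_a` is
`a! / (a - r - 1)! q_{a-r}` for `r + 1 ≤ a`, and zero otherwise; the component along `∂/∂z` is
zero. -/
def canonField {k : ℕ} (r : ℕ) (p : Ext E Q k) : TangentSpace (extModel E k) p :=
  ((fun a : Fin (k + 1) => if r + 1 ≤ (a : ℕ) then
      ((a : ℕ).factorial / ((a : ℕ) - (r + 1)).factorial : ℝ) •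
        p.1.coords (chartAt E p.1.base) ⟨(a : ℕ) - r, by omega⟩
      else 0), (0 : ℝ))

/-- The derivative `∂L/∂z`. -/
def derivZ {k : ℕ} (L : Ext E Q k → ℝ) (p : Ext E Q k) : ℝ :=
  diff (extModel E k) L p ((0 : Fin (k + 1) → E), (1 : ℝ))

/-- The vector `q₁ ∂/∂q₀ + ⋯ + q_{r+1} ∂/∂q_r + L ∂/∂z`, tangent to `T^r Q × ℝ`, `r = k + a`, at
the projection of the point `p = (q₀, …, q_{r+1}, z)` of `T^{r+1} Q × ℝ`. It is the projection of
`Γ p`, for every semispray `Γ` of type `1` on `T^{r+1} Q × ℝ` with `i(Γ) dz = L`. -/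
def totalVec {k a : ℕ} (L : Ext E Q k → ℝ) (p : Ext E Q (k + a + 1)) :
    TangentSpace (extModel E (k + a)) (extProj (Nat.le_succ (k + a)) p) :=
  ((fun j : Fin (k + a + 1) => p.1.coords (chartAt E p.1.base) j.succ),
    L (extProj (by omega : k ≤ k + a + 1) p))

/-- The Lagrangian total derivative `D_L F = Lie(Γ) F - (∂L/∂z) F` of functions, with values in
a normed space. -/
def lagDeriv {k a : ℕ} (L : Ext E Q k → ℝ) (F : Ext E Q (k + a) → G) :
    Ext E Q (k + a + 1) → G := fun p =>
  diff (extModel E (k + a)) F (extProj (Nat.le_succ (k + a)) p) (totalVec L p)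
    - derivZ L (extProj (by omega : k ≤ k + a + 1) p) • F (extProj (Nat.le_succ (k + a)) p)

/-- The iterates of `D_L` on functions. -/
def lagDerivIter {k : ℕ} (L : Ext E Q k → ℝ) (F : Ext E Q k → G) : (a : ℕ) → Ext E Q (k + a) → G
  | 0 => F
  | a + 1 => lagDeriv L (lagDerivIter L F a)

/-- The pullback of a `1`-form along a projection `T^s Q × ℝ → T^r Q × ℝ`. -/
def pullForm {r s : ℕ} (h : r ≤ s) (ξ : ∀ p : Ext E Q r, TangentSpace (extModel E r) p →L[ℝ] ℝ)
    (p : Ext E Q s) : TangentSpace (extModel E s) p →L[ℝ] ℝ :=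
  (ξ (extProj h p)).comp (mfderiv (extModel E s) (extModel E r) (extProj h) p)

/-- The Lagrangian total derivative `D_L ξ = Lie(Γ) ξ - (∂L/∂z) ξ` of `1`-forms. Here the Lie
derivative is given by Cartan's formula `Lie(Γ) ξ = i(Γ) dξ + d (i(Γ) ξ)`, in which only the
projection of `Γ` occurs. -/
def lagDerivForm {k a : ℕ} (L : Ext E Q k → ℝ)
    (ξ : ∀ p : Ext E Q (k + a), TangentSpace (extModel E (k + a)) p →L[ℝ] ℝ) :
    ∀ p : Ext E Q (k + a + 1), TangentSpace (extModel E (k + a + 1)) p →L[ℝ] ℝ := fun p =>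
  (extDerivOneForm (extModel E (k + a)) ξ (extProj (Nat.le_succ (k + a)) p) (totalVec L p)).comp
      (mfderiv (extModel E (k + a + 1)) (extModel E (k + a)) (extProj (Nat.le_succ (k + a))) p)
    + diff (extModel E (k + a + 1))
      (fun p' => ξ (extProj (Nat.le_succ (k + a)) p') (totalVec L p')) p
    - derivZ L (extProj (by omega : k ≤ k + a + 1) p) • pullForm (Nat.le_succ (k + a)) ξ p

/-- The iterates of `D_L` on `1`-forms. -/
def lagDerivFormIter {k : ℕ} (L : Ext E Q k → ℝ)
    (ξ : ∀ p : Ext E Q k, TangentSpace (extModel E k) p →L[ℝ] ℝ) :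
    (a : ℕ) → ∀ p : Ext E Q (k + a), TangentSpace (extModel E (k + a)) p →L[ℝ] ℝ
  | 0 => ξ
  | a + 1 => lagDerivForm L (lagDerivFormIter L ξ a)

/-- The Lagrangian energy
`E_L = ∑_{β=1}^k (-1)^{β-1} / β! D_L^{β-1} (Δ_β L) - L`, where `β = b + 1`. -/
def energy {k : ℕ} (L : Ext E Q k → ℝ) (p : Ext E Q (2 * k - 1)) : ℝ :=
  ∑ b : Fin k, ((-1 : ℝ) ^ (b : ℕ) / ((b : ℕ) + 1).factorial) *
      lagDerivIter L (fun p' => diff (extModel E k) L p' (canonField (b : ℕ) p')) b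
        (extProj (by omega : k + (b : ℕ) ≤ 2 * k - 1) p)
    - L (extProj (by omega : k ≤ 2 * k - 1) p)

/-- The Cartan form `θ_L = ∑_{β=1}^k (-1)^{β-1} / β! D_L^{β-1} i(J_β) dL`, where `β = b + 1`. -/
def cartanForm {k : ℕ} (L : Ext E Q k → ℝ) (p : Ext E Q (2 * k - 1)) :
    TangentSpace (extModel E (2 * k - 1)) p →L[ℝ] ℝ :=
  ∑ b : Fin k, ((-1 : ℝ) ^ (b : ℕ) / ((b : ℕ) + 1).factorial) •
      pullForm (by omega : k + (b : ℕ) ≤ 2 * k - 1)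
        (lagDerivFormIter L
          (fun p' => (diff (extModel E k) L p').comp (vertEnd ((b : ℕ) + 1) p')) b) p

/-- The contact Lagrangian form `η_L = dz - θ_L`. -/
def contactForm {k : ℕ} (L : Ext E Q k → ℝ) (p : Ext E Q (2 * k - 1)) :
    TangentSpace (extModel E (2 * k - 1)) p →L[ℝ] ℝ :=
  diff (extModel E (2 * k - 1)) (fun p' : Ext E Q (2 * k - 1) => p'.2) p - cartanForm L p

/-- Vector fields on `T^{2k-1} Q × ℝ`. -/
abbrev Field (E : Type*) [NormedAddCommGroup E] [NormedSpace ℝ E] (Q : Type*) [TopologicalSpace Q]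
    [ChartedSpace E Q] [IsManifold 𝓘(ℝ, E) ∞ Q] (r : ℕ) : Type _ :=
  ∀ p : Ext E Q r, TangentSpace (extModel E r) p

/-- `R` is a Reeb vector field: `i(R) dη_L = 0` and `i(R) η_L = 1`. -/
def IsReebField {k : ℕ} (L : Ext E Q k → ℝ) (R : Field E Q (2 * k - 1)) : Prop :=
  ∀ p, extDerivOneForm (extModel E (2 * k - 1)) (contactForm L) p (R p) = 0 ∧
    contactForm L p (R p) = 1

/-- The contact Lagrangian equations `i(X) dη_L = dE_L - R(E_L) η_L` and `i(X) η_L = -E_L`. -/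
def IsContactLagrangianField {k : ℕ} (L : Ext E Q k → ℝ) (R X : Field E Q (2 * k - 1)) : Prop :=
  ∀ p, extDerivOneForm (extModel E (2 * k - 1)) (contactForm L) p (X p) =
      diff (extModel E (2 * k - 1)) (energy L) p
        - diff (extModel E (2 * k - 1)) (energy L) p (R p) • contactForm L p ∧
    contactForm L p (X p) = -energy L p

/-- The local expression of a function on `T^k Q × ℝ` in the natural coordinates
`(q₀, …, q_k, z)` induced by a chart of `Q`. -/
def localExpr {k : ℕ} (e : atlas E Q) (L : Ext E Q k → ℝ) : (Fin (k + 1) → E) × ℝ → ℝ :=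
  fun x => L ((TJet.natChart k e).symm x.1, x.2)

/-- The derivative `∂L/∂q_α` in the natural coordinates induced by a chart `e` of `Q`, as a linear
form on the model space (with components `∂L/∂q_α^i`). -/
def partialQ {k : ℕ} (e : atlas E Q) (L : Ext E Q k → ℝ) (α : Fin (k + 1)) (p : Ext E Q k) :
    E →L[ℝ] ℝ :=
  (fderiv ℝ (localExpr e L) (p.1.coords e.1, p.2)).comp
    ((ContinuousLinearMap.inl ℝ (Fin (k + 1) → E) ℝ).comp
      (ContinuousLinearMap.single ℝ (fun _ => E) α))

/-- Regularity of a Lagrangian: in natural coordinates, the Hessian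
`∂²L / ∂q_k^i ∂q_k^j` is everywhere nonsingular. -/
def IsRegular {k : ℕ} (L : Ext E Q k → ℝ) : Prop :=
  ∀ (e : atlas E Q) (p : Ext E Q k), p.1.base ∈ e.1.source → ∀ u : E,
    (∀ v : E, fderiv ℝ (fderiv ℝ (localExpr e L)) (p.1.coords e.1, p.2)
      (Pi.single (Fin.last k) u, 0) (Pi.single (Fin.last k) v, 0) = 0) → u = 0

/-- The function `∑_{α=0}^k (-1)^α D_L^α (∂L/∂q_α^i)` on `T^{2k} Q × ℝ`, in the natural coordinates
induced by the chart `e` of `Q`. -/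
def herglotzExpr {k : ℕ} (e : atlas E Q) (L : Ext E Q k → ℝ) (p : Ext E Q (2 * k)) : E →L[ℝ] ℝ :=
  ∑ α : Fin (k + 1), (-1 : ℝ) ^ (α : ℕ) •
    lagDerivIter L (partialQ e L α) α (extProj (by omega : k + (α : ℕ) ≤ 2 * k) p)

/-- On the set `s` of times, `σ` is the prolongation to `T^r Q × ℝ` of the smooth curve
`(c, z)` in `Q × ℝ`. -/
def IsProlongationOn {r : ℕ} (σ : ℝ → Ext E Q r) (c : ℝ → Q) (z : ℝ → ℝ) (s : Set ℝ) : Prop :=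
  ContMDiffOn 𝓘(ℝ, ℝ) 𝓘(ℝ, E) ∞ c s ∧ ContDiffOn ℝ ∞ z s ∧
    ∀ t ∈ s, σ t = (TJet.lift E r c t, z t)

/-- Holonomic vector fields (semisprays of type `1`) on `T^r Q × ℝ`: every integral curve, defined
on an open interval, is the prolongation of a curve in `Q × ℝ`. -/
def IsHolonomicField {r : ℕ} (X : Field E Q r) : Prop :=
  ∀ (σ : ℝ → Ext E Q r) (s : Set ℝ), IsOpen s → s.OrdConnected →
    IsMIntegralCurveOn (I := extModel E r) σ X s → ∃ c z, IsProlongationOn σ c z s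

/-- The higher-order Herglotz equations for a curve `(c, z)` in `Q × ℝ`, at the times in `s`:
`∑_{α=0}^k (-1)^α D_L^α (∂L/∂q_α^i) = 0` (in all natural coordinates) along the prolongation of the
curve, and `dz/dt = L`. -/
def SatisfiesHerglotzOn {k : ℕ} (L : Ext E Q k → ℝ) (c : ℝ → Q) (z : ℝ → ℝ) (s : Set ℝ) : Prop :=
  ∀ t ∈ s, (∀ e : atlas E Q, c t ∈ e.1.source →
      herglotzExpr e L (TJet.lift E (2 * k) c t, z t) = 0) ∧
    HasDerivAt z (L (TJet.lift E k c t, z t)) t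

end Lagrangian

end HOContact

end

/-! Everything is governed by the Jacobi–Ostrogradsky momenta `p_i = ∑_m (-1)^m D_L^m
(∂L/∂q_{i+1+m})`, `0 ≤ i < k`. In every natural chart `η_L = dz - ∑ p_i dq_i` and `E_L = ∑ p_i
q_{i+1} - L` (`contactForm_eq`, `energy_eq`), and the Herglotz expression is `∂L/∂q_0 - D_L p_0`
(`herglotzExpr_eq`).

These formulas hold because `Lie(Γ) dq_i = dq_{i+1}`: on the coefficients of a form `∑ g_i dq_i`,
`D_L` acts as `D + S`, with `D` componentwise and `S` the index shift. Since `D` and `S` commute,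
the powers of `D + S` expand binomially, and the identity `∑_b (-1)^b C(b,m) C(n,b+1) = (-1)^m`
collapses the sum over `β` to the momenta (`sum_iterated_eq_momentum`). The functions `Δ_β L` are
the same coefficients paired with `q_{i+1}`, so the energy involves the same momenta
(`loc_lagDerivIter_sum`). The vertical endomorphisms, the canonical fields and the total vector are
defined at each point by the preferred chart; the same formulas hold in all natural charts by
`fderiv_prolongMap_seqVert` and by the recursive form of the prolonged coordinate changes.

The recursion `p_i = ∂L/∂q_{i+1} - D_L p_{i+1}`, `p_k = 0`, shows that `p_{k-1-j}` depends only on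
`q_0, …, q_{k+j}, z`, and that its derivative in the direction `q_{k+j}` is `(-1)^j` times the
Hessian of `L` (`hasOrder_momentum`). By this triangular structure regularity makes `dq_a, dp_a` (`a
< k`) and `dz` a coframe: the operator `solOp` is invertible, with smooth inverse. As `dη_L = ∑ dq_a
∧ dp_a`, the Reeb equations say that these forms take the values `0, 0, 1` on `R_L`. It follows that
`R_L(E_L) = -∂L/∂z`, and then the contact equations prescribe the values of the same coframe on
`X_L`. Both fields therefore exist, are unique and are smooth.

For `a ≥ 1` the prescribed value of `dp_a` is `dp_a(Γ)`. Triangularity then forces `X_L` to agree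
with `Γ` in every component but the one along `q_{2k-1}`, which is holonomy. The remaining equation
is `dp_0(X_L) = ∂L/∂q_0 + (∂L/∂z) p_0`; along a prolongation it reads `∂L/∂q_0 - D_L p_0 = 0`, the
Herglotz equation (`eq_contactVec_iff`, `contactVec_lift_iff`). -/

open Set Topology
open scoped Manifold ContDiff

noncomputable section

namespace HOContact

set_option linter.unusedSectionVars false

/-! ### Natural charts of `T^r Q × ℝ`. -/

section Charts

variable {E : Type*} [NormedAddCommGroup E] [NormedSpace ℝ E]
  {Q : Type*} [TopologicalSpace Q] [ChartedSpace E Q] [IsManifold 𝓘(ℝ, E) ∞ Q]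

/-- The natural chart of `T^r Q` as a partial homeomorphism. -/
def natHomeo (e : atlas E Q) (r : ℕ) : OpenPartialHomeomorph (TJet E Q r) (Fin (r + 1) → E) :=
  (TJet.chartedSpaceCore E Q r).openPartialHomeomorph (TJet.natChart r e) (mem_range_self e)

theorem natHomeo_mem_atlas (e : atlas E Q) (r : ℕ) :
    natHomeo e r ∈ atlas (Fin (r + 1) → E) (TJet E Q r) := by
  simp only [atlas, ChartedSpace.atlas, TJet.chartedSpaceCore, mem_iUnion]
  exact ⟨_, mem_range_self e, rfl⟩

/-- The natural chart of `T^r Q × ℝ` as a partial homeomorphism. -/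
def extHomeo (e : atlas E Q) (r : ℕ) :
    OpenPartialHomeomorph (Ext E Q r) (ModelProd (Fin (r + 1) → E) ℝ) :=
  (natHomeo e r).prod (OpenPartialHomeomorph.refl ℝ)

theorem extHomeo_mem_atlas (e : atlas E Q) (r : ℕ) :
    extHomeo e r ∈ atlas (ModelProd (Fin (r + 1) → E) ℝ) (Ext E Q r) :=
  ⟨natHomeo e r, natHomeo_mem_atlas e r, OpenPartialHomeomorph.refl ℝ, by simp, rfl⟩

/-- The natural coordinates `(q₀, …, q_r, z)` on `T^r Q × ℝ` induced by a chart. -/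
def natCoords (e : atlas E Q) (r : ℕ) (p : Ext E Q r) : (Fin (r + 1) → E) × ℝ :=
  (p.1.coords e.1, p.2)

/-- The point with given natural coordinates. -/
def natInv (e : atlas E Q) (r : ℕ) (x : (Fin (r + 1) → E) × ℝ) : Ext E Q r :=
  ((TJet.natChart r e).symm x.1, x.2)

/-- The domain of the natural coordinates. -/
def natSource (e : atlas E Q) (r : ℕ) : Set (Ext E Q r) := {p | p.1.base ∈ e.1.source}

/-- The range of the natural coordinates. -/
def natTarget (e : atlas E Q) (r : ℕ) : Set ((Fin (r + 1) → E) × ℝ) := {x | x.1 0 ∈ e.1.target}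

theorem isOpen_natTarget (e : atlas E Q) (r : ℕ) : IsOpen (natTarget e r) :=
  e.1.open_target.preimage (by fun_prop)

theorem extHomeo_source (e : atlas E Q) (r : ℕ) : (extHomeo e r).source = natSource e r := by
  ext p
  simp only [extHomeo, OpenPartialHomeomorph.prod_source, OpenPartialHomeomorph.refl_source,
    mem_prod, mem_univ, and_true]
  rfl

theorem extHomeo_target (e : atlas E Q) (r : ℕ) :
    (extHomeo e r).target = (natTarget e r : Set ((Fin (r + 1) → E) × ℝ)) := by
  change (natHomeo e r).target ×ˢ (univ : Set ℝ) = _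
  rw [Set.prod_univ]
  rfl

theorem isOpen_natSource (e : atlas E Q) (r : ℕ) : IsOpen (natSource e r) := by
  rw [← extHomeo_source]; exact (extHomeo e r).open_source

theorem natCoords_mem {e : atlas E Q} {r : ℕ} {p : Ext E Q r} (hp : p ∈ natSource e r) :
    natCoords e r p ∈ natTarget e r :=
  (TJet.natChart r e).map_source hp

theorem natInv_mem {e : atlas E Q} {r : ℕ} {x : (Fin (r + 1) → E) × ℝ} (hx : x ∈ natTarget e r) :
    natInv e r x ∈ natSource e r :=
  (TJet.natChart r e).map_target hx

theorem natInv_natCoords {e : atlas E Q} {r : ℕ} {p : Ext E Q r} (hp : p ∈ natSource e r) :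
    natInv e r (natCoords e r p) = p :=
  Prod.ext ((TJet.natChart r e).left_inv hp) rfl

theorem natCoords_natInv {e : atlas E Q} {r : ℕ} {x : (Fin (r + 1) → E) × ℝ}
    (hx : x ∈ natTarget e r) : natCoords e r (natInv e r x) = x :=
  Prod.ext ((TJet.natChart r e).right_inv hx) rfl

theorem natCoords_inj {e : atlas E Q} {r : ℕ} {p p' : Ext E Q r} (hp : p ∈ natSource e r)
    (hp' : p' ∈ natSource e r) (h : natCoords e r p = natCoords e r p') : p = p' := by
  rw [← natInv_natCoords hp, h, natInv_natCoords hp']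

theorem contMDiffAt_natCoords {e : atlas E Q} {r : ℕ} {p : Ext E Q r} (hp : p ∈ natSource e r) :
    ContMDiffAt (extModel E r) 𝓘(ℝ, (Fin (r + 1) → E) × ℝ) ∞ (natCoords e r) p :=
  (extHomeo e r).contMDiffAt_extend (IsManifold.subset_maximalAtlas (extHomeo_mem_atlas e r))
    (by rwa [extHomeo_source])

theorem contMDiffAt_natInv {e : atlas E Q} {r : ℕ} {x : (Fin (r + 1) → E) × ℝ}
    (hx : x ∈ natTarget e r) :
    ContMDiffAt 𝓘(ℝ, (Fin (r + 1) → E) × ℝ) (extModel E r) ∞ (natInv e r) x := by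
  have h := contMDiffOn_extend_symm (I := extModel E r) (n := ∞)
    (IsManifold.subset_maximalAtlas (extHomeo_mem_atlas e r))
  have h' : (extModel E r) '' (extHomeo e r).target = natTarget e r := by
    rw [extHomeo_target]
    change id '' _ = _
    exact image_id _
  rw [h'] at h
  exact (h x hx).contMDiffAt ((isOpen_natTarget e r).mem_nhds hx)

/-- The preferred chart at the base point. -/
def baseChart {r : ℕ} (p : Ext E Q r) : atlas E Q :=
  ⟨chartAt E p.1.base, chart_mem_atlas E _⟩

theorem mem_natSource_baseChart {r : ℕ} (p : Ext E Q r) : p ∈ natSource (baseChart p) r :=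
  mem_chart_source E p.1.base

/-- A tangent vector at `p` is, by definition of the tangent space, its own list of components in
the preferred chart, which here is the natural chart of `baseChart p`. -/
theorem diff_apply_coords {G : Type*} [NormedAddCommGroup G] [NormedSpace ℝ G] {r : ℕ}
    {F : Ext E Q r → G} {p : Ext E Q r}
    (hF : MDifferentiableAt (extModel E r) 𝓘(ℝ, G) F p) (v : TangentSpace (extModel E r) p) :
    diff (extModel E r) F p v = fderiv ℝ (fun x => F (natInv (baseChart p) r x))
      (natCoords (baseChart p) r p) v := by
  have h := hF.mfderiv
  rw [(extModel E r).range_eq_univ, fderivWithin_univ] at h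
  exact DFunLike.congr_fun h v

end Charts

/-! ### The vertical endomorphisms commute with prolonged coordinate changes. -/

section Vertical

variable {E G : Type*} [NormedAddCommGroup E] [NormedSpace ℝ E]
  [NormedAddCommGroup G] [NormedSpace ℝ G]

theorem fderiv_fderiv_symm {f : E → G} {x : E} (h : ContDiffAt ℝ ∞ f x) (a b : E) :
    fderiv ℝ (fderiv ℝ f) x a b = fderiv ℝ (fderiv ℝ f) x b a :=
  (h.isSymmSndFDerivAt (by
    rw [minSmoothness_of_isRCLikeNormedField]; exact WithTop.coe_le_coe.2 le_top)).eq a b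

/-- The restriction of a sequence to its first terms. -/
def seqRes (j : ℕ) (q : ℕ → E) : Fin (j + 1) → E := fun i => q i

/-- The shift of sequences. -/
def seqShift (q : ℕ → E) : ℕ → E := fun i => q (i + 1)

/-- The operation on sequences `(J_r v)_i = i! / (i - r)! v_{i - r}`. -/
def seqVert (r : ℕ) (v : ℕ → E) : ℕ → E := fun i =>
  if r ≤ i then ((i.factorial : ℝ) / (i - r).factorial) • v (i - r) else 0

theorem seqVert_zero (v : ℕ → E) : seqVert 0 v = v := by
  funext i
  have : (i.factorial : ℝ) ≠ 0 := by positivity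
  simp [seqVert, this]

theorem seqVert_one_succ (v : ℕ → E) (i : ℕ) :
    seqVert 1 v (i + 1) = ((i : ℝ) + 1) • v i := by
  have : (i.factorial : ℝ) ≠ 0 := by positivity
  simp [seqVert, Nat.factorial_succ]
  field_simp

theorem seqVert_one_zero (v : ℕ → E) : seqVert 1 v 0 = 0 := by simp [seqVert]

/-- All the operations are powers of `seqVert 1`, so naturality has to be proved for `r = 1` only.
-/
theorem seqVert_succ (r : ℕ) (v : ℕ → E) : seqVert (r + 1) v = seqVert 1 (seqVert r v) := by
  funext i
  cases i with
  | zero => simp [seqVert]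
  | succ i =>
    rw [seqVert_one_succ]
    by_cases h : r ≤ i
    · simp only [seqVert, h, Nat.add_le_add_iff_right, if_true, Nat.add_sub_add_right, smul_smul,
        Nat.factorial_succ]
      push_cast
      congr 1
      ring
    · simp [seqVert, h]

/-- The commutation relation `[shift, J_1] = id`, which drives the induction in
`fderiv_prolongMap_seqVert_one`. -/
theorem seqShift_seqVert_one (v : ℕ → E) :
    seqShift (seqVert 1 v) = v + seqVert 1 (seqShift v) := by
  funext i
  cases i with
  | zero => simp [seqShift, seqVert_one_succ, seqVert_one_zero]
  | succ i =>
    simp only [seqShift, Pi.add_apply, seqVert_one_succ]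
    push_cast
    module

theorem contDiffAt_prolongMap {g : E → G} {U : Set E} (hU : IsOpen U) (hg : ContDiffOn ℝ ∞ g U)
    (j : ℕ) {q : Fin (j + 1) → E} (hq : q 0 ∈ U) : ContDiffAt ℝ ∞ (prolongMap g j) q :=
  (contDiffOn_prolongMap hU hg j).contDiffAt
    ((hU.preimage (continuous_apply (0 : Fin (j + 1)))).mem_nhds hq)

/-- The derivative of a total derivative. -/
theorem fderiv_prolongMap_succ {g : E → G} {U : Set E} (hU : IsOpen U) (hg : ContDiffOn ℝ ∞ g U)
    (j : ℕ) {q : ℕ → E} (hq : q 0 ∈ U) (v : ℕ → E) :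
    fderiv ℝ (prolongMap g (j + 1)) (seqRes (j + 1) q) (seqRes (j + 1) v) =
      fderiv ℝ (fderiv ℝ (prolongMap g j)) (seqRes j q) (seqRes j v) (seqRes j (seqShift q))
        + fderiv ℝ (prolongMap g j) (seqRes j q) (seqRes j (seqShift v)) := by
  have h1 : DifferentiableAt ℝ (fderiv ℝ (prolongMap g j)) (seqRes j q) :=
    ((contDiffAt_prolongMap hU hg j (q := seqRes j q) hq).fderiv_right (m := ∞)
      (by simp)).differentiableAt (by simp)
  let A : (Fin (j + 2) → E) →L[ℝ] (Fin (j + 1) → E) :=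
    ContinuousLinearMap.pi fun i => ContinuousLinearMap.proj (R := ℝ) (φ := fun _ => E) i.castSucc
  let B : (Fin (j + 2) → E) →L[ℝ] (Fin (j + 1) → E) :=
    ContinuousLinearMap.pi fun i => ContinuousLinearMap.proj (R := ℝ) (φ := fun _ => E) i.succ
  have h2 : HasFDerivAt (fun q : Fin (j + 2) → E => fderiv ℝ (prolongMap g j) (A q))
      ((fderiv ℝ (fderiv ℝ (prolongMap g j)) (seqRes j q)).comp A) (seqRes (j + 1) q) :=
    HasFDerivAt.comp (f := A) (seqRes (j + 1) q) h1.hasFDerivAt A.hasFDerivAt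
  have h3 := (h2.clm_apply (B.hasFDerivAt (x := seqRes (j + 1) q))).fderiv
  have h4 := DFunLike.congr_fun h3 (seqRes (j + 1) v)
  refine h4.trans ?_
  simp only [_root_.add_apply, ContinuousLinearMap.comp_apply,
    ContinuousLinearMap.flip_apply]
  rw [add_comm]
  rfl

/-- The tangent map of a prolonged coordinate change intertwines `J_1`. In the induction on the
order, the derivative of a total derivative has a second-order part and a part along the shifted
vector. The first is the induction hypothesis differentiated along the shift of `q`, by symmetry of
second derivatives; the second is handled by the commutation of `J_1` with the shift. -/
theorem fderiv_prolongMap_seqVert_one {g : E → G} {U : Set E} (hU : IsOpen U)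
    (hg : ContDiffOn ℝ ∞ g U) (j : ℕ) : ∀ {q : ℕ → E}, q 0 ∈ U → ∀ v : ℕ → E,
    fderiv ℝ (prolongMap g (j + 1)) (seqRes (j + 1) q) (seqRes (j + 1) (seqVert 1 v)) =
      ((j : ℝ) + 1) • fderiv ℝ (prolongMap g j) (seqRes j q) (seqRes j v) := by
  induction j with
  | zero =>
    intro q hq v
    rw [fderiv_prolongMap_succ hU hg 0 hq]
    have h1 : seqRes 0 (seqVert 1 v) = 0 := by
      funext i
      simp [seqRes, seqVert_one_zero]
    have h2 : seqRes 0 (seqShift (seqVert 1 v)) = seqRes 0 v := by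
      funext i
      simp [seqRes, seqShift, seqVert_one_succ]
    rw [h1, h2]; simp
  | succ j ih =>
    intro q hq v
    have hsymm : ∀ m, ∀ a b, fderiv ℝ (fderiv ℝ (prolongMap g m)) (seqRes m q) a b =
        fderiv ℝ (fderiv ℝ (prolongMap g m)) (seqRes m q) b a := fun m a b =>
      fderiv_fderiv_symm (contDiffAt_prolongMap hU hg m (q := seqRes m q) hq) a b
    rw [fderiv_prolongMap_succ hU hg (j + 1) hq, seqShift_seqVert_one]
    have e1 : seqRes (j + 1) (v + seqVert 1 (seqShift v)) =
        seqRes (j + 1) v + seqRes (j + 1) (seqVert 1 (seqShift v)) := rfl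
    rw [e1, map_add, ih hq, fderiv_prolongMap_succ hU hg j hq v, hsymm]
    have h1 : DifferentiableAt ℝ (fderiv ℝ (prolongMap g (j + 1))) (seqRes (j + 1) q) :=
      ((contDiffAt_prolongMap hU hg (j + 1) (q := seqRes (j + 1) q) hq).fderiv_right (m := ∞)
        (by simp)).differentiableAt (by simp)
    have h2 : DifferentiableAt ℝ (fderiv ℝ (prolongMap g j)) (seqRes j q) :=
      ((contDiffAt_prolongMap hU hg j (q := seqRes j q) hq).fderiv_right (m := ∞)
        (by simp)).differentiableAt (by simp)
    let A : (Fin (j + 2) → E) →L[ℝ] (Fin (j + 1) → E) :=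
      ContinuousLinearMap.pi fun i => ContinuousLinearMap.proj (R := ℝ) (φ := fun _ => E) i.castSucc
    have h3 : HasFDerivAt (fun x : Fin (j + 2) → E => fderiv ℝ (prolongMap g j) (A x))
        ((fderiv ℝ (fderiv ℝ (prolongMap g j)) (seqRes j q)).comp A) (seqRes (j + 1) q) :=
      HasFDerivAt.comp (f := A) (seqRes (j + 1) q) h2.hasFDerivAt A.hasFDerivAt
    -- Padding `x` by zeros to a sequence makes the induction hypothesis an identity near the base
    -- point, which can be differentiated.
    have hev : (fun x => fderiv ℝ (prolongMap g (j + 1)) x (seqRes (j + 1) (seqVert 1 v)))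
        =ᶠ[𝓝 (seqRes (j + 1) q)]
        fun x => ((j : ℝ) + 1) • fderiv ℝ (prolongMap g j) (A x) (seqRes j v) := by
      filter_upwards [(hU.preimage (continuous_apply (0 : Fin (j + 2)))).mem_nhds
        (show seqRes (j + 1) q ∈ _ from hq)] with x hx
      have := ih (q := fun i => if h : i < j + 2 then x ⟨i, h⟩ else 0) (by simpa using hx) v
      have e2 : seqRes (j + 1) (fun i => if h : i < j + 2 then x ⟨i, h⟩ else 0) = x := by
        funext i; simp [seqRes]
      have e3 : seqRes j (fun i => if h : i < j + 2 then x ⟨i, h⟩ else 0) = A x := by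
        funext i
        have : (i : ℕ) < j + 2 := by omega
        simp only [seqRes, this, dif_pos]
        rfl
      rwa [e2, e3] at this
    have h5 := hev.fderiv_eq (𝕜 := ℝ)
    have h6 := ((h3.clm_apply (hasFDerivAt_const (seqRes j v) (seqRes (j + 1) q))).const_smul
      ((j : ℝ) + 1)).fderiv
    have h7 := (h1.hasFDerivAt.clm_apply (hasFDerivAt_const (seqRes (j + 1) (seqVert 1 v))
      (seqRes (j + 1) q))).fderiv
    have h8 := DFunLike.congr_fun (h7.symm.trans (h5.trans h6)) (seqRes (j + 1) (seqShift q))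
    simp only [ContinuousLinearMap.comp_apply, ContinuousLinearMap.flip_apply, zero_add,
      _root_.smul_apply, ContinuousLinearMap.comp_zero] at h8
    rw [h8, hsymm j (seqRes j v)]
    have e4 : A (seqRes (j + 1) (seqShift q)) = seqRes j (seqShift q) := rfl
    rw [e4]
    push_cast
    module

/-- Iteration of the case of `J_1`; the factors `j + 1` accumulate to the quotient of factorials. -/
theorem fderiv_prolongMap_seqVert {g : E → G} {U : Set E} (hU : IsOpen U)
    (hg : ContDiffOn ℝ ∞ g U) {q : ℕ → E} (hq : q 0 ∈ U) (v : ℕ → E) (r : ℕ) : ∀ j : ℕ,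
    fderiv ℝ (prolongMap g j) (seqRes j q) (seqRes j (seqVert r v)) =
      if r ≤ j then ((j.factorial : ℝ) / (j - r).factorial) •
        fderiv ℝ (prolongMap g (j - r)) (seqRes (j - r) q) (seqRes (j - r) v) else 0 := by
  induction r with
  | zero =>
    intro j
    have : (j.factorial : ℝ) ≠ 0 := by positivity
    simp [seqVert_zero, this]
  | succ r ih =>
    intro j
    rw [seqVert_succ]
    cases j with
    | zero =>
      have h1 : seqRes 0 (seqVert 1 (seqVert r v)) = 0 := by
        funext i
        simp [seqRes, seqVert_one_zero]
      rw [h1]; simp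
    | succ j =>
      rw [fderiv_prolongMap_seqVert_one hU hg j hq, ih]
      by_cases h : r ≤ j
      · simp only [h, Nat.add_le_add_iff_right, if_true, smul_smul, Nat.factorial_succ]
        rw [Nat.add_sub_add_right]
        congr 1
        push_cast
        ring
      · simp [h]

end Vertical

/-! ### Coordinates on the model spaces, padded by zero, and their truncations. -/

section CoordSpace

variable {E : Type*} [NormedAddCommGroup E] [NormedSpace ℝ E]

/-- The coordinate `q_i` on the model space of `T^r Q × ℝ`, zero for `i > r`. -/
def coordL (r i : ℕ) : ((Fin (r + 1) → E) × ℝ) →L[ℝ] E :=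
  if h : i < r + 1 then (ContinuousLinearMap.proj (R := ℝ) (φ := fun _ : Fin (r + 1) => E)
    ⟨i, h⟩).comp (ContinuousLinearMap.fst ℝ _ _) else 0

theorem coordL_of_lt {r i : ℕ} (h : i < r + 1) (x : (Fin (r + 1) → E) × ℝ) :
    coordL r i x = x.1 ⟨i, h⟩ := by simp [coordL, h]

theorem coordL_of_le {r i : ℕ} (h : r + 1 ≤ i) (x : (Fin (r + 1) → E) × ℝ) :
    coordL r i x = 0 := by
  simp [coordL, Nat.not_lt.2 h]

theorem coordL_fin {r : ℕ} (i : Fin (r + 1)) (x : (Fin (r + 1) → E) × ℝ) :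
    coordL r i x = x.1 i := coordL_of_lt i.2 x

theorem coord_ext {r : ℕ} {x y : (Fin (r + 1) → E) × ℝ}
    (h : ∀ i, i < r + 1 → coordL r i x = coordL r i y) (hz : x.2 = y.2) : x = y := by
  refine Prod.ext (funext fun i => ?_) hz
  have := h i i.2
  rwa [coordL_fin, coordL_fin] at this

/-- The truncation of coordinates. -/
def truncL {r s : ℕ} (h : r ≤ s) : ((Fin (s + 1) → E) × ℝ) →L[ℝ] ((Fin (r + 1) → E) × ℝ) :=
  (ContinuousLinearMap.pi fun i : Fin (r + 1) =>
    ContinuousLinearMap.proj (R := ℝ) (φ := fun _ : Fin (s + 1) => E) ⟨i, by omega⟩).prodMap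
      (ContinuousLinearMap.id ℝ ℝ)

theorem coordL_truncL {r s : ℕ} (h : r ≤ s) (x : (Fin (s + 1) → E) × ℝ) {i : ℕ} (hi : i < r + 1) :
    coordL r i (truncL h x) = coordL s i x := by
  rw [coordL_of_lt hi, coordL_of_lt (show i < s + 1 by omega)]; rfl

theorem truncL_truncL {r s t : ℕ} (h : r ≤ s) (h' : s ≤ t) (x : (Fin (t + 1) → E) × ℝ) :
    truncL h (truncL h' x) = truncL (h.trans h') x := rfl

/-- The coordinate sequence. -/
def coordSeq {r : ℕ} (x : (Fin (r + 1) → E) × ℝ) : ℕ → E := fun i => coordL r i x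

theorem seqRes_coordSeq {r : ℕ} (x : (Fin (r + 1) → E) × ℝ) (j : Fin (r + 1)) :
    seqRes j (coordSeq x) = fun i : Fin (j + 1) => x.1 ⟨i, by omega⟩ := by
  funext i
  exact coordL_of_lt (by omega) x

end CoordSpace

/-! ### Changes of natural coordinates and components of tangent vectors. -/

section Charts

variable {E : Type*} [NormedAddCommGroup E] [NormedSpace ℝ E]
  {Q : Type*} [TopologicalSpace Q] [ChartedSpace E Q] [IsManifold 𝓘(ℝ, E) ∞ Q]

/-- The change of charts of `Q`. -/
def transition (e e' : atlas E Q) : E → E := fun x => e'.1 (e.1.symm x)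

theorem coords_change {r : ℕ} (e e' : atlas E Q) {p : TJet E Q r} (hp : p.base ∈ e.1.source)
    (hp' : p.base ∈ e'.1.source) (j : Fin (r + 1)) :
    p.coords e'.1 j = prolongMap (transition e e') j (fun i => p.coords e.1 ⟨i, by omega⟩) := by
  induction p using TJet.ind with
  | h c =>
    rw [TJet.coords_mk e.2 c hp, TJet.coords_mk e'.2 c hp']
    exact TJet.curveCoords_change e.2 e'.2 c.smooth hp hp' j

theorem base_proj {r s : ℕ} (h : r ≤ s) (p : TJet E Q s) : (TJet.proj h p).base = p.base := by
  induction p using TJet.ind with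
  | h c => rfl

theorem coords_proj {r s : ℕ} (h : r ≤ s) (e : atlas E Q) {p : TJet E Q s}
    (hp : p.base ∈ e.1.source) (j : Fin (r + 1)) :
    (TJet.proj h p).coords e.1 j = p.coords e.1 ⟨j, by omega⟩ := by
  induction p using TJet.ind with
  | h c =>
    rw [TJet.proj_mk, TJet.coords_mk e.2 c hp, TJet.coords_mk e.2 c hp]
    rfl

theorem extProj_mem {r s : ℕ} (h : r ≤ s) {e : atlas E Q} {p : Ext E Q s} :
    extProj h p ∈ natSource e r ↔ p ∈ natSource e s := by
  change (TJet.proj h p.1).base ∈ e.1.source ↔ p.1.base ∈ e.1.source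
  rw [base_proj]

theorem natCoords_extProj {r s : ℕ} (h : r ≤ s) {e : atlas E Q} {p : Ext E Q s}
    (hp : p ∈ natSource e s) : natCoords e r (extProj h p) = truncL h (natCoords e s p) :=
  Prod.ext (funext fun j => coords_proj h e hp j) rfl

theorem truncL_mem {r s : ℕ} (h : r ≤ s) {e : atlas E Q} {x : (Fin (s + 1) → E) × ℝ} :
    truncL h x ∈ natTarget e r ↔ x ∈ natTarget e s := Iff.rfl

theorem extProj_natInv {r s : ℕ} (h : r ≤ s) {e : atlas E Q} {x : (Fin (s + 1) → E) × ℝ}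
    (hx : x ∈ natTarget e s) : extProj h (natInv e s x) = natInv e r (truncL h x) := by
  refine natCoords_inj ((extProj_mem h).2 (natInv_mem hx)) (natInv_mem ((truncL_mem h).2 hx)) ?_
  rw [natCoords_extProj h (natInv_mem hx), natCoords_natInv hx,
    natCoords_natInv ((truncL_mem h).2 hx)]

/-- Projections keep the base point, so one chart of `Q` serves the tangent spaces of all orders;
this is what makes `totalVec`, which reads coordinates upstairs, comparable with vectors downstairs.
-/
theorem baseChart_extProj {r s : ℕ} (h : r ≤ s) (p : Ext E Q s) :
    baseChart (extProj h p) = baseChart p := by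
  unfold baseChart extProj
  simp only [base_proj]

/-- The differential of the natural coordinates. -/
def dCoords (e : atlas E Q) (r : ℕ) (p : Ext E Q r) :
    TangentSpace (extModel E r) p →L[ℝ] (Fin (r + 1) → E) × ℝ :=
  diff (extModel E r) (natCoords e r) p

theorem mdifferentiableAt_natCoords {e : atlas E Q} {r : ℕ} {p : Ext E Q r}
    (hp : p ∈ natSource e r) :
    MDifferentiableAt (extModel E r) 𝓘(ℝ, (Fin (r + 1) → E) × ℝ) (natCoords e r) p :=
  (contMDiffAt_natCoords hp).mdifferentiableAt (by simp)

theorem mdifferentiableAt_natInv {e : atlas E Q} {r : ℕ} {x : (Fin (r + 1) → E) × ℝ}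
    (hx : x ∈ natTarget e r) :
    MDifferentiableAt 𝓘(ℝ, (Fin (r + 1) → E) × ℝ) (extModel E r) (natInv e r) x :=
  (contMDiffAt_natInv hx).mdifferentiableAt (by simp)

/-- Functions whose expression in natural coordinates is smooth. -/
def SmoothIn {G : Type*} [NormedAddCommGroup G] [NormedSpace ℝ G] (e : atlas E Q) {r : ℕ}
    (F : Ext E Q r → G) : Prop :=
  ContDiffOn ℝ ∞ (fun x => F (natInv e r x)) (natTarget e r)

variable {G : Type*} [NormedAddCommGroup G] [NormedSpace ℝ G]

theorem SmoothIn.contDiffAt {e : atlas E Q} {r : ℕ} {F : Ext E Q r → G} (hF : SmoothIn e F)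
    {x : (Fin (r + 1) → E) × ℝ} (hx : x ∈ natTarget e r) :
    ContDiffAt ℝ ∞ (fun x => F (natInv e r x)) x :=
  ContDiffOn.contDiffAt hF ((isOpen_natTarget e r).mem_nhds hx)

theorem SmoothIn.differentiableAt {e : atlas E Q} {r : ℕ} {F : Ext E Q r → G} (hF : SmoothIn e F)
    {x : (Fin (r + 1) → E) × ℝ} (hx : x ∈ natTarget e r) :
    DifferentiableAt ℝ (fun x => F (natInv e r x)) x :=
  (hF.contDiffAt hx).differentiableAt (by simp)

theorem eventually_natSource {e : atlas E Q} {r : ℕ} {p : Ext E Q r}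
    (hp : p ∈ natSource e r) : ∀ᶠ p' in 𝓝 p, p' ∈ natSource e r :=
  (isOpen_natSource e r).mem_nhds hp

theorem SmoothIn.contMDiffAt {e : atlas E Q} {r : ℕ} {F : Ext E Q r → G} (hF : SmoothIn e F)
    {p : Ext E Q r} (hp : p ∈ natSource e r) :
    ContMDiffAt (extModel E r) 𝓘(ℝ, G) ∞ F p := by
  have h : ContMDiffAt (extModel E r) 𝓘(ℝ, G) ∞
      ((fun x => F (natInv e r x)) ∘ natCoords e r) p :=
    ContMDiffAt.comp p ((hF.contDiffAt (natCoords_mem hp)).contMDiffAt) (contMDiffAt_natCoords hp)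
  refine h.congr_of_eventuallyEq ?_
  filter_upwards [eventually_natSource hp] with p' hp'
  simp [natInv_natCoords hp']

theorem SmoothIn.mdifferentiableAt {e : atlas E Q} {r : ℕ} {F : Ext E Q r → G} (hF : SmoothIn e F)
    {p : Ext E Q r} (hp : p ∈ natSource e r) :
    MDifferentiableAt (extModel E r) 𝓘(ℝ, G) F p :=
  (hF.contMDiffAt hp).mdifferentiableAt (by simp)

theorem ContMDiff.smoothIn {r : ℕ} {F : Ext E Q r → G}
    (hF : ContMDiff (extModel E r) 𝓘(ℝ, G) ∞ F) (e : atlas E Q) : SmoothIn e F := fun x hx =>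
  (ContMDiffAt.contDiffAt (ContMDiffAt.comp x (hF _) (contMDiffAt_natInv hx))).contDiffWithinAt

theorem diff_eq {e : atlas E Q} {r : ℕ} {F : Ext E Q r → G} (hF : SmoothIn e F)
    {p : Ext E Q r} (hp : p ∈ natSource e r) (v : TangentSpace (extModel E r) p) :
    diff (extModel E r) F p v =
      fderiv ℝ (fun x => F (natInv e r x)) (natCoords e r p) (dCoords e r p v) := by
  have h1 : HasMFDerivAt (extModel E r) 𝓘(ℝ, G) ((fun x => F (natInv e r x)) ∘ natCoords e r) p _ :=
    HasMFDerivAt.comp p ((hF.differentiableAt (natCoords_mem hp)).hasFDerivAt.hasMFDerivAt)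
      (mdifferentiableAt_natCoords hp).hasMFDerivAt
  have h2 : HasMFDerivAt (extModel E r) 𝓘(ℝ, G) F p _ :=
    h1.congr_of_eventuallyEq (by
      filter_upwards [eventually_natSource hp] with p' hp'
      simp [natInv_natCoords hp'])
  exact DFunLike.congr_fun h2.mfderiv v

theorem dCoords_injective {e : atlas E Q} {r : ℕ} {p : Ext E Q r} (hp : p ∈ natSource e r) :
    Function.Injective (dCoords e r p) := by
  have h3 := HasMFDerivAt.comp p (mdifferentiableAt_natInv (natCoords_mem hp)).hasMFDerivAt
    (mdifferentiableAt_natCoords hp).hasMFDerivAt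
  have h5 := (h3.congr_of_eventuallyEq (f₁ := id) (by
    filter_upwards [eventually_natSource hp] with p' hp'
    simp [natInv_natCoords hp']))
  have h7 := h5.mfderiv.symm.trans mfderiv_id
  exact Function.LeftInverse.injective (g := mfderiv 𝓘(ℝ, (Fin (r + 1) → E) × ℝ) (extModel E r)
    (natInv e r) (natCoords e r p)) fun v => DFunLike.congr_fun h7 v

theorem dCoords_surjective {e : atlas E Q} {r : ℕ} {p : Ext E Q r} (hp : p ∈ natSource e r) :
    Function.Surjective (dCoords e r p) := by
  suffices H : ∀ x ∈ natTarget e r, Function.Surjective (dCoords e r (natInv e r x)) by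
    have := H _ (natCoords_mem hp)
    rwa [natInv_natCoords hp] at this
  intro x hx
  have h4 := HasMFDerivAt.comp x (mdifferentiableAt_natCoords (natInv_mem hx)).hasMFDerivAt
    (mdifferentiableAt_natInv hx).hasMFDerivAt
  have h6 := (h4.congr_of_eventuallyEq (f₁ := id) (by
    filter_upwards [(isOpen_natTarget e r).mem_nhds hx] with p' hp'
    simp [natCoords_natInv hp']))
  have h8 := h6.mfderiv.symm.trans mfderiv_id
  exact Function.RightInverse.surjective (g := mfderiv 𝓘(ℝ, (Fin (r + 1) → E) × ℝ)
    (extModel E r) (natInv e r) x) fun v => DFunLike.congr_fun h8 v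

theorem natCoords_zero {e : atlas E Q} {r : ℕ} {p : Ext E Q r} (hp : p ∈ natSource e r) :
    (natCoords e r p).1 0 = e.1 p.1.base := by
  obtain ⟨q, z⟩ := p
  induction q using TJet.ind with
  | h c =>
    change TJet.coords _ _ _ = _
    rw [TJet.coords_mk e.2 c hp]
    simp [curveCoords]

theorem natCoords_zero_mem_transition {e e' : atlas E Q} {r : ℕ} {p : Ext E Q r}
    (hp : p ∈ natSource e r) (hp' : p ∈ natSource e' r) :
    (natCoords e r p).1 0 ∈ (e.1.symm.trans e'.1).source := by
  rw [natCoords_zero hp]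
  have hs : p.1.base ∈ e.1.source := hp
  have hs' : p.1.base ∈ e'.1.source := hp'
  simp [e.1.map_source hs, e.1.left_inv hs, hs']

/-- The passage from the preferred chart at `p`, in which the intrinsic objects are defined, to an
arbitrary chart `e`: the change of natural coordinates is the prolonged transition map, and vectors
transform by its derivative. -/
theorem dCoords_apply {e : atlas E Q} {r : ℕ} {p : Ext E Q r} (hp : p ∈ natSource e r)
    (v : (Fin (r + 1) → E) × ℝ) (j : Fin (r + 1)) :
    (dCoords e r p v).1 j = fderiv ℝ (prolongMap (transition (baseChart p) e) j)
        (seqRes j (coordSeq (natCoords (baseChart p) r p))) (seqRes j (coordSeq v)) := by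
  have hp0 := mem_natSource_baseChart p
  set x₀ := natCoords (baseChart p) r p with hx₀
  have hx0 : x₀ ∈ natTarget (baseChart p) r := natCoords_mem hp0
  have h1 : dCoords e r p v = fderiv ℝ (fun x => natCoords e r (natInv (baseChart p) r x)) x₀ v :=
    diff_apply_coords (mdifferentiableAt_natCoords hp) v
  have hU := ((baseChart p).1.symm.trans e.1).open_source
  have hmem : x₀.1 0 ∈ ((baseChart p).1.symm.trans e.1).source :=
    natCoords_zero_mem_transition hp0 hp
  have hev : ∀ᶠ x in 𝓝 x₀, natCoords e r (natInv (baseChart p) r x) =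
      ((fun j : Fin (r + 1) => prolongMap (transition (baseChart p) e) j
        (fun i : Fin (j + 1) => x.1 ⟨i, by omega⟩)), x.2) := by
    have ho : IsOpen {x : (Fin (r + 1) → E) × ℝ | x.1 0 ∈
        ((baseChart p).1.symm.trans e.1).source} := hU.preimage (by fun_prop)
    filter_upwards [ho.mem_nhds hmem] with x hx
    have hx1 : x ∈ natTarget (baseChart p) r := by
      have : x.1 0 ∈ ((baseChart p).1.symm.trans e.1).source := hx
      simp at this; exact this.1
    have hx2 : (natInv (baseChart p) r x).1.base ∈ e.1.source := by
      have : x.1 0 ∈ ((baseChart p).1.symm.trans e.1).source := hx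
      simp at this
      have h3 : (natInv (baseChart p) r x).1.base = (baseChart p).1.symm (x.1 0) := by
        change TJet.base (TJet.ofCurve E r _) = _
        rw [TJet.base_ofCurve, TJet.polyCurve_zero]
      rw [h3]; exact this.2
    refine Prod.ext (funext fun j => ?_) rfl
    have := coords_change (baseChart p) e (p := (natInv (baseChart p) r x).1)
      (natInv_mem hx1) hx2 j
    refine this.trans ?_
    congr 1
    funext i
    have h5 := natCoords_natInv hx1
    exact congrFun (congrArg Prod.fst h5) ⟨i, by omega⟩
  have hg := TJet.contDiffOn_transition (baseChart p).2 e.2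
  let A : (Fin (r + 1) → E) × ℝ →L[ℝ] (Fin (j + 1) → E) :=
    (ContinuousLinearMap.pi fun i : Fin (j + 1) =>
      ContinuousLinearMap.proj (R := ℝ) (φ := fun _ : Fin (r + 1) => E) ⟨i, by omega⟩).comp
        (ContinuousLinearMap.fst ℝ _ _)
  have h6 : HasFDerivAt (fun x => prolongMap (transition (baseChart p) e) j (A x)) _ x₀ :=
    HasFDerivAt.comp (f := A) x₀ (((contDiffAt_prolongMap hU hg j (q := A x₀)
      hmem).differentiableAt (by simp)).hasFDerivAt) A.hasFDerivAt
  have h7 : HasFDerivAt (fun x => natCoords e r (natInv (baseChart p) r x))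
      (fderiv ℝ (fun x => natCoords e r (natInv (baseChart p) r x)) x₀) x₀ := by
    refine DifferentiableAt.hasFDerivAt ?_
    have h8 : ContMDiffAt (extModel E r) 𝓘(ℝ, (Fin (r + 1) → E) × ℝ) ∞ (natCoords e r)
      (natInv (baseChart p) r x₀) := contMDiffAt_natCoords (by rwa [hx₀, natInv_natCoords hp0])
    exact (ContMDiffAt.contDiffAt (ContMDiffAt.comp x₀ h8
      (contMDiffAt_natInv hx0))).differentiableAt (by simp)
  let B : (Fin (r + 1) → E) × ℝ →L[ℝ] E :=
    (ContinuousLinearMap.proj (R := ℝ) (φ := fun _ : Fin (r + 1) => E) j).comp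
        (ContinuousLinearMap.fst ℝ _ _)
  have h9 : HasFDerivAt (fun x => B (natCoords e r (natInv (baseChart p) r x))) _ x₀ :=
    B.hasFDerivAt.comp x₀ h7
  have h10 := h9.unique (h6.congr_of_eventuallyEq (by
    filter_upwards [hev] with x hx
    rw [hx]; rfl))
  have h11 := DFunLike.congr_fun h10 v
  rw [h1, seqRes_coordSeq, seqRes_coordSeq]
  exact h11

theorem dCoords_snd {e : atlas E Q} {r : ℕ} {p : Ext E Q r} (hp : p ∈ natSource e r)
    (v : (Fin (r + 1) → E) × ℝ) : (dCoords e r p v).2 = v.2 := by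
  have hp0 := mem_natSource_baseChart p
  have h1 : dCoords e r p v = fderiv ℝ (fun x => natCoords e r (natInv (baseChart p) r x))
    (natCoords (baseChart p) r p) v := diff_apply_coords (mdifferentiableAt_natCoords hp) v
  have h8 : ContMDiffAt (extModel E r) 𝓘(ℝ, (Fin (r + 1) → E) × ℝ) ∞ (natCoords e r)
      (natInv (baseChart p) r (natCoords (baseChart p) r p)) :=
    contMDiffAt_natCoords (by rwa [natInv_natCoords hp0])
  have h7 := ((ContMDiffAt.contDiffAt (ContMDiffAt.comp _ h8
      (contMDiffAt_natInv (natCoords_mem hp0)))).differentiableAt (by simp)).hasFDerivAt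
  have h9 := (ContinuousLinearMap.snd ℝ (Fin (r + 1) → E) ℝ).hasFDerivAt.comp _ h7
  have h10 := h9.unique (ContinuousLinearMap.snd ℝ (Fin (r + 1) → E) ℝ).hasFDerivAt
  rw [h1]
  exact DFunLike.congr_fun h10 v

end Charts

/-! ### The total vector, the vertical endomorphisms and the canonical fields in any natural chart.
-/

section Charts

variable {E : Type*} [NormedAddCommGroup E] [NormedSpace ℝ E]
  {Q : Type*} [TopologicalSpace Q] [ChartedSpace E Q] [IsManifold 𝓘(ℝ, E) ∞ Q]

/-- Differentiating the `j`-th prolonged transition along `(q_1, q_2, …)` is taking its total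
derivative, which is by definition the `(j + 1)`-st prolonged transition, that is, the new
coordinate of index `j + 1`. -/
theorem dCoords_totalVec {k a : ℕ} (L : Ext E Q k → ℝ) {e : atlas E Q} {p : Ext E Q (k + a + 1)}
    (hp : p ∈ natSource e (k + a + 1)) :
    dCoords e (k + a) (extProj (Nat.le_succ (k + a)) p) (totalVec L p) =
      ((fun j : Fin (k + a + 1) => (natCoords e (k + a + 1) p).1 j.succ),
        L (extProj (by omega : k ≤ k + a + 1) p)) := by
  have hp' : extProj (Nat.le_succ (k + a)) p ∈ natSource e (k + a) := (extProj_mem _).2 hp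
  refine Prod.ext (funext fun j => ?_) (dCoords_snd hp' _)
  let v : (Fin (k + a + 1) → E) × ℝ :=
    (fun j => p.1.coords (chartAt E p.1.base) j.succ, L (extProj (by omega : k ≤ k + a + 1) p))
  refine (dCoords_apply hp' v j).trans ?_
  rw [baseChart_extProj, natCoords_extProj _ (mem_natSource_baseChart p),
    seqRes_coordSeq, seqRes_coordSeq]
  exact (coords_change (baseChart p) e (mem_natSource_baseChart p) hp j.succ).symm

theorem coordL_dCoords_totalVec {k a : ℕ} (L : Ext E Q k → ℝ) {e : atlas E Q}
    {p : Ext E Q (k + a + 1)} (hp : p ∈ natSource e (k + a + 1)) {i : ℕ} (hi : i < k + a + 1) :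
    coordL (k + a) i (dCoords e (k + a) (extProj (Nat.le_succ (k + a)) p) (totalVec L p)) =
      coordL (k + a + 1) (i + 1) (natCoords e (k + a + 1) p) := by
  rw [dCoords_totalVec L hp, coordL_of_lt hi, coordL_of_lt (by omega)]
  rfl

theorem coordL_dCoords_of_seqVert {k b : ℕ} {e : atlas E Q} {p : Ext E Q k}
    (hp : p ∈ natSource e k) (v w : (Fin (k + 1) → E) × ℝ)
    (h : ∀ i < k + 1, coordSeq w i = seqVert b (coordSeq v) i) {i : ℕ} (hi : i < k + 1) :
    coordL k i (dCoords e k p w) = if b ≤ i then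
      ((i.factorial : ℝ) / (i - b).factorial) • coordL k (i - b) (dCoords e k p v) else 0 := by
  have hU := ((baseChart p).1.symm.trans e.1).open_source
  have hg := TJet.contDiffOn_transition (baseChart p).2 e.2
  have hmem : coordSeq (natCoords (baseChart p) k p) 0 ∈
      ((baseChart p).1.symm.trans e.1).source := by
    rw [coordSeq, coordL_of_lt (Nat.succ_pos k)]
    exact natCoords_zero_mem_transition (mem_natSource_baseChart p) hp
  rw [coordL_of_lt hi, dCoords_apply hp]
  have e1 : seqRes i (coordSeq w) = seqRes i (seqVert b (coordSeq v)) :=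
    funext fun j => h j (by omega)
  have key := fderiv_prolongMap_seqVert hU hg hmem (coordSeq v) b i
  change fderiv ℝ (prolongMap (transition (baseChart p) e) i) (seqRes i _) (seqRes i _) = _
  rw [e1]
  refine key.trans ?_
  split_ifs with hb
  · rw [coordL_of_lt (show i - b < k + 1 by omega), dCoords_apply hp]
    rfl
  · rfl

theorem coordL_dCoords_vertEnd {k b : ℕ} {e : atlas E Q} {p : Ext E Q k}
    (hp : p ∈ natSource e k) (v : TangentSpace (extModel E k) p) {i : ℕ} (hi : i < k + 1) :
    coordL k i (dCoords e k p (vertEnd b p v)) = if b ≤ i then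
      ((i.factorial : ℝ) / (i - b).factorial) • coordL k (i - b) (dCoords e k p v) else 0 := by
  let v' : (Fin (k + 1) → E) × ℝ := v
  refine coordL_dCoords_of_seqVert hp v' _ (fun i hi => ?_) hi
  refine (coordL_of_lt hi _).trans ?_
  unfold seqVert
  have : (vertEnd b p v : (Fin (k + 1) → E) × ℝ).1 ⟨i, hi⟩ =
    (if b ≤ i then ((i.factorial : ℝ) / (i - b).factorial) •
      ContinuousLinearMap.proj (R := ℝ) (φ := fun _ => E) (⟨i - b, by omega⟩ : Fin (k + 1))
      else (0 : (Fin (k + 1) → E) →L[ℝ] E)) v'.1 := rfl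
  refine this.trans ?_
  split_ifs
  · exact congrArg _ (coordL_of_lt (show i - b < k + 1 by omega) v').symm
  · rfl

theorem dCoords_vertEnd_snd {k b : ℕ} {e : atlas E Q} {p : Ext E Q k}
    (hp : p ∈ natSource e k) (v : TangentSpace (extModel E k) p) :
    (dCoords e k p (vertEnd b p v)).2 = 0 := dCoords_snd hp _

theorem coordL_dCoords_canonField {k b : ℕ} {e : atlas E Q} {p : Ext E Q k}
    (hp : p ∈ natSource e k) {i : ℕ} (hi : i < k + 1) :
    coordL k i (dCoords e k p (canonField b p)) = if b + 1 ≤ i then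
      ((i.factorial : ℝ) / (i - (b + 1)).factorial) • coordL k (i - b) (natCoords e k p)
      else 0 := by
  set x := natCoords (baseChart p) k p with hx
  -- The canonical field is `J_{b+1}` applied to this vector. Its last entry is the padding value
  -- `0`, which `J_{b+1}` never reads.
  let v : (Fin (k + 1) → E) × ℝ := (fun j => coordL k (j + 1) x, 0)
  have h1 := coordL_dCoords_of_seqVert (b := b + 1) hp v (canonField b p) (fun i hi => ?_) hi
  · rw [h1]
    split_ifs with hb
    · congr 1
      have hi' : i - (b + 1) < k + 1 := by omega
      rw [coordL_of_lt hi', dCoords_apply hp, coordL_of_lt (show i - b < k + 1 by omega)]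
      have h2 := coords_change (baseChart p) e (mem_natSource_baseChart p) hp
        (⟨i - (b + 1) + 1, by omega⟩ : Fin (k + 1))
      have h3 : (natCoords e k p).1 ⟨i - b, by omega⟩ =
          p.1.coords e.1 (⟨i - (b + 1) + 1, by omega⟩ : Fin (k + 1)) := by
        change p.1.coords e.1 _ = _
        congr 2; omega
      rw [h3, h2, seqRes_coordSeq, seqRes_coordSeq]
      change _ = fderiv ℝ (prolongMap (transition (baseChart p) e) (i - (b + 1))) _ _
      congr 1
      funext j
      change coordL k ((j : ℕ) + 1) x = _
      rw [coordL_of_lt (by have := j.2; simp only at this; omega)]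
      rfl
    · rfl
  · refine (coordL_of_lt hi _).trans ?_
    unfold seqVert
    change (if b + 1 ≤ i then
      ((i.factorial : ℝ) / (i - (b + 1)).factorial) • x.1 ⟨i - b, by omega⟩ else 0) = _
    split_ifs with hb
    · congr 1
      refine Eq.trans ?_ (coordL_of_lt (show i - (b + 1) < k + 1 by omega) v).symm
      change _ = coordL k (i - (b + 1) + 1) x
      rw [coordL_of_lt (show i - (b + 1) + 1 < k + 1 by omega)]
      exact congrArg x.1 (Fin.ext (show i - b = i - (b + 1) + 1 by omega))
    · rfl

theorem dCoords_canonField_snd {k b : ℕ} {e : atlas E Q} {p : Ext E Q k}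
    (hp : p ∈ natSource e k) : (dCoords e k p (canonField b p)).2 = 0 := dCoords_snd hp _

end Charts

/-! ### The exterior derivative of a form written as `dh₀ + ∑ g_i dh_i`. -/

section ExtDeriv

variable {V : Type*} [NormedAddCommGroup V] [NormedSpace ℝ V] {H : Type*} [TopologicalSpace H]
  {M : Type*} [TopologicalSpace M] [ChartedSpace H M] (I : ModelWithCorners ℝ V H)
  [I.Boundaryless] [IsManifold I ∞ M]
  {E : Type*} [NormedAddCommGroup E] [NormedSpace ℝ E]

variable {G : Type*} [NormedAddCommGroup G] [NormedSpace ℝ G]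

theorem contDiffAt_comp_extChartAt_symm {f : M → G} {p : M} (hf : ContMDiffAt I 𝓘(ℝ, G) ∞ f p) :
    ContDiffAt ℝ ∞ (fun y => f ((extChartAt I p).symm y)) (extChartAt I p p) := by
  have h1 : ContMDiffAt 𝓘(ℝ, V) I ∞ (extChartAt I p).symm (extChartAt I p p) :=
    (contMDiffOn_extChartAt_symm p).contMDiffAt (extChartAt_target_mem_nhds p)
  have h2 : ContMDiffAt I 𝓘(ℝ, G) ∞ f ((extChartAt I p).symm (extChartAt I p p)) := by
    rwa [extChartAt_to_inv]
  exact (ContMDiffAt.comp _ h2 h1).contDiffAt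

theorem eventually_diff_extChartAt_symm {f : M → G} {p : M}
    (hf : ContMDiffAt I 𝓘(ℝ, G) ∞ f p) :
    ∀ᶠ y in 𝓝 (extChartAt I p p), ∀ w : V, diff I f ((extChartAt I p).symm y)
      (mfderiv 𝓘(ℝ, V) I (extChartAt I p).symm y w) =
        fderiv ℝ (fun y => f ((extChartAt I p).symm y)) y w := by
  have h0 : ∀ᶠ p' in 𝓝 p, ContMDiffAt I 𝓘(ℝ, G) 1 f p' :=
    (contMDiffAt_iff_contMDiffAt_nhds (by simp)).1 (hf.of_le (by simp))
  have hc : Filter.Tendsto (extChartAt I p).symm (𝓝 (extChartAt I p p)) (𝓝 p) := by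
    have := continuousAt_extChartAt_symm (I := I) p
    rwa [ContinuousAt, extChartAt_to_inv] at this
  filter_upwards [hc.eventually h0,
    eventually_eventually_nhds.2 (extChartAt_target_mem_nhds (I := I) p)] with y hy hy'
  intro w
  have h1 : MDifferentiableAt 𝓘(ℝ, V) I (extChartAt I p).symm y :=
    ((contMDiffOn_extChartAt_symm (n := ∞) p).contMDiffAt hy').mdifferentiableAt (by simp)
  have h2 := (HasMFDerivAt.comp y (hy.mdifferentiableAt (by simp)).hasMFDerivAt h1.hasMFDerivAt)
  refine (DFunLike.congr_fun h2.mfderiv w).symm.trans ?_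
  rw [mfderiv_eq_fderiv]
  rfl

theorem diff_eq_fderiv_extChartAt {f : M → G} {p : M} (hf : ContMDiffAt I 𝓘(ℝ, G) ∞ f p)
    (u : TangentSpace I p) : diff I f p u =
      fderiv ℝ (fun y => f ((extChartAt I p).symm y)) (extChartAt I p p)
        (mfderiv I 𝓘(ℝ, V) (extChartAt I p) p u) := by
  have h1 : HasMFDerivAt I 𝓘(ℝ, G)
      ((fun y => f ((extChartAt I p).symm y)) ∘ extChartAt I p) p _ :=
    HasMFDerivAt.comp p ((contDiffAt_comp_extChartAt_symm I hf).differentiableAt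
      (by simp)).hasFDerivAt.hasMFDerivAt
      ((contMDiffAt_extChartAt (I := I) (n := ∞)).mdifferentiableAt (by simp)).hasMFDerivAt
  have h2 : HasMFDerivAt I 𝓘(ℝ, G) f p _ := h1.congr_of_eventuallyEq (by
    filter_upwards [extChartAt_source_mem_nhds (I := I) p] with p' hp'
    exact congrArg f ((extChartAt I p).left_inv hp').symm)
  exact DFunLike.congr_fun h2.mfderiv u

/-- The exterior derivative of `dh₀ + ∑ g_i dh_i` is `∑ dg_i ∧ dh_i`. -/
theorem extDerivOneForm_sum {ι : Type*} (s : Finset ι) {h₀ : M → ℝ} {g : ι → M → E →L[ℝ] ℝ}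
    {h : ι → M → E} {p : M} {ξ : ∀ p : M, TangentSpace I p →L[ℝ] ℝ}
    (hh₀ : ContMDiffAt I 𝓘(ℝ, ℝ) ∞ h₀ p)
    (hg : ∀ i ∈ s, ContMDiffAt I 𝓘(ℝ, E →L[ℝ] ℝ) ∞ (g i) p)
    (hh : ∀ i ∈ s, ContMDiffAt I 𝓘(ℝ, E) ∞ (h i) p)
    (hξ : ∀ᶠ p' in 𝓝 p, ∀ v, ξ p' v = diff I h₀ p' v + ∑ i ∈ s, g i p' (diff I (h i) p' v))
    (u v : TangentSpace I p) :
    extDerivOneForm I ξ p u v = ∑ i ∈ s,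
      (diff I (g i) p u (diff I (h i) p v) - diff I (g i) p v (diff I (h i) p u)) := by
  set y₀ := extChartAt I p p with hy₀
  let ξ' : V → V →L[ℝ] ℝ := fun y =>
    (ξ ((extChartAt I p).symm y)).comp (mfderiv 𝓘(ℝ, V) I (extChartAt I p).symm y)
  let h₀' : V → ℝ := fun y => h₀ ((extChartAt I p).symm y)
  let g' : ι → V → E →L[ℝ] ℝ := fun i y => g i ((extChartAt I p).symm y)
  let h' : ι → V → E := fun i y => h i ((extChartAt I p).symm y)
  have hc : Filter.Tendsto (extChartAt I p).symm (𝓝 (extChartAt I p p)) (𝓝 p) := by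
    have := continuousAt_extChartAt_symm (I := I) p
    rwa [ContinuousAt, extChartAt_to_inv] at this
  have hev : ξ' =ᶠ[𝓝 y₀] fun y => fderiv ℝ h₀' y + ∑ i ∈ s, (g' i y).comp (fderiv ℝ (h' i) y) := by
    filter_upwards [hc.eventually hξ, eventually_diff_extChartAt_symm I hh₀,
      (s.eventually_all).2 fun i hi => eventually_diff_extChartAt_symm I (hh i hi)] with y h1 h2 h3
    ext w
    refine (h1 _).trans ((congrArg₂ (· + ·) (h2 w)
      (Finset.sum_congr rfl fun i hi => congrArg _ (h3 i hi w))).trans ?_)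
    simp only [_root_.add_apply, _root_.sum_apply, ContinuousLinearMap.comp_apply]
    rfl
  have hd₀ := contDiffAt_comp_extChartAt_symm I hh₀
  have hdg := fun i hi => contDiffAt_comp_extChartAt_symm I (hg i hi)
  have hdh := fun i hi => contDiffAt_comp_extChartAt_symm I (hh i hi)
  have hA : ∀ a b : V, fderiv ℝ ξ' y₀ a b = fderiv ℝ (fderiv ℝ h₀') y₀ a b + ∑ i ∈ s,
      (fderiv ℝ (g' i) y₀ a (fderiv ℝ (h' i) y₀ b) +
        g' i y₀ (fderiv ℝ (fderiv ℝ (h' i)) y₀ a b)) := by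
    intro a b
    have e0 : HasFDerivAt (fderiv ℝ h₀') (fderiv ℝ (fderiv ℝ h₀') y₀) y₀ :=
      ((hd₀.fderiv_right (m := ∞) (by simp)).differentiableAt (by simp)).hasFDerivAt
    have e1 : ∀ i ∈ s, HasFDerivAt (fun y => (g' i y).comp (fderiv ℝ (h' i) y)) _ y₀ := fun i hi =>
      HasFDerivAt.clm_comp ((hdg i hi).differentiableAt (by simp)).hasFDerivAt
        (((hdh i hi).fderiv_right (m := ∞) (by simp)).differentiableAt (by simp)).hasFDerivAt
    have e2 := e0.add (HasFDerivAt.fun_sum e1)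
    rw [hev.fderiv_eq]
    refine (DFunLike.congr_fun (DFunLike.congr_fun e2.fderiv a) b).trans ?_
    simp only [_root_.add_apply, _root_.sum_apply, ContinuousLinearMap.comp_apply,
      ContinuousLinearMap.flip_apply, ContinuousLinearMap.compL_apply]
    congr 1
    exact Finset.sum_congr rfl fun i _ => add_comm _ _
  let D : TangentSpace I p → V := mfderiv I 𝓘(ℝ, V) (extChartAt I p) p
  have hdef : extDerivOneForm I ξ p u v =
      fderiv ℝ ξ' y₀ (D u) (D v) - fderiv ℝ ξ' y₀ (D v) (D u) := rfl
  -- The second derivatives of `h₀` and of the `h_i` are symmetric, hence cancel in the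
  -- antisymmetrisation.
  rw [hdef, hA, hA, fderiv_fderiv_symm hd₀, add_sub_add_left_eq_sub, ← Finset.sum_sub_distrib]
  refine Finset.sum_congr rfl fun i hi => ?_
  rw [fderiv_fderiv_symm (hdh i hi), diff_eq_fderiv_extChartAt I (hg i hi),
    diff_eq_fderiv_extChartAt I (hg i hi), diff_eq_fderiv_extChartAt I (hh i hi),
    diff_eq_fderiv_extChartAt I (hh i hi), add_sub_add_right_eq_sub]

end ExtDeriv

/-! ### The Lagrangian total derivative on a coordinate space of fixed order `N`. -/

section LocalOperators

variable {E : Type*} [NormedAddCommGroup E] [NormedSpace ℝ E]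
  {Q : Type*} [TopologicalSpace Q] [ChartedSpace E Q] [IsManifold 𝓘(ℝ, E) ∞ Q]
  {G : Type*} [NormedAddCommGroup G] [NormedSpace ℝ G]

/-- The expression of a function on `T^r Q × ℝ` in the natural coordinates of `T^N Q × ℝ`. -/
def loc (e : atlas E Q) {r N : ℕ} (h : r ≤ N) (F : Ext E Q r → G) :
    (Fin (N + 1) → E) × ℝ → G := fun x => F (natInv e r (truncL h x))

theorem contDiffOn_loc {e : atlas E Q} {r N : ℕ} (h : r ≤ N) {F : Ext E Q r → G}
    (hF : SmoothIn e F) : ContDiffOn ℝ ∞ (loc e h F) (natTarget e N) :=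
  ContDiffOn.comp (f := truncL h) hF (truncL (E := E) h).contDiff.contDiffOn (fun _ hx => hx)

theorem fderiv_loc {e : atlas E Q} {r N : ℕ} (h : r ≤ N) {F : Ext E Q r → G}
    (hF : SmoothIn e F) {x : (Fin (N + 1) → E) × ℝ} (hx : x ∈ natTarget e N)
    (v : (Fin (N + 1) → E) × ℝ) : fderiv ℝ (loc e h F) x v =
      fderiv ℝ (fun y => F (natInv e r y)) (truncL h x) (truncL h v) := by
  have h1 : HasFDerivAt (loc e h F) _ x := HasFDerivAt.comp (f := truncL h) x
    (hF.differentiableAt (show truncL h x ∈ natTarget e r from hx)).hasFDerivAt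
    (truncL (E := E) h).hasFDerivAt
  exact DFunLike.congr_fun h1.fderiv v

theorem loc_extProj {e : atlas E Q} {r s N : ℕ} (h : r ≤ s) (h' : s ≤ N) (F : Ext E Q r → G)
    {x : (Fin (N + 1) → E) × ℝ} (hx : x ∈ natTarget e N) :
    loc e h' (fun p => F (extProj h p)) x = loc e (h.trans h') F x := by
  change F (HOContact.extProj h (natInv e s (truncL h' x))) = _
  rw [extProj_natInv h (show truncL h' x ∈ natTarget e s from hx), truncL_truncL]
  rfl

theorem SmoothIn.extProj {e : atlas E Q} {r s : ℕ} (h : r ≤ s) {F : Ext E Q r → G}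
    (hF : SmoothIn e F) : SmoothIn e (fun p => F (HOContact.extProj h p)) :=
  (contDiffOn_loc h hF).congr fun _ hx => loc_extProj h le_rfl F hx

theorem loc_natCoords {e : atlas E Q} {r N : ℕ} (h : r ≤ N) (F : Ext E Q r → G) {p : Ext E Q N}
    (hp : p ∈ natSource e N) : loc e h F (natCoords e N p) = F (extProj h p) := by
  unfold loc
  rw [← natCoords_extProj h hp, natInv_natCoords ((extProj_mem h).2 hp)]

/-- The semispray `∑ q_{α+1} ∂/∂q_α + L ∂/∂z` in coordinates, truncated at order `N`. -/
def locSpray (e : atlas E Q) {k N : ℕ} (hk : k ≤ N) (L : Ext E Q k → ℝ)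
    (x : (Fin (N + 1) → E) × ℝ) : (Fin (N + 1) → E) × ℝ :=
  (fun j => coordL N (j + 1) x, loc e hk L x)

theorem coordL_locSpray (e : atlas E Q) {k N : ℕ} (hk : k ≤ N) (L : Ext E Q k → ℝ)
    (x : (Fin (N + 1) → E) × ℝ) (i : ℕ) :
    coordL N i (locSpray e hk L x) = coordL N (i + 1) x := by
  by_cases hi : i < N + 1
  · rw [coordL_of_lt hi]; rfl
  · rw [coordL_of_le (by omega), coordL_of_le (by omega)]

theorem contDiffOn_locSpray {e : atlas E Q} {k N : ℕ} (hk : k ≤ N) {L : Ext E Q k → ℝ}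
    (hL : SmoothIn e L) : ContDiffOn ℝ ∞ (locSpray e hk L) (natTarget e N) :=
  ContDiffOn.prodMk (contDiffOn_pi.2 fun j => (coordL (E := E) N (j + 1)).contDiff.contDiffOn)
    (contDiffOn_loc hk hL)

/-- The Lagrangian total derivative in coordinates. -/
def locD (e : atlas E Q) {k N : ℕ} (hk : k ≤ N) (L : Ext E Q k → ℝ)
    (f : (Fin (N + 1) → E) × ℝ → G) (x : (Fin (N + 1) → E) × ℝ) : G :=
  fderiv ℝ f x (locSpray e hk L x) - fderiv ℝ (loc e hk L) x (0, 1) • f x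

theorem contDiffOn_locD {e : atlas E Q} {k N : ℕ} (hk : k ≤ N) {L : Ext E Q k → ℝ}
    (hL : SmoothIn e L) {f : (Fin (N + 1) → E) × ℝ → G}
    (hf : ContDiffOn ℝ ∞ f (natTarget e N)) :
    ContDiffOn ℝ ∞ (locD e hk L f) (natTarget e N) := by
  have ho := isOpen_natTarget e N
  have h1 := hf.fderiv_of_isOpen (m := ∞) ho (by simp)
  have h2 := (contDiffOn_loc hk hL).fderiv_of_isOpen (m := ∞) ho (by simp)
  exact (h1.clm_apply (contDiffOn_locSpray hk hL)).sub
    ((h2.clm_apply contDiffOn_const).smul hf)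

theorem locD_congr {e : atlas E Q} {k N : ℕ} (hk : k ≤ N) {L : Ext E Q k → ℝ}
    {f g : (Fin (N + 1) → E) × ℝ → G} (h : EqOn f g (natTarget e N)) :
    EqOn (locD e hk L f) (locD e hk L g) (natTarget e N) := fun x hx => by
  have : f =ᶠ[𝓝 x] g := Filter.eventuallyEq_of_mem ((isOpen_natTarget e N).mem_nhds hx) h
  unfold locD
  rw [this.fderiv_eq, h hx]

theorem dCoords_vertical {e : atlas E Q} {k : ℕ} {p : Ext E Q k} (hp : p ∈ natSource e k) :
    dCoords e k p ((0 : Fin (k + 1) → E), (1 : ℝ)) = (0, 1) := by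
  refine Prod.ext (funext fun j => ?_) (dCoords_snd hp _)
  refine (dCoords_apply hp ((0 : Fin (k + 1) → E), (1 : ℝ)) j).trans ?_
  rw [seqRes_coordSeq ((0 : Fin (k + 1) → E), (1 : ℝ))]
  exact map_zero _

theorem derivZ_eq {e : atlas E Q} {k : ℕ} {L : Ext E Q k → ℝ} (hL : SmoothIn e L)
    {p : Ext E Q k} (hp : p ∈ natSource e k) :
    derivZ L p = fderiv ℝ (fun x => L (natInv e k x)) (natCoords e k p) (0, 1) := by
  refine (diff_eq hL hp ((0 : Fin (k + 1) → E), (1 : ℝ))).trans ?_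
  rw [dCoords_vertical hp]

/-- The Lagrangian total derivative of functions in coordinates. -/
theorem loc_lagDeriv {e : atlas E Q} {k a N : ℕ} (hk : k ≤ N) (h : k + a + 1 ≤ N)
    {L : Ext E Q k → ℝ} (hL : SmoothIn e L) {F : Ext E Q (k + a) → G} (hF : SmoothIn e F) :
    EqOn (loc e h (lagDeriv L F)) (locD e hk L (loc e (by omega : k + a ≤ N) F))
      (natTarget e N) := fun x hx => by
  have hx1 : truncL h x ∈ natTarget e (k + a + 1) := hx
  have hx2 : truncL (show k + a ≤ N by omega) x ∈ natTarget e (k + a) := hx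
  have hx3 : truncL hk x ∈ natTarget e k := hx
  have hp := natInv_mem hx1
  have e1 : extProj (Nat.le_succ (k + a)) (natInv e (k + a + 1) (truncL h x)) =
      natInv e (k + a) (truncL (by omega) x) := extProj_natInv _ hx1
  have e2 : extProj (show k ≤ k + a + 1 by omega) (natInv e (k + a + 1) (truncL h x)) =
      natInv e k (truncL hk x) := extProj_natInv _ hx1
  have hp' : extProj (Nat.le_succ (k + a)) (natInv e (k + a + 1) (truncL h x)) ∈
    natSource e (k + a) := (extProj_mem _).2 hp
  change lagDeriv L F (natInv e (k + a + 1) (truncL h x)) = _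
  unfold lagDeriv locD
  rw [diff_eq hF hp', dCoords_totalVec L hp, natCoords_natInv hx1, e2, e1, natCoords_natInv hx2,
    fderiv_loc (show k + a ≤ N by omega) hF hx, fderiv_loc hk hL hx, derivZ_eq hL (natInv_mem hx3),
    natCoords_natInv hx3]
  -- Since `k + a + 1 ≤ N`, every coordinate `q_{j+1}` needed here exists at order `N`; the zero put
  -- by `locSpray` in place of `q_{N+1}` is lost in the truncation.
  congr 2
  refine Prod.ext (funext fun j => ?_) rfl
  change x.1 ⟨(j.succ : Fin (k + a + 2)), by omega⟩ = coordL N ((j : ℕ) + 1) x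
  rw [coordL_of_lt (by omega)]
  rfl

theorem SmoothIn.lagDeriv {e : atlas E Q} {k a : ℕ} {L : Ext E Q k → ℝ} (hL : SmoothIn e L)
    {F : Ext E Q (k + a) → G} (hF : SmoothIn e F) : SmoothIn e (lagDeriv L F) :=
  (contDiffOn_locD (by omega : k ≤ k + a + 1) hL (contDiffOn_loc (Nat.le_succ (k + a)) hF)).congr
    (loc_lagDeriv (by omega) le_rfl hL hF)

theorem SmoothIn.lagDerivIter {e : atlas E Q} {k : ℕ} {L : Ext E Q k → ℝ} (hL : SmoothIn e L)
    {F : Ext E Q k → G} (hF : SmoothIn e F) : ∀ a, SmoothIn e (lagDerivIter L F a)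
  | 0 => hF
  | a + 1 => SmoothIn.lagDeriv hL (SmoothIn.lagDerivIter hL hF a)

/-- The coordinate `q_i` as a function on `T^r Q × ℝ`. -/
def coordFun (e : atlas E Q) (r i : ℕ) (p : Ext E Q r) : E := coordL r i (natCoords e r p)

theorem smoothIn_coordFun (e : atlas E Q) (r i : ℕ) : SmoothIn e (coordFun e r i) :=
  (coordL (E := E) r i).contDiff.contDiffOn.congr fun x hx => by
    change coordL r i (natCoords e r (natInv e r x)) = _
    rw [natCoords_natInv hx]

theorem diff_coordFun {e : atlas E Q} {r i : ℕ} {p : Ext E Q r} (hp : p ∈ natSource e r)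
    (v : TangentSpace (extModel E r) p) :
    diff (extModel E r) (coordFun e r i) p v = coordL r i (dCoords e r p v) := by
  have h1 : HasMFDerivAt (extModel E r) 𝓘(ℝ, E) (coordFun e r i) p _ :=
    HasMFDerivAt.comp p (coordL (E := E) r i).hasFDerivAt.hasMFDerivAt
      (mdifferentiableAt_natCoords hp).hasMFDerivAt
  exact DFunLike.congr_fun h1.mfderiv v

theorem mdifferentiableAt_extProj {r s : ℕ} (h : r ≤ s) (p : Ext E Q s) :
    MDifferentiableAt (extModel E s) (extModel E r) (extProj h) p := by
  have hp := mem_natSource_baseChart p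
  have h1 := MDifferentiableAt.comp (g := truncL h) p
    ((truncL (E := E) h).differentiableAt.mdifferentiableAt) (mdifferentiableAt_natCoords hp)
  have h2 := MDifferentiableAt.comp p (mdifferentiableAt_natInv
    (show truncL h (natCoords (baseChart p) s p) ∈ natTarget (baseChart p) r from
      natCoords_mem hp)) h1
  refine h2.congr_of_eventuallyEq ?_
  filter_upwards [eventually_natSource hp] with p' hp'
  simp only [Function.comp_apply]
  rw [← natCoords_extProj h hp', natInv_natCoords ((extProj_mem h).2 hp')]

theorem diff_comp_extProj {r s : ℕ} (h : r ≤ s) {F : Ext E Q r → G} {p : Ext E Q s}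
    (hF : MDifferentiableAt (extModel E r) 𝓘(ℝ, G) F (extProj h p))
    (v : TangentSpace (extModel E s) p) :
    diff (extModel E s) (fun p => F (extProj h p)) p v =
      diff (extModel E r) F (extProj h p)
        (mfderiv (extModel E s) (extModel E r) (extProj h) p v) :=
  DFunLike.congr_fun (HasMFDerivAt.comp p hF.hasMFDerivAt
    (mdifferentiableAt_extProj h p).hasMFDerivAt).mfderiv v

theorem dCoords_mfderiv_extProj {e : atlas E Q} {r s : ℕ} (h : r ≤ s) {p : Ext E Q s}
    (hp : p ∈ natSource e s) (v : TangentSpace (extModel E s) p) :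
    dCoords e r (extProj h p) (mfderiv (extModel E s) (extModel E r) (extProj h) p v) =
      truncL h (dCoords e s p v) := by
  have h0 := diff_comp_extProj h (mdifferentiableAt_natCoords ((extProj_mem h).2 hp)) v
  have h1 : HasMFDerivAt (extModel E s) 𝓘(ℝ, (Fin (r + 1) → E) × ℝ)
      (truncL h ∘ natCoords e s) p _ :=
    HasMFDerivAt.comp p (truncL (E := E) h).hasFDerivAt.hasMFDerivAt
      (mdifferentiableAt_natCoords hp).hasMFDerivAt
  have h2 : HasMFDerivAt (extModel E s) 𝓘(ℝ, (Fin (r + 1) → E) × ℝ)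
      (fun p => natCoords e r (extProj h p)) p _ := h1.congr_of_eventuallyEq (by
    filter_upwards [eventually_natSource hp] with p' hp'
    exact natCoords_extProj h hp')
  exact h0.symm.trans (DFunLike.congr_fun h2.mfderiv v)

end LocalOperators

/-! ### Coefficients of the iterated Lagrangian total derivatives of a `1`-form. -/

section FormRep

variable {E : Type*} [NormedAddCommGroup E] [NormedSpace ℝ E]
  {Q : Type*} [TopologicalSpace Q] [ChartedSpace E Q] [IsManifold 𝓘(ℝ, E) ∞ Q]

/-- The `1`-form `ξ` on `T^r Q × ℝ` is `∑ g_i dq_i` in the natural coordinates induced by `e`. -/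
structure FormRep (e : atlas E Q) {r : ℕ}
    (ξ : ∀ p : Ext E Q r, TangentSpace (extModel E r) p →L[ℝ] ℝ)
    (g : ℕ → Ext E Q r → E →L[ℝ] ℝ) : Prop where
  smooth : ∀ i, SmoothIn e (g i)
  support : ∀ i, r < i → g i = 0
  eq : ∀ p ∈ natSource e r, ∀ v : TangentSpace (extModel E r) p,
    ξ p v = ∑ i ∈ Finset.range (r + 1), g i p (coordL r i (dCoords e r p v))

/-- The coefficients of the Lagrangian total derivative of a `1`-form. -/
def nextCoeff {k a : ℕ} (L : Ext E Q k → ℝ) (g : ℕ → Ext E Q (k + a) → E →L[ℝ] ℝ) (i : ℕ) :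
    Ext E Q (k + a + 1) → E →L[ℝ] ℝ := fun p =>
  lagDeriv L (g i) p + if i = 0 then 0 else g (i - 1) (extProj (Nat.le_succ (k + a)) p)

theorem lagDeriv_zero {G : Type*} [NormedAddCommGroup G] [NormedSpace ℝ G] {k a : ℕ}
    (L : Ext E Q k → ℝ) : lagDeriv (a := a) L (0 : Ext E Q (k + a) → G) = 0 := by
  funext p
  have : diff (extModel E (k + a)) (0 : Ext E Q (k + a) → G)
      (extProj (Nat.le_succ (k + a)) p) = 0 :=
    mfderiv_const
  unfold lagDeriv
  rw [this]
  simp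

theorem SmoothIn.add {G : Type*} [NormedAddCommGroup G] [NormedSpace ℝ G] {e : atlas E Q} {r : ℕ}
    {F F' : Ext E Q r → G} (h : SmoothIn e F) (h' : SmoothIn e F') :
    SmoothIn e (fun p => F p + F' p) := ContDiffOn.add h h'

theorem SmoothIn.const_smul {G : Type*} [NormedAddCommGroup G] [NormedSpace ℝ G] {e : atlas E Q}
    {r : ℕ} {F : Ext E Q r → G} (h : SmoothIn e F) (c : ℝ) :
    SmoothIn e (fun p => c • F p) := contDiffOn_const.smul h

theorem smoothIn_const {G : Type*} [NormedAddCommGroup G] [NormedSpace ℝ G] {e : atlas E Q}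
    {r : ℕ} (c : G) : SmoothIn e (fun _ : Ext E Q r => c) := contDiffOn_const

theorem SmoothIn.nextCoeff {e : atlas E Q} {k a : ℕ} {L : Ext E Q k → ℝ} (hL : SmoothIn e L)
    {g : ℕ → Ext E Q (k + a) → E →L[ℝ] ℝ} (hg : ∀ i, SmoothIn e (g i)) (i : ℕ) :
    SmoothIn e (nextCoeff L g i) := by
  refine SmoothIn.add (SmoothIn.lagDeriv hL (hg i)) ?_
  by_cases h : i = 0
  · simp only [h, if_true]; exact smoothIn_const 0
  · simp only [h, if_false]; exact SmoothIn.extProj _ (hg (i - 1))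

theorem fderiv_clm_apply_apply {F : Type*} [NormedAddCommGroup F] [NormedSpace ℝ F]
    {c : F → E →L[ℝ] ℝ} {u : F → E} {x : F} (hc : DifferentiableAt ℝ c x)
    (hu : DifferentiableAt ℝ u x) (v : F) :
    fderiv ℝ (fun y => c y (u y)) x v = fderiv ℝ c x v (u x) + c x (fderiv ℝ u x v) := by
  rw [fderiv_clm_apply hc hu]
  simp [add_comm]

theorem SmoothIn.clm_apply {e : atlas E Q} {r : ℕ} {F : Ext E Q r → E →L[ℝ] ℝ}
    {u : Ext E Q r → E} (h : SmoothIn e F) (h' : SmoothIn e u) :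
    SmoothIn e (fun p => F p (u p)) := ContDiffOn.clm_apply h h'

theorem SmoothIn.sum {G : Type*} [NormedAddCommGroup G] [NormedSpace ℝ G] {e : atlas E Q} {r : ℕ}
    {ι : Type*} {s : Finset ι} {F : ι → Ext E Q r → G} (h : ∀ i ∈ s, SmoothIn e (F i)) :
    SmoothIn e (fun p => ∑ i ∈ s, F i p) := ContDiffOn.sum h

theorem diff_sum_clm_apply {e : atlas E Q} {r : ℕ} {ι : Type*} {s : Finset ι}
    {F : ι → Ext E Q r → E →L[ℝ] ℝ} {u : ι → Ext E Q r → E} (h : ∀ i ∈ s, SmoothIn e (F i))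
    (h' : ∀ i ∈ s, SmoothIn e (u i)) {p : Ext E Q r} (hp : p ∈ natSource e r)
    (v : TangentSpace (extModel E r) p) :
    diff (extModel E r) (fun p => ∑ i ∈ s, F i p (u i p)) p v =
      ∑ i ∈ s, (diff (extModel E r) (F i) p v (u i p) + F i p (diff (extModel E r) (u i) p v)) := by
  have hx := natCoords_mem hp
  rw [diff_eq (SmoothIn.sum fun i hi => (h i hi).clm_apply (h' i hi)) hp,
    fderiv_fun_sum fun i hi => ((h i hi).clm_apply (h' i hi)).differentiableAt hx,
    _root_.sum_apply]
  refine Finset.sum_congr rfl fun i hi => ?_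
  rw [fderiv_clm_apply_apply ((h i hi).differentiableAt hx) ((h' i hi).differentiableAt hx),
    diff_eq (h i hi) hp, diff_eq (h' i hi) hp, natInv_natCoords hp]

/-- In Cartan's formula for `∑ g_i dq_i` the terms `dg_i · q_{i+1}` of `i(Γ) dξ` and of `d(i(Γ) ξ)`
cancel. What remains is `(Γ g_i) dq_i + g_i dq_{i+1}`, so the coefficients undergo `D_L` plus an
index shift. -/
theorem FormRep.lagDerivForm {e : atlas E Q} {k a : ℕ} {L : Ext E Q k → ℝ} (hL : SmoothIn e L)
    {ξ : ∀ p : Ext E Q (k + a), TangentSpace (extModel E (k + a)) p →L[ℝ] ℝ}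
    {g : ℕ → Ext E Q (k + a) → E →L[ℝ] ℝ} (h : FormRep e ξ g) :
    FormRep e (lagDerivForm L ξ) (nextCoeff L g) := by
  refine ⟨SmoothIn.nextCoeff hL h.smooth, fun i hi => ?_, fun p hp v => ?_⟩
  · funext p
    unfold nextCoeff
    rw [h.support i (by omega), h.support (i - 1) (by omega), lagDeriv_zero]
    simp
  · set p' := extProj (Nat.le_succ (k + a)) p with hp'def
    have hp' : p' ∈ natSource e (k + a) := (extProj_mem _).2 hp
    set v' : TangentSpace (extModel E (k + a)) p' :=
      mfderiv (extModel E (k + a + 1)) (extModel E (k + a)) (extProj (Nat.le_succ (k + a))) p v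
      with hv'
    have hv'c : ∀ i < k + a + 1, coordL (k + a) i (dCoords e (k + a) p' v') =
        coordL (k + a + 1) i (dCoords e (k + a + 1) p v) := fun i hi => by
      have := dCoords_mfderiv_extProj (Nat.le_succ (k + a)) hp v
      rw [hv', hp'def, this, coordL_truncL _ _ hi]
    set tv : TangentSpace (extModel E (k + a)) p' := totalVec L p with htv
    have h1 : extDerivOneForm (extModel E (k + a)) ξ p' tv v' =
        ∑ i ∈ Finset.range (k + a + 1),
          (diff (extModel E (k + a)) (g i) p' tv (coordL (k + a) i (dCoords e (k + a) p' v'))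
          - diff (extModel E (k + a)) (g i) p' v'
            (coordL (k + a + 1) (i + 1) (natCoords e (k + a + 1) p))) := by
      rw [extDerivOneForm_sum (extModel E (k + a)) (Finset.range (k + a + 1))
        (h₀ := fun _ => 0) (g := g) (h := coordFun e (k + a)) contMDiffAt_const
        (fun i _ => (h.smooth i).contMDiffAt hp')
        (fun i _ => (smoothIn_coordFun e (k + a) i).contMDiffAt hp')]
      · refine Finset.sum_congr rfl fun i hi => ?_
        rw [diff_coordFun hp', diff_coordFun hp', htv,
          coordL_dCoords_totalVec L hp (Finset.mem_range.1 hi)]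
      · filter_upwards [eventually_natSource hp'] with p'' hp'' w
        have h0 : diff (extModel E (k + a)) (fun _ => (0 : ℝ)) p'' = 0 := mfderiv_const
        rw [h.eq p'' hp'' w, h0, _root_.zero_apply, zero_add]
        exact Finset.sum_congr rfl fun i _ => by rw [diff_coordFun hp'']
    have h2 : diff (extModel E (k + a + 1))
        (fun p' => ξ (extProj (Nat.le_succ (k + a)) p') (totalVec L p')) p v =
        ∑ i ∈ Finset.range (k + a + 1),
          (diff (extModel E (k + a)) (g i) p' v'
            (coordL (k + a + 1) (i + 1) (natCoords e (k + a + 1) p))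
          + g i p' (coordL (k + a + 1) (i + 1) (dCoords e (k + a + 1) p v))) := by
      have hev : (fun p' => ξ (extProj (Nat.le_succ (k + a)) p') (totalVec L p')) =ᶠ[𝓝 p]
          fun p' => ∑ i ∈ Finset.range (k + a + 1), g i (extProj (Nat.le_succ (k + a)) p')
            (coordFun e (k + a + 1) (i + 1) p') := by
        filter_upwards [eventually_natSource hp] with p'' hp''
        rw [h.eq _ ((extProj_mem _).2 hp'')]
        exact Finset.sum_congr rfl fun i hi => by
          rw [coordL_dCoords_totalVec L hp'' (Finset.mem_range.1 hi)]; rfl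
      refine (DFunLike.congr_fun hev.mfderiv_eq v).trans ?_
      refine (diff_sum_clm_apply (e := e) (fun i _ => SmoothIn.extProj _ (h.smooth i))
        (fun i _ => smoothIn_coordFun e _ _) hp v).trans ?_
      refine Finset.sum_congr rfl fun i _ => ?_
      rw [diff_comp_extProj _ ((h.smooth i).mdifferentiableAt hp'), diff_coordFun hp]
      rfl
    have h3 : ξ p' v' = ∑ i ∈ Finset.range (k + a + 1),
        g i p' (coordL (k + a) i (dCoords e (k + a) p' v')) := h.eq p' hp' v'
    have h4 : HOContact.lagDerivForm L ξ p v = extDerivOneForm (extModel E (k + a)) ξ p' tv v'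
        + diff (extModel E (k + a + 1))
        (fun p' => ξ (extProj (Nat.le_succ (k + a)) p') (totalVec L p')) p v
        - derivZ L (extProj (by omega : k ≤ k + a + 1) p) * ξ p' v' := rfl
    have h5 : ∀ i, lagDeriv L (g i) p = diff (extModel E (k + a)) (g i) p' tv -
      derivZ L (extProj (by omega : k ≤ k + a + 1) p) • g i p' := fun i => rfl
    -- The order rises by one: the new top coefficient receives only the shifted term.
    have h6 : lagDeriv L (g (k + a + 1)) p = 0 := by
      rw [h.support _ (Nat.lt_succ_self _), lagDeriv_zero]; rfl
    rw [h4, h1, h2, h3, Finset.mul_sum, ← Finset.sum_add_distrib, ← Finset.sum_sub_distrib]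
    unfold nextCoeff
    simp only [_root_.add_apply, Finset.sum_add_distrib]
    rw [Finset.sum_range_succ (fun i => (lagDeriv L (g i) p) _), h6, _root_.zero_apply, add_zero]
    rw [Finset.sum_range_succ' (fun i => (if i = 0 then (0 : E →L[ℝ] ℝ) else
      g (i - 1) (extProj (Nat.le_succ (k + a)) p)) _)]
    simp only [if_true, _root_.zero_apply, add_zero, Nat.add_eq_zero_iff, one_ne_zero, and_false,
      if_false, Nat.add_sub_cancel]
    rw [← Finset.sum_add_distrib]
    refine Finset.sum_congr rfl fun i hi => ?_
    rw [hv'c i (Finset.mem_range.1 hi), h5, _root_.sub_apply, _root_.smul_apply, smul_eq_mul]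
    ring

/-- The coefficients of the iterated Lagrangian total derivatives of a `1`-form. -/
def iterCoeff {k : ℕ} (L : Ext E Q k → ℝ) (g : ℕ → Ext E Q k → E →L[ℝ] ℝ) :
    (a : ℕ) → ℕ → Ext E Q (k + a) → E →L[ℝ] ℝ
  | 0 => g
  | a + 1 => nextCoeff L (iterCoeff L g a)

theorem FormRep.lagDerivFormIter {e : atlas E Q} {k : ℕ} {L : Ext E Q k → ℝ} (hL : SmoothIn e L)
    {ξ : ∀ p : Ext E Q k, TangentSpace (extModel E k) p →L[ℝ] ℝ}
    {g : ℕ → Ext E Q k → E →L[ℝ] ℝ} (h : FormRep e ξ g) :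
    ∀ a, FormRep e (lagDerivFormIter L ξ a) (iterCoeff L g a)
  | 0 => h
  | a + 1 => (FormRep.lagDerivFormIter hL h a).lagDerivForm hL

end FormRep

/-! ### The binomial identities that produce the momenta. -/

section Binomial

/-- Up to sign this is the `n`-th finite difference of `b ↦ C(b,m)`, a polynomial of degree `m < n`.
Pascal's rule in `n` and then in `m` gives the recursion `S(n+1, m+1) = -S(n, m)`. -/
theorem sum_alternating_choose_mul_choose (n : ℕ) : ∀ m, m < n →
    ∑ b ∈ Finset.range (n + 1), (-1 : ℝ) ^ b * (n.choose b * b.choose m) = 0 := by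
  have hrec : ∀ n m : ℕ, ∑ b ∈ Finset.range (n + 2), (-1 : ℝ) ^ b * ((n + 1).choose b * b.choose m)
      = ∑ b ∈ Finset.range (n + 1), (-1 : ℝ) ^ b * (n.choose b * b.choose m)
        - ∑ b ∈ Finset.range (n + 1), (-1 : ℝ) ^ b * (n.choose b * (b + 1).choose m) := by
    intro n m
    rw [Finset.sum_range_succ']
    have h1 : ∀ b, (-1 : ℝ) ^ (b + 1) * ((n + 1).choose (b + 1) * (b + 1).choose m) =
        (-1 : ℝ) ^ (b + 1) * (n.choose (b + 1) * (b + 1).choose m)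
        - (-1 : ℝ) ^ b * (n.choose b * (b + 1).choose m) := by
      intro b
      rw [Nat.choose_succ_succ]
      push_cast
      ring
    simp only [h1, Finset.sum_sub_distrib]
    have h2 := Finset.sum_range_succ' (fun b => (-1 : ℝ) ^ b * (n.choose b * b.choose m)) (n + 1)
    rw [Finset.sum_range_succ _ (n + 1)] at h2
    simp only [Nat.choose_succ_self, Nat.cast_zero, zero_mul, mul_zero, add_zero,
      Nat.choose_zero_right] at h2 ⊢
    linarith
  induction n with
  | zero => intro m hm; omega
  | succ n ih =>
    intro m hm
    rw [hrec]
    cases m with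
    | zero => simp
    | succ m =>
      have := ih m (by omega)
      simp only [Nat.choose_succ_succ _ m, Nat.cast_add, mul_add, Finset.sum_add_distrib]
      linarith

/-- Pascal's rule for `C(n+1, b+1)` reduces `n + 1` to `n` up to the preceding sum, which vanishes
unless `m = n`; for `m = n` only its term `b = n` survives. -/
theorem sum_alternating_choose_mul_choose_succ (n : ℕ) : ∀ m, m < n →
    ∑ b ∈ Finset.range n, (-1 : ℝ) ^ b * (b.choose m * n.choose (b + 1)) = (-1) ^ m := by
  induction n with
  | zero => intro m hm; omega
  | succ n ih =>
    intro m hm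
    have h1 : ∑ b ∈ Finset.range (n + 1), (-1 : ℝ) ^ b * (b.choose m * (n + 1).choose (b + 1)) =
        ∑ b ∈ Finset.range (n + 1), (-1 : ℝ) ^ b * (n.choose b * b.choose m) +
        ∑ b ∈ Finset.range n, (-1 : ℝ) ^ b * (b.choose m * n.choose (b + 1)) := by
      have h2 : ∑ b ∈ Finset.range n, (-1 : ℝ) ^ b * (b.choose m * n.choose (b + 1)) =
          ∑ b ∈ Finset.range (n + 1), (-1 : ℝ) ^ b * (b.choose m * n.choose (b + 1)) := by
        rw [Finset.sum_range_succ]; simp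
      rw [h2, ← Finset.sum_add_distrib]
      refine Finset.sum_congr rfl fun b _ => ?_
      rw [Nat.choose_succ_succ n b]
      push_cast
      ring
    rw [h1]
    rcases Nat.lt_succ_iff_lt_or_eq.1 hm with h | h
    · rw [sum_alternating_choose_mul_choose n m h, ih m h, zero_add]
    · subst h
      have h3 : ∑ b ∈ Finset.range m, (-1 : ℝ) ^ b * (b.choose m * m.choose (b + 1)) = 0 :=
        Finset.sum_eq_zero fun b hb => by
          rw [Nat.choose_eq_zero_of_lt (Finset.mem_range.1 hb)]; simp
      rw [h3, Finset.sum_range_succ, Finset.sum_eq_zero fun b hb => by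
          rw [Nat.choose_eq_zero_of_lt (Finset.mem_range.1 hb)]; simp]
      simp

variable {A : Type*} [AddCommGroup A] [Module ℝ A] (D : A →ₗ[ℝ] A)

/-- The shift on sequences. -/
def rightShift (A : Type*) [AddCommGroup A] [Module ℝ A] : (ℕ → A) →ₗ[ℝ] (ℕ → A) where
  toFun f i := if i = 0 then 0 else f (i - 1)
  map_add' f g := by funext i; by_cases h : i = 0 <;> simp [h]
  map_smul' c f := by funext i; by_cases h : i = 0 <;> simp [h]

theorem rightShift_pow_apply (n : ℕ) (f : ℕ → A) (i : ℕ) :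
    (rightShift A ^ n) f i = if n ≤ i then f (i - n) else 0 := by
  induction n generalizing i with
  | zero => simp
  | succ n ih =>
    rw [pow_succ']
    change (if i = 0 then 0 else (rightShift A ^ n) f (i - 1)) = _
    by_cases h : i = 0
    · simp [h]
    · rw [if_neg h, ih]
      by_cases h2 : n + 1 ≤ i
      · rw [if_pos h2, if_pos (by omega)]; congr 1; omega
      · rw [if_neg h2, if_neg (by omega)]

/-- The componentwise action on sequences. -/
def seqMap : (ℕ → A) →ₗ[ℝ] (ℕ → A) := LinearMap.pi fun i => D.comp (LinearMap.proj i)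

theorem seqMap_pow_apply (n : ℕ) (f : ℕ → A) (i : ℕ) :
    (seqMap D ^ n) f i = (D ^ n) (f i) := by
  induction n generalizing i with
  | zero => simp
  | succ n ih =>
    rw [pow_succ', pow_succ']
    change D ((seqMap D ^ n) f i) = D ((D ^ n) (f i))
    rw [ih]

theorem commute_seqMap_rightShift : Commute (seqMap D) (rightShift A) := by
  refine LinearMap.ext fun f => funext fun i => ?_
  change D (if i = 0 then 0 else f (i - 1)) = if i = 0 then 0 else D (f (i - 1))
  split_ifs <;> simp

/-- The combinatorial identity behind the Jacobi–Ostrogradsky momenta. -/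
theorem sum_iterated_eq_momentum {k : ℕ} {l : ℕ → A} (hl : ∀ i, k < i → l i = 0)
    {f : ℕ → ℕ → ℕ → A}
    (h0 : ∀ b i, f b 0 i = (((b + 1 + i).factorial : ℝ) / i.factorial) • l (b + 1 + i))
    (hs : ∀ b a i, f b (a + 1) i = D (f b a i) + if i = 0 then 0 else f b a (i - 1)) (i : ℕ) :
    ∑ b ∈ Finset.range k, ((-1 : ℝ) ^ b / (b + 1).factorial) • f b b i =
      ∑ m ∈ Finset.range k, (-1 : ℝ) ^ m • (D ^ m) (l (i + 1 + m)) := by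
  -- The recursion for `f` is the application of `D + S`, with `S` the index shift; the two commute,
  -- so the binomial theorem applies.
  have h1 : ∀ b a, f b a = ((seqMap D + rightShift A) ^ a) (f b 0) := by
    intro b a
    induction a with
    | zero => rfl
    | succ a ih =>
      funext i
      rw [hs, ih, pow_succ']
      rfl
  have h2 : ∀ b < k, ((-1 : ℝ) ^ b / (b + 1).factorial) • f b b i = ∑ m ∈ Finset.range k,
      ((-1 : ℝ) ^ b * (b.choose m * (i + 1 + m).choose (b + 1))) • (D ^ m) (l (i + 1 + m)) := by
    intro b hb
    have e1 : f b b i = ∑ m ∈ Finset.range (b + 1),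
        (b.choose m : ℝ) • (D ^ m) ((rightShift A ^ (b - m)) (f b 0) i) := by
      rw [h1 b b, (commute_seqMap_rightShift D).add_pow, LinearMap.sum_apply, Finset.sum_apply]
      refine Finset.sum_congr rfl fun m _ => ?_
      rw [← seqMap_pow_apply]
      have : (((b.choose m : ℕ) : Module.End ℝ (ℕ → A))) = (b.choose m : ℝ) • 1 := by
        ext1; simp [Nat.cast_smul_eq_nsmul]
      rw [this, mul_smul_comm, mul_one]
      rfl
    rw [e1, Finset.smul_sum, ← Finset.sum_subset (Finset.range_subset_range.2
      (show b + 1 ≤ k by omega)) (fun m _ hm => by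
        rw [Nat.choose_eq_zero_of_lt (by simpa using hm)]; simp)]
    refine Finset.sum_congr rfl fun m hm => ?_
    have hmb : m ≤ b := by simpa [Nat.lt_succ_iff] using hm
    rw [rightShift_pow_apply]
    split_ifs with hc
    · rw [h0]
      have e2 : b + 1 + (i - (b - m)) = i + 1 + m := by omega
      have e3 : i - (b - m) = i + 1 + m - (b + 1) := by omega
      rw [e2, e3, map_smul, smul_smul, smul_smul]
      congr 1
      -- The factorials from `J_{b+1}` and the weight `1 / (b+1)!` combine to `C(i+1+m, b+1)`.
      rw [Nat.cast_choose ℝ (show b + 1 ≤ i + 1 + m by omega)]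
      have : ((b + 1).factorial : ℝ) ≠ 0 := by positivity
      field_simp
    · rw [Nat.choose_eq_zero_of_lt (show i + 1 + m < b + 1 by omega)]
      simp
  rw [Finset.sum_congr rfl fun b hb => h2 b (Finset.mem_range.1 hb), Finset.sum_comm]
  refine Finset.sum_congr rfl fun m hm => ?_
  rw [← Finset.sum_smul]
  -- Either `l (i+1+m)` vanishes, or `i+1+m ≤ k` and the sum over `b < k` stops at `b < i+1+m`,
  -- where the alternating identity is exact.
  by_cases hk : k < i + 1 + m
  · rw [hl _ hk]; simp
  · rw [← sum_alternating_choose_mul_choose_succ (i + 1 + m) m (by omega)]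
    congr 1
    symm
    refine Finset.sum_subset (Finset.range_subset_range.2 (by omega)) fun b _ hb => ?_
    rw [Nat.choose_eq_zero_of_lt (show i + 1 + m < b + 1 by
      have := Finset.mem_range.not.1 hb; omega)]
    simp

/-- Splitting off the term `m = 0` gives both the recursion of the momenta and the reduction of the
Herglotz expression to `p_0`. -/
theorem alternating_sum_eq_sub (l : ℕ → A) (k : ℕ) :
    ∑ m ∈ Finset.range (k + 1), (-1 : ℝ) ^ m • (D ^ m) (l m) =
      l 0 - D (∑ m ∈ Finset.range k, (-1 : ℝ) ^ m • (D ^ m) (l (m + 1))) := by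
  rw [Finset.sum_range_succ', map_sum, sub_eq_add_neg, add_comm, ← Finset.sum_neg_distrib]
  congr 1
  · simp
  · refine Finset.sum_congr rfl fun m _ => ?_
    rw [map_smul, pow_succ', pow_succ']
    simp [Module.End.mul_apply]

end Binomial

/-! ### Function spaces on which `D_L` is a linear endomorphism; the derivatives `∂L/∂q_i`. -/

section Momenta

variable {E : Type*} [NormedAddCommGroup E] [NormedSpace ℝ E]
  {Q : Type*} [TopologicalSpace Q] [ChartedSpace E Q] [IsManifold 𝓘(ℝ, E) ∞ Q]
  {G : Type*} [NormedAddCommGroup G] [NormedSpace ℝ G]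

/-- Functions smooth in the range of the natural coordinates, zero elsewhere. -/
def smoothFun (e : atlas E Q) (N : ℕ) (G : Type*) [NormedAddCommGroup G] [NormedSpace ℝ G] :
    Submodule ℝ ((Fin (N + 1) → E) × ℝ → G) where
  carrier := {f | ContDiffOn ℝ ∞ f (natTarget e N) ∧ ∀ x ∉ natTarget e N, f x = 0}
  add_mem' h h' := ⟨h.1.add h'.1, fun x hx => by simp [h.2 x hx, h'.2 x hx]⟩
  zero_mem' := ⟨contDiffOn_const, fun _ _ => rfl⟩
  smul_mem' c _ h := ⟨contDiffOn_const.smul h.1, fun x hx => by simp [h.2 x hx]⟩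

/-- The space of functions smooth in the range of the natural coordinates, zero elsewhere. -/
def SmoothFun (e : atlas E Q) (N : ℕ) (G : Type*) [NormedAddCommGroup G] [NormedSpace ℝ G] :
    Type _ := smoothFun e N G

instance (e : atlas E Q) (N : ℕ) : AddCommGroup (SmoothFun e N G) :=
  inferInstanceAs (AddCommGroup (smoothFun e N G))

instance (e : atlas E Q) (N : ℕ) : Module ℝ (SmoothFun e N G) :=
  inferInstanceAs (Module ℝ (smoothFun e N G))

open Classical in
/-- The element of `SmoothFun` given by a smooth function. -/
def toSmooth {e : atlas E Q} {N : ℕ} (f : (Fin (N + 1) → E) × ℝ → G)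
    (hf : ContDiffOn ℝ ∞ f (natTarget e N)) : SmoothFun e N G :=
  ⟨fun x => if x ∈ natTarget e N then f x else 0,
    hf.congr fun _ hx => if_pos hx, fun _ hx => if_neg hx⟩

theorem toSmooth_apply {e : atlas E Q} {N : ℕ} {f : (Fin (N + 1) → E) × ℝ → G}
    (hf : ContDiffOn ℝ ∞ f (natTarget e N)) {x : (Fin (N + 1) → E) × ℝ} (hx : x ∈ natTarget e N) :
    (toSmooth f hf).1 x = f x := if_pos hx

/-- Fixing the value `0` off the chart range makes equality on the range genuine equality, so that
the module identities of the binomial part can be applied to these functions. -/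
theorem smoothFun_ext {e : atlas E Q} {N : ℕ} {f g : SmoothFun e N G}
    (h : EqOn f.1 g.1 (natTarget e N)) : f = g := by
  refine Subtype.ext (funext fun x => ?_)
  by_cases hx : x ∈ natTarget e N
  · exact h hx
  · rw [f.2.2 x hx, g.2.2 x hx]

theorem differentiableAt_smoothFun {e : atlas E Q} {N : ℕ} (f : SmoothFun e N G)
    {x : (Fin (N + 1) → E) × ℝ} (hx : x ∈ natTarget e N) : DifferentiableAt ℝ f.1 x :=
  (f.2.1.contDiffAt ((isOpen_natTarget e N).mem_nhds hx)).differentiableAt (by simp)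

/-- The Lagrangian total derivative in coordinates as a linear operator. -/
def locDLin {e : atlas E Q} {k N : ℕ} (hk : k ≤ N) {L : Ext E Q k → ℝ} (hL : SmoothIn e L) :
    SmoothFun e N G →ₗ[ℝ] SmoothFun e N G where
  toFun f := toSmooth (locD e hk L f.1) (contDiffOn_locD hk hL f.2.1)
  map_add' f g := smoothFun_ext fun x hx => by
    rw [toSmooth_apply _ hx]
    change _ = (toSmooth (locD e hk L f.1) (contDiffOn_locD hk hL f.2.1)).1 x +
      (toSmooth (locD e hk L g.1) (contDiffOn_locD hk hL g.2.1)).1 x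
    rw [toSmooth_apply _ hx, toSmooth_apply _ hx]
    change fderiv ℝ (f.1 + g.1) x _ - _ • (f.1 x + g.1 x) = locD e hk L f.1 x + locD e hk L g.1 x
    rw [fderiv_add (differentiableAt_smoothFun f hx) (differentiableAt_smoothFun g hx),
      _root_.add_apply, smul_add]
    unfold locD
    abel
  map_smul' c f := smoothFun_ext fun x hx => by
    rw [toSmooth_apply _ hx]
    change _ = c • (toSmooth (locD e hk L f.1) (contDiffOn_locD hk hL f.2.1)).1 x
    rw [toSmooth_apply _ hx]
    change fderiv ℝ (c • f.1) x _ - _ • (c • f.1 x) = c • locD e hk L f.1 x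
    rw [fderiv_const_smul (differentiableAt_smoothFun f hx), _root_.smul_apply, smul_comm,
      ← smul_sub]
    rfl

theorem locDLin_apply {e : atlas E Q} {k N : ℕ} (hk : k ≤ N) {L : Ext E Q k → ℝ}
    (hL : SmoothIn e L) (f : SmoothFun e N G) {x : (Fin (N + 1) → E) × ℝ}
    (hx : x ∈ natTarget e N) : (locDLin hk hL f).1 x = locD e hk L f.1 x :=
  toSmooth_apply (contDiffOn_locD hk hL f.2.1) hx

theorem locDLin_toSmooth {e : atlas E Q} {k a N : ℕ} (hk : k ≤ N) (h : k + a + 1 ≤ N)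
    {L : Ext E Q k → ℝ} (hL : SmoothIn e L) {F : Ext E Q (k + a) → G} (hF : SmoothIn e F) :
    locDLin hk hL (toSmooth _ (contDiffOn_loc (by omega : k + a ≤ N) hF)) =
      toSmooth _ (contDiffOn_loc h (hL.lagDeriv hF)) := smoothFun_ext fun x hx => by
  rw [locDLin_apply _ _ _ hx, toSmooth_apply _ hx, loc_lagDeriv hk h hL hF hx]
  exact locD_congr hk (fun y hy => toSmooth_apply _ hy) hx

/-- The truncated operator computes the true iterate only while its order `k + a` does not exceed
`N`; for the momenta `N = 2k - 1` is enough, for the Herglotz expression `N = 2k`. -/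
theorem locDLin_pow_toSmooth {e : atlas E Q} {k N : ℕ} (hk : k ≤ N)
    {L : Ext E Q k → ℝ} (hL : SmoothIn e L) {F : Ext E Q k → G} (hF : SmoothIn e F) :
    ∀ (a : ℕ) (h : k + a ≤ N),
    (locDLin hk hL ^ a) (toSmooth _ (contDiffOn_loc hk hF)) =
      toSmooth _ (contDiffOn_loc h (hL.lagDerivIter hF a))
  | 0, _ => rfl
  | a + 1, h => by
    rw [pow_succ']
    change locDLin hk hL ((locDLin hk hL ^ a) _) = _
    rw [locDLin_pow_toSmooth hk hL hF a (by omega)]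
    exact locDLin_toSmooth hk h hL (hL.lagDerivIter hF a)

/-- The derivatives `∂L/∂q_i`, zero for `i > k`. -/
def derivQ {k : ℕ} (e : atlas E Q) (L : Ext E Q k → ℝ) (i : ℕ) : Ext E Q k → E →L[ℝ] ℝ :=
  if h : i < k + 1 then partialQ e L ⟨i, h⟩ else 0

theorem derivQ_of_lt {k : ℕ} (e : atlas E Q) (L : Ext E Q k → ℝ) {i : ℕ} (h : k < i) :
    derivQ e L i = 0 := dif_neg (by omega)

theorem derivQ_fin {k : ℕ} (e : atlas E Q) (L : Ext E Q k → ℝ) (i : Fin (k + 1)) :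
    derivQ e L i = partialQ e L i := dif_pos i.2

theorem derivQ_natInv {k : ℕ} {e : atlas E Q} {L : Ext E Q k → ℝ} {i : ℕ} (hi : i < k + 1)
    {x : (Fin (k + 1) → E) × ℝ} (hx : x ∈ natTarget e k) (u : E) :
    derivQ e L i (natInv e k x) u =
      fderiv ℝ (fun y => L (natInv e k y)) x (Pi.single ⟨i, hi⟩ u, 0) := by
  have h1 : ((natInv e k x).1.coords e.1, (natInv e k x).2) = x := natCoords_natInv hx
  unfold derivQ partialQ
  rw [dif_pos hi, h1]
  rfl

theorem smoothIn_derivQ {k : ℕ} {e : atlas E Q} {L : Ext E Q k → ℝ} (hL : SmoothIn e L) (i : ℕ) :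
    SmoothIn e (derivQ e L i) := by
  by_cases hi : i < k + 1
  · have h1 := (ContDiffOn.fderiv_of_isOpen (m := ∞) hL (isOpen_natTarget e k) (by simp)).clm_comp
      (contDiffOn_const (c := (ContinuousLinearMap.inl ℝ (Fin (k + 1) → E) ℝ).comp
      (ContinuousLinearMap.single ℝ (fun _ => E) ⟨i, hi⟩)))
    refine h1.congr fun x hx => ?_
    ext u
    exact derivQ_natInv hi hx u
  · rw [derivQ_of_lt e L (by omega)]
    exact smoothIn_const 0

theorem eq_sum_single {k : ℕ} (w : (Fin (k + 1) → E) × ℝ) :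
    w = ∑ i : Fin (k + 1), (((Pi.single i (w.1 i) : Fin (k + 1) → E), (0 : ℝ))) +
      w.2 • ((0 : Fin (k + 1) → E), (1 : ℝ)) := by
  refine Prod.ext ?_ (by simp [Prod.snd_sum])
  simp only [Prod.fst_add, Prod.fst_sum, Prod.smul_fst, smul_zero, add_zero]
  exact (Finset.univ_sum_single w.1).symm

theorem diff_lagrangian {k : ℕ} {e : atlas E Q} {L : Ext E Q k → ℝ} (hL : SmoothIn e L)
    {p : Ext E Q k} (hp : p ∈ natSource e k) (v : TangentSpace (extModel E k) p) :
    diff (extModel E k) L p v = ∑ i ∈ Finset.range (k + 1),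
      derivQ e L i p (coordL k i (dCoords e k p v)) + derivZ L p * (dCoords e k p v).2 := by
  rw [diff_eq hL hp, derivZ_eq hL hp, Finset.sum_range]
  set w := dCoords e k p v
  conv_lhs => rw [eq_sum_single w]
  rw [map_add, map_sum, map_smul, smul_eq_mul, mul_comm w.2]
  congr 1
  refine Finset.sum_congr rfl fun i _ => ?_
  have := derivQ_natInv (L := L) i.2 (natCoords_mem hp) (w.1 i)
  rw [natInv_natCoords hp] at this
  rw [coordL_fin, this]

/-- The coefficients of `dL ∘ J_{b+1}`. -/
def vertCoeff {k : ℕ} (e : atlas E Q) (L : Ext E Q k → ℝ) (b i : ℕ) : Ext E Q k → E →L[ℝ] ℝ :=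
  fun p => (((b + 1 + i).factorial : ℝ) / i.factorial) • derivQ e L (b + 1 + i) p

theorem vertCoeff_of_le {k : ℕ} (e : atlas E Q) (L : Ext E Q k → ℝ) (b : ℕ) {i : ℕ} (h : k ≤ i) :
    vertCoeff e L b i = 0 := by
  funext p
  rw [vertCoeff, derivQ_of_lt e L (by omega)]
  simp

/-- The substitution `i ↦ b + 1 + i`, the extra terms vanishing since `∂L/∂q_i = 0` for `i > k`. It
serves both `dL ∘ J_{b+1}` and `Δ_{b+1} L`, which therefore share their coefficients. -/
theorem sum_derivQ_vert {k : ℕ} (e : atlas E Q) (L : Ext E Q k → ℝ) (b : ℕ) (p : Ext E Q k)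
    (w : ℕ → E) :
    ∑ i ∈ Finset.range (k + 1), derivQ e L i p (if b + 1 ≤ i then
      ((i.factorial : ℝ) / (i - (b + 1)).factorial) • w (i - (b + 1)) else 0) =
    ∑ i ∈ Finset.range (k + 1), vertCoeff e L b i p (w i) := by
  have h1 := Finset.sum_subset (Finset.range_subset_range.2 (show k + 1 ≤ b + 1 + (k + 1) by omega))
    (f := fun i => derivQ e L i p (if b + 1 ≤ i then
      ((i.factorial : ℝ) / (i - (b + 1)).factorial) • w (i - (b + 1)) else 0))
    (fun i _ hi => by
      rw [derivQ_of_lt e L (by simpa [Nat.lt_succ_iff] using hi)]; rfl)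
  rw [h1, Finset.sum_range_add, Finset.sum_eq_zero (s := Finset.range (b + 1)) (fun i hi => by
    rw [if_neg (by simpa using hi), map_zero]), zero_add]
  refine Finset.sum_congr rfl fun i _ => ?_
  rw [if_pos (by omega), Nat.add_sub_cancel_left, map_smul]
  rfl

theorem formRep_vert {k : ℕ} {e : atlas E Q} {L : Ext E Q k → ℝ} (hL : SmoothIn e L) (b : ℕ) :
    FormRep e (fun p => (diff (extModel E k) L p).comp (vertEnd (b + 1) p))
      (vertCoeff e L b) := by
  refine ⟨fun i => (smoothIn_derivQ hL _).const_smul _,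
    fun i hi => vertCoeff_of_le e L b hi.le, fun p hp v => ?_⟩
  change diff (extModel E k) L p (vertEnd (b + 1) p v) = _
  rw [diff_lagrangian hL hp, dCoords_vertEnd_snd hp, mul_zero, add_zero,
    ← sum_derivQ_vert e L b p (fun i => coordL k i (dCoords e k p v))]
  exact Finset.sum_congr rfl fun i hi => by
    rw [coordL_dCoords_vertEnd hp _ (Finset.mem_range.1 hi)]

theorem diff_canonField {k : ℕ} {e : atlas E Q} {L : Ext E Q k → ℝ} (hL : SmoothIn e L) (b : ℕ)
    {p : Ext E Q k} (hp : p ∈ natSource e k) :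
    diff (extModel E k) L p (canonField b p) =
      ∑ i ∈ Finset.range (k + 1), vertCoeff e L b i p (coordFun e k (i + 1) p) := by
  rw [diff_lagrangian hL hp, dCoords_canonField_snd hp, mul_zero, add_zero,
    ← sum_derivQ_vert e L b p (fun i => coordFun e k (i + 1) p)]
  refine Finset.sum_congr rfl fun i hi => ?_
  rw [coordL_dCoords_canonField hp (Finset.mem_range.1 hi)]
  congr 1
  split_ifs with h
  · have : i - (b + 1) + 1 = i - b := by omega
    rw [this]; rfl
  · rfl

end Momenta

/-! ### The Jacobi–Ostrogradsky momenta. -/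

section Momenta

variable {E : Type*} [NormedAddCommGroup E] [NormedSpace ℝ E]
  {Q : Type*} [TopologicalSpace Q] [ChartedSpace E Q] [IsManifold 𝓘(ℝ, E) ∞ Q]
  {e : atlas E Q} {k N : ℕ} (hk : k ≤ N) {L : Ext E Q k → ℝ} (hL : SmoothIn e L)

/-- The derivatives `∂L/∂q_i` in coordinates. -/
def locDerivQ (i : ℕ) : SmoothFun e N (E →L[ℝ] ℝ) :=
  toSmooth _ (contDiffOn_loc hk (smoothIn_derivQ hL i))

theorem locDerivQ_of_lt {i : ℕ} (h : k < i) : locDerivQ hk hL i = 0 := smoothFun_ext fun x hx => by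
  rw [locDerivQ, toSmooth_apply _ hx, loc, derivQ_of_lt e L h]
  rfl

theorem locDerivQ_apply (i : ℕ) {x : (Fin (N + 1) → E) × ℝ} (hx : x ∈ natTarget e N) :
    (locDerivQ hk hL i).1 x = loc e hk (derivQ e L i) x := toSmooth_apply _ hx

/-- The Jacobi–Ostrogradsky momenta in coordinates. -/
def momentum (i : ℕ) : SmoothFun e N (E →L[ℝ] ℝ) :=
  ∑ m ∈ Finset.range k, (-1 : ℝ) ^ m • (locDLin hk hL ^ m) (locDerivQ hk hL (i + 1 + m))

theorem momentum_of_le {i : ℕ} (h : k ≤ i) : momentum hk hL i = 0 :=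
  Finset.sum_eq_zero fun m _ => by rw [locDerivQ_of_lt hk hL (by omega), map_zero, smul_zero]

/-- The sum defining `p_i` may be extended by one zero term; splitting off its first term leaves
`-D_L p_{i+1}`. With `p_k = 0` this is a descending recursion. -/
theorem momentum_eq (i : ℕ) :
    momentum hk hL i = locDerivQ hk hL (i + 1) - locDLin hk hL (momentum hk hL (i + 1)) := by
  have h1 : momentum hk hL i = ∑ m ∈ Finset.range (k + 1),
      (-1 : ℝ) ^ m • (locDLin hk hL ^ m) (locDerivQ hk hL (i + 1 + m)) := by
    rw [Finset.sum_range_succ, locDerivQ_of_lt hk hL (show k < i + 1 + k by omega), map_zero,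
      smul_zero, add_zero]
    rfl
  rw [h1]
  refine (alternating_sum_eq_sub (locDLin hk hL) (fun m => locDerivQ hk hL (i + 1 + m)) k).trans ?_
  refine congrArg₂ (· - ·) rfl (congrArg _ (Finset.sum_congr rfl fun m _ => ?_))
  rw [show i + 1 + (m + 1) = i + 1 + 1 + m by omega]

theorem sum_alternating_locDerivQ :
    ∑ m ∈ Finset.range (k + 1), (-1 : ℝ) ^ m • (locDLin hk hL ^ m) (locDerivQ hk hL m) =
      locDerivQ hk hL 0 - locDLin hk hL (momentum hk hL 0) := by
  refine (alternating_sum_eq_sub (locDLin hk hL) (locDerivQ hk hL) k).trans ?_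
  simp only [momentum, show ∀ m, 0 + 1 + m = m + 1 by intro m; omega]

theorem coe_sum_smoothFun {ι : Type*} (s : Finset ι) (F : ι → SmoothFun e N (E →L[ℝ] ℝ))
    (x : (Fin (N + 1) → E) × ℝ) : (∑ i ∈ s, F i).1 x = ∑ i ∈ s, (F i).1 x := by
  let ev : SmoothFun e N (E →L[ℝ] ℝ) →+ (E →L[ℝ] ℝ) :=
    { toFun := fun f => f.1 x, map_zero' := rfl, map_add' := fun _ _ => rfl }
  exact map_sum ev F s

theorem smul_toSmooth_apply (c : ℝ) {f : (Fin (N + 1) → E) × ℝ → E →L[ℝ] ℝ}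
    (hf : ContDiffOn ℝ ∞ f (natTarget e N)) {x : (Fin (N + 1) → E) × ℝ} (hx : x ∈ natTarget e N) :
    (c • toSmooth f hf).1 x = c • f x := congrArg (c • ·) (toSmooth_apply hf hx)

theorem momentum_apply (hN : 2 * k - 1 ≤ N) (i : ℕ) {x : (Fin (N + 1) → E) × ℝ}
    (hx : x ∈ natTarget e N) : (momentum hk hL i).1 x = ∑ m : Fin k, (-1 : ℝ) ^ (m : ℕ) •
      loc e (by omega : k + (m : ℕ) ≤ N) (lagDerivIter L (derivQ e L (i + 1 + m)) m) x := by
  rw [momentum, Finset.sum_range, coe_sum_smoothFun]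
  refine Finset.sum_congr rfl fun m _ => ?_
  rw [locDerivQ, locDLin_pow_toSmooth hk hL (smoothIn_derivQ hL _) m (by omega),
    smul_toSmooth_apply _ _ hx]

/-- The momenta live on `T^{2k-1} Q × ℝ`, so beyond that order the choice of `N` is immaterial;
needed to compare orders `2k - 1` and `2k` in the Herglotz equation. -/
theorem momentum_truncL {N' : ℕ} (hN : 2 * k - 1 ≤ N) (h : N ≤ N') (i : ℕ)
    {x : (Fin (N' + 1) → E) × ℝ} (hx : x ∈ natTarget e N') :
    (momentum (hk.trans h) hL i).1 x = (momentum hk hL i).1 (truncL h x) := by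
  rw [momentum_apply _ hL (hN.trans h) i hx,
    momentum_apply hk hL hN i (show truncL h x ∈ natTarget e N from hx)]
  rfl

theorem loc_iterCoeff_succ (b : ℕ) {a : ℕ} (h : k + a + 1 ≤ N) (i : ℕ)
    (hg : ∀ i, SmoothIn e (iterCoeff L (vertCoeff e L b) a i)) :
    toSmooth _ (contDiffOn_loc h (hL.nextCoeff hg i)) =
      locDLin hk hL (toSmooth _ (contDiffOn_loc (by omega : k + a ≤ N) (hg i))) +
      if i = 0 then 0 else toSmooth _ (contDiffOn_loc (by omega : k + a ≤ N) (hg (i - 1))) :=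
  smoothFun_ext fun x hx => by
    rw [toSmooth_apply _ hx, locDLin_toSmooth hk h hL (hg i)]
    change _ = (toSmooth _ _).1 x + (ite (i = 0) (0 : SmoothFun e N (E →L[ℝ] ℝ)) _).1 x
    rw [toSmooth_apply _ hx]
    change lagDeriv L _ _ + ite (i = 0) 0 _ = lagDeriv L _ _ + _
    congr 1
    split_ifs with hi
    · rfl
    · rw [toSmooth_apply _ hx]
      exact loc_extProj _ h _ hx

open Classical in
/-- The coefficients of the Cartan form are the Jacobi–Ostrogradsky momenta. -/
theorem sum_loc_iterCoeff (hN : 2 * k - 1 ≤ N) (i : ℕ) {x : (Fin (N + 1) → E) × ℝ}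
    (hx : x ∈ natTarget e N) :
    ∑ b : Fin k, ((-1 : ℝ) ^ (b : ℕ) / ((b : ℕ) + 1).factorial) •
      loc e (by omega : k + (b : ℕ) ≤ N) (iterCoeff L (vertCoeff e L b) b i) x =
      (momentum hk hL i).1 x := by
  have hg : ∀ b a i, SmoothIn e (iterCoeff L (vertCoeff e L b) a i) := fun b a =>
    ((formRep_vert hL b).lagDerivFormIter hL a).smooth
  let D := locDLin (G := E →L[ℝ] ℝ) hk hL
  -- The abstract identity needs the recursion for all `a`, whereas the true coefficients fit in
  -- order `N` only for `k + a ≤ N`. So `f` is defined by the recursion and identified with them in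
  -- that range.
  let f : ℕ → ℕ → ℕ → SmoothFun e N (E →L[ℝ] ℝ) := fun b =>
    Nat.rec (fun i => (((b + 1 + i).factorial : ℝ) / i.factorial) • locDerivQ hk hL (b + 1 + i))
      (fun _ F i => D (F i) + if i = 0 then 0 else F (i - 1))
  have hf : ∀ b a i, ∀ h : k + a ≤ N, f b a i = toSmooth _ (contDiffOn_loc h (hg b a i)) := by
    intro b a
    induction a with
    | zero =>
      intro i h
      refine smoothFun_ext fun y hy => ?_
      rw [toSmooth_apply _ hy]
      exact smul_toSmooth_apply _ _ hy
    | succ a ih =>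
      intro i h
      change D (f b a i) + (if i = 0 then 0 else f b a (i - 1)) = _
      rw [ih i (by omega), ih (i - 1) (by omega)]
      exact (loc_iterCoeff_succ hk hL b h i (hg b a)).symm
  have key := sum_iterated_eq_momentum D (k := k) (l := locDerivQ hk hL)
    (fun i hi => locDerivQ_of_lt hk hL hi) (f := f) (fun _ _ => rfl) (fun _ _ _ => rfl) i
  have key' := congrArg (fun F : SmoothFun e N (E →L[ℝ] ℝ) => F.1 x) key
  refine Eq.trans ?_ key'
  rw [Finset.sum_range]
  rw [coe_sum_smoothFun]
  refine Finset.sum_congr rfl fun b _ => ?_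
  rw [hf b b i (by omega), smul_toSmooth_apply _ _ hx]

theorem locD_sum_clm_apply {s : Finset ℕ} {f : ℕ → (Fin (N + 1) → E) × ℝ → E →L[ℝ] ℝ}
    (hf : ∀ i ∈ s, ContDiffOn ℝ ∞ (f i) (natTarget e N)) {x : (Fin (N + 1) → E) × ℝ}
    (hx : x ∈ natTarget e N) :
    locD e hk L (fun x => ∑ i ∈ s, f i x (coordL N (i + 1) x)) x =
      ∑ i ∈ s, (locD e hk L (f i) x (coordL N (i + 1) x) + f i x (coordL N (i + 2) x)) := by
  have hd : ∀ i ∈ s, DifferentiableAt ℝ (f i) x := fun i hi =>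
    ((hf i hi).contDiffAt ((isOpen_natTarget e N).mem_nhds hx)).differentiableAt (by simp)
  have hc : ∀ j, DifferentiableAt ℝ (fun x : (Fin (N + 1) → E) × ℝ => coordL N j x) x :=
    fun j => (coordL (E := E) N j).differentiableAt
  unfold locD
  rw [fderiv_fun_sum fun i hi => (hd i hi).clm_apply (hc _), _root_.sum_apply, smul_eq_mul,
    Finset.mul_sum, ← Finset.sum_sub_distrib]
  refine Finset.sum_congr rfl fun i hi => ?_
  rw [fderiv_clm_apply_apply (hd i hi) (hc _)]
  have : fderiv ℝ (fun x : (Fin (N + 1) → E) × ℝ => coordL N (i + 1) x) x =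
    coordL N (i + 1) := (coordL (E := E) N (i + 1)).fderiv
  rw [this, coordL_locSpray, _root_.sub_apply, _root_.smul_apply, smul_eq_mul]
  ring

/-- Contraction with `Γ` commutes with `D_L`: as `Γ q_{i+1} = q_{i+2}`, the coefficients in front of
`q_{i+1}` obey the recursion of those in front of `dq_i`. This transfers the computation of the
Cartan form to the energy. -/
theorem loc_lagDerivIter_sum (hk : k ≤ N) (hL : SmoothIn e L) {F : Ext E Q k → ℝ}
    {g : ℕ → Ext E Q k → E →L[ℝ] ℝ} (hg : ∀ a i, SmoothIn e (iterCoeff L g a i))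
    (hs : ∀ i, k ≤ i → g i = 0)
    (hs' : ∀ a i, k + a < i → iterCoeff L g a i = 0)
    (hF : SmoothIn e F)
    (h : ∀ p ∈ natSource e k, F p =
      ∑ i ∈ Finset.range (k + 1), g i p (coordFun e k (i + 1) p)) (a : ℕ) (ha : k + a ≤ N) :
    EqOn (loc e ha (lagDerivIter L F a)) (fun x => ∑ i ∈ Finset.range (k + a + 1),
      loc e ha (iterCoeff L g a i) x (coordL N (i + 1) x)) (natTarget e N) := by
  induction a with
  | zero =>
    intro x hx
    have hx' : truncL ha x ∈ natTarget e k := hx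
    refine (h _ (natInv_mem hx')).trans (Finset.sum_congr rfl fun i hi => ?_)
    by_cases hi' : i < k
    · rw [coordFun, natCoords_natInv hx', coordL_truncL _ _ (by omega)]
      rfl
    · change _ = g i _ _
      rw [hs i (by omega)]; rfl
  | succ a ih =>
    intro x hx
    have h1 := loc_lagDeriv (by omega) ha hL (hL.lagDerivIter hF a) hx
    refine h1.trans ?_
    rw [locD_congr _ (ih (by omega)) hx, locD_sum_clm_apply _
      (fun i _ => contDiffOn_loc _ (hg a i)) hx, Finset.sum_add_distrib]
    have h2 : ∀ i, loc e ha (iterCoeff L g (a + 1) i) x =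
        locD e hk L (loc e (by omega : k + a ≤ N) (iterCoeff L g a i)) x +
        if i = 0 then 0 else loc e (by omega : k + a ≤ N) (iterCoeff L g a (i - 1)) x := by
      intro i
      rw [← loc_lagDeriv hk ha hL (hg a i) hx]
      change lagDeriv L _ _ + _ = _
      congr 1
      split_ifs with hi
      · rfl
      · exact loc_extProj _ ha _ hx
    simp only [h2, _root_.add_apply, Finset.sum_add_distrib]
    have h3 : locD e hk L (loc e (by omega : k + a ≤ N) (iterCoeff L g a (k + a + 1))) x = 0 := by
      rw [← loc_lagDeriv hk ha hL (hg a _) hx, hs' a _ (by omega), lagDeriv_zero]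
      rfl
    rw [show k + (a + 1) + 1 = k + a + 1 + 1 by omega,
      Finset.sum_range_succ (fun i => locD e hk L (loc e (by omega : k + a ≤ N)
        (iterCoeff L g a i)) x (coordL N (i + 1) x)) (k + a + 1), h3, _root_.zero_apply, add_zero,
      Finset.sum_range_succ' (fun i => (if i = 0 then (0 : E →L[ℝ] ℝ) else
        loc e (by omega : k + a ≤ N) (iterCoeff L g a (i - 1)) x) (coordL N (i + 1) x))]
    simp

end Momenta

/-! ### The contact form, the energy and the Herglotz expression in terms of the momenta. -/

section Representation

variable {E : Type*} [NormedAddCommGroup E] [NormedSpace ℝ E]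
  {Q : Type*} [TopologicalSpace Q] [ChartedSpace E Q] [IsManifold 𝓘(ℝ, E) ∞ Q]
  {e : atlas E Q} {k : ℕ} {L : Ext E Q k → ℝ}

theorem diff_snd {r : ℕ} {p : Ext E Q r} (hp : p ∈ natSource e r)
    (v : TangentSpace (extModel E r) p) :
    diff (extModel E r) (fun p' : Ext E Q r => p'.2) p v = (dCoords e r p v).2 := by
  have h1 : HasMFDerivAt (extModel E r) 𝓘(ℝ, ℝ)
      (ContinuousLinearMap.snd ℝ (Fin (r + 1) → E) ℝ ∘ natCoords e r) p _ :=
    HasMFDerivAt.comp p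
      (ContinuousLinearMap.snd ℝ (Fin (r + 1) → E) ℝ).hasFDerivAt.hasMFDerivAt
      (mdifferentiableAt_natCoords hp).hasMFDerivAt
  exact DFunLike.congr_fun h1.mfderiv v

theorem smoothIn_snd {r : ℕ} : SmoothIn e (fun p : Ext E Q r => p.2) :=
  contDiff_snd.contDiffOn

/-- The Cartan form is `∑ p_i dq_i`. -/
theorem cartanForm_eq (hk : k ≤ 2 * k - 1) (hL : SmoothIn e L) {p : Ext E Q (2 * k - 1)}
    (hp : p ∈ natSource e (2 * k - 1)) (v : TangentSpace (extModel E (2 * k - 1)) p) :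
    cartanForm L p v = ∑ i ∈ Finset.range k,
      (momentum hk hL i).1 (natCoords e _ p) (coordL _ i (dCoords e _ p v)) := by
  have hx := natCoords_mem hp
  have h1 : ∀ b : Fin k, pullForm (by omega : k + (b : ℕ) ≤ 2 * k - 1)
        (lagDerivFormIter L
          (fun p' => (diff (extModel E k) L p').comp (vertEnd ((b : ℕ) + 1) p')) b) p v =
      ∑ i ∈ Finset.range (2 * k), loc e (by omega : k + (b : ℕ) ≤ 2 * k - 1)
        (iterCoeff L (vertCoeff e L b) b i) (natCoords e _ p) (coordL _ i (dCoords e _ p v)) := by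
    intro b
    have hb : k + (b : ℕ) ≤ 2 * k - 1 := by omega
    have hr := (formRep_vert hL (b : ℕ)).lagDerivFormIter hL b
    rw [← Finset.sum_subset (Finset.range_subset_range.2 (show k + (b : ℕ) + 1 ≤ 2 * k by omega))
      (fun i _ hi => by
        rw [hr.support i (by simpa [Nat.lt_succ_iff] using hi)]; rfl)]
    refine (hr.eq _ ((extProj_mem hb).2 hp) _).trans (Finset.sum_congr rfl fun i hi => ?_)
    refine (congrArg (fun w => iterCoeff L (vertCoeff e L b) b i (extProj hb p) (coordL _ i w))
      (dCoords_mfderiv_extProj hb hp v)).trans ?_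
    rw [coordL_truncL _ _ (Finset.mem_range.1 hi), loc_natCoords hb _ hp]
  have h2 : cartanForm L p v = ∑ b : Fin k, ((-1 : ℝ) ^ (b : ℕ) / ((b : ℕ) + 1).factorial) *
      pullForm (by omega : k + (b : ℕ) ≤ 2 * k - 1)
        (lagDerivFormIter L
          (fun p' => (diff (extModel E k) L p').comp (vertEnd ((b : ℕ) + 1) p')) b) p v := by
    unfold cartanForm
    rw [_root_.sum_apply]
    rfl
  rw [h2]
  simp only [h1, Finset.mul_sum]
  -- The summand for `b` involves indices up to `k + b`; all are padded to the range `2 * k`, and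
  -- after summing over `b` only the indices below `k` remain.
  rw [Finset.sum_comm, Finset.sum_subset (Finset.range_subset_range.2 (show k ≤ 2 * k by omega))
    (fun i _ hi => by rw [momentum_of_le hk hL (by simpa using hi)]; rfl)]
  refine Finset.sum_congr rfl fun i _ => ?_
  rw [← sum_loc_iterCoeff hk hL le_rfl i hx, _root_.sum_apply]
  rfl

theorem contactForm_eq (hk : k ≤ 2 * k - 1) (hL : SmoothIn e L) {p : Ext E Q (2 * k - 1)}
    (hp : p ∈ natSource e (2 * k - 1)) (v : TangentSpace (extModel E (2 * k - 1)) p) :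
    contactForm L p v = (dCoords e _ p v).2 - ∑ i ∈ Finset.range k,
      (momentum hk hL i).1 (natCoords e _ p) (coordL _ i (dCoords e _ p v)) := by
  rw [← cartanForm_eq hk hL hp v, ← diff_snd hp v]
  rfl

theorem energy_eq (hk : k ≤ 2 * k - 1) (hL : SmoothIn e L) {p : Ext E Q (2 * k - 1)}
    (hp : p ∈ natSource e (2 * k - 1)) :
    energy L p = ∑ i ∈ Finset.range k, (momentum hk hL i).1 (natCoords e _ p)
      (coordL _ (i + 1) (natCoords e _ p)) - loc e hk L (natCoords e _ p) := by
  have hx := natCoords_mem hp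
  have h1 : ∀ b : Fin k, lagDerivIter L (fun p' => diff (extModel E k) L p' (canonField (b : ℕ) p'))
      b (extProj (by omega : k + (b : ℕ) ≤ 2 * k - 1) p) =
      ∑ i ∈ Finset.range (2 * k), loc e (by omega : k + (b : ℕ) ≤ 2 * k - 1)
        (iterCoeff L (vertCoeff e L b) b i) (natCoords e _ p)
          (coordL _ (i + 1) (natCoords e _ p)) := by
    intro b
    have hb : k + (b : ℕ) ≤ 2 * k - 1 := by omega
    have hr := (formRep_vert hL (b : ℕ)).lagDerivFormIter hL
    have hF : SmoothIn e (fun p' => diff (extModel E k) L p' (canonField (b : ℕ) p')) := by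
      refine ContDiffOn.congr (SmoothIn.sum (s := Finset.range (k + 1)) fun i _ =>
        ((hr 0).smooth i).clm_apply (smoothIn_coordFun e k (i + 1))) fun x hx => ?_
      exact diff_canonField hL b (natInv_mem hx)
    rw [← Finset.sum_subset (Finset.range_subset_range.2 (show k + (b : ℕ) + 1 ≤ 2 * k by omega))
      (fun i _ hi => by
        rw [(hr b).support i (by simpa [Nat.lt_succ_iff] using hi)]; rfl)]
    refine (loc_natCoords hb _ hp).symm.trans ?_
    exact loc_lagDerivIter_sum hk hL (fun a => (hr a).smooth)
      (fun i hi => vertCoeff_of_le e L b hi) (fun a => (hr a).support) hF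
      (fun p hp => diff_canonField hL b hp) b hb hx
  unfold energy
  rw [loc_natCoords hk _ hp]
  congr 1
  simp only [h1, Finset.mul_sum]
  rw [Finset.sum_comm, Finset.sum_subset (Finset.range_subset_range.2 (show k ≤ 2 * k by omega))
    (fun i _ hi => by rw [momentum_of_le hk hL (by simpa using hi)]; rfl)]
  refine Finset.sum_congr rfl fun i _ => ?_
  rw [← sum_loc_iterCoeff hk hL le_rfl i hx, _root_.sum_apply]
  rfl

/-- At order `2k` the expression is `∂L/∂q_0 - D_L p_0`. As `p_0` comes from order `2k - 1`, `D_L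
p_0` needs only the derivative of `p_0` at the truncated point `x` along the truncated total vector
`y`. -/
theorem herglotzExpr_eq (hk : k ≤ 2 * k - 1) (hL : SmoothIn e L) {p : Ext E Q (2 * k)}
    (hp : p ∈ natSource e (2 * k)) {x : (Fin (2 * k - 1 + 1) → E) × ℝ}
    (hxp : x = truncL (by omega : 2 * k - 1 ≤ 2 * k) (natCoords e (2 * k) p))
    {y : (Fin (2 * k - 1 + 1) → E) × ℝ}
    (hy : ∀ i < 2 * k - 1 + 1, coordL _ i y = coordL _ (i + 1) (natCoords e (2 * k) p))
    (hyz : y.2 = L (extProj (by omega : k ≤ 2 * k) p)) :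
    herglotzExpr e L p = loc e hk (derivQ e L 0) x - (fderiv ℝ (momentum hk hL 0).1 x y -
      fderiv ℝ (loc e hk L) x (0, 1) • (momentum hk hL 0).1 x) := by
  have hk2 : k ≤ 2 * k := by omega
  have hN : 2 * k - 1 ≤ 2 * k := by omega
  have hX := natCoords_mem hp
  have hx : x ∈ natTarget e (2 * k - 1) := hxp ▸ hX
  set X := natCoords e (2 * k) p
  have h1 : herglotzExpr e L p =
      (locDerivQ hk2 hL 0 - locDLin hk2 hL (momentum hk2 hL 0)).1 X := by
    rw [← sum_alternating_locDerivQ, coe_sum_smoothFun, Finset.sum_range]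
    refine Finset.sum_congr rfl fun m _ => ?_
    rw [locDerivQ, locDLin_pow_toSmooth hk2 hL (smoothIn_derivQ hL _) m
      (show k + (m : ℕ) ≤ 2 * k by omega), smul_toSmooth_apply _ _ hX, loc_natCoords _ _ hp,
      derivQ_fin]
  have h2 : (locDerivQ hk2 hL 0 - locDLin hk2 hL (momentum hk2 hL 0)).1 X =
      (locDerivQ hk2 hL 0).1 X - (locDLin hk2 hL (momentum hk2 hL 0)).1 X := rfl
  have h3 : (momentum hk2 hL 0).1 =ᶠ[𝓝 X] fun X => (momentum hk hL 0).1 (truncL hN X) := by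
    filter_upwards [(isOpen_natTarget e _).mem_nhds hX] with X' hX'
    exact momentum_truncL hk hL le_rfl hN 0 hX'
  have h4 : HasFDerivAt (fun X => (momentum hk hL 0).1 (truncL hN X)) _ X :=
    HasFDerivAt.comp (f := truncL hN) X (differentiableAt_smoothFun (momentum hk hL 0)
      (show truncL hN X ∈ natTarget e _ from hX)).hasFDerivAt (truncL (E := E) hN).hasFDerivAt
  have h5 : truncL hN (locSpray e hk2 L X) = y := by
    refine coord_ext (fun i hi => ?_) ?_
    · rw [coordL_truncL hN _ hi, coordL_locSpray, hy i hi]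
    · rw [hyz]
      exact loc_natCoords hk2 L hp
  have h6 : fderiv ℝ (loc e hk2 L) X (0, 1) = fderiv ℝ (loc e hk L) x (0, 1) := by
    rw [fderiv_loc hk2 hL hX, fderiv_loc hk hL hx, hxp]
    rfl
  rw [h1, h2, locDerivQ_apply hk2 hL 0 hX, locDLin_apply hk2 hL _ hX, locD, h3.fderiv_eq, h4.fderiv,
    h3.eq_of_nhds, ContinuousLinearMap.comp_apply, h5, h6, hxp]
  rfl

end Representation

/-! ### Triangular dependence of the momenta on the top coordinates, and the Hessian. -/

section Order

variable {E : Type*} [NormedAddCommGroup E] [NormedSpace ℝ E]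
  {Q : Type*} [TopologicalSpace Q] [ChartedSpace E Q] [IsManifold 𝓘(ℝ, E) ∞ Q]
  {G : Type*} [NormedAddCommGroup G] [NormedSpace ℝ G]
  {e : atlas E Q} {k N : ℕ} {L : Ext E Q k → ℝ}

/-- The vector `v` in the direction of the coordinate `q_i`. -/
def singleL (N i : ℕ) : E →L[ℝ] (Fin (N + 1) → E) × ℝ :=
  if h : i < N + 1 then (ContinuousLinearMap.inl ℝ (Fin (N + 1) → E) ℝ).comp
    (ContinuousLinearMap.single ℝ (fun _ => E) ⟨i, h⟩) else 0

theorem singleL_apply {i : ℕ} (h : i < N + 1) (v : E) :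
    singleL N i v = (Pi.single ⟨i, h⟩ v, 0) := by
  unfold singleL
  rw [dif_pos h]
  rfl

theorem singleL_snd (i : ℕ) (v : E) : (singleL N i v).2 = 0 := by
  unfold singleL
  split_ifs <;> rfl

theorem coordL_singleL {i : ℕ} (h : i < N + 1) (v : E) (j : ℕ) :
    coordL N j (singleL N i v) = if j = i then v else 0 := by
  by_cases hj : j < N + 1
  · rw [coordL_of_lt hj, singleL_apply h]
    simp only [Pi.single_apply, Fin.mk.injEq]
  · rw [coordL_of_le (by omega), if_neg (by omega)]

theorem truncL_singleL {r : ℕ} (hr : r ≤ N) {i : ℕ} (h : i < r + 1) (v : E) :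
    truncL hr (singleL N i v) = singleL r i v := by
  refine coord_ext (fun j hj => ?_) ?_
  · rw [coordL_truncL hr _ hj, coordL_singleL h, coordL_singleL (by omega)]
  · exact (singleL_snd (N := N) i v).trans (singleL_snd i v).symm

/-- Functions depending only on `q_0, …, q_r, z`. -/
def HasOrder (e : atlas E Q) (N : ℕ) (f : (Fin (N + 1) → E) × ℝ → G) (r : ℕ) : Prop :=
  ∀ x ∈ natTarget e N, ∀ w, (∀ i ≤ r, coordL N i w = 0) → w.2 = 0 → fderiv ℝ f x w = 0

theorem hasOrder_loc {r : ℕ} (h : r ≤ N) {F : Ext E Q r → G} (hF : SmoothIn e F) :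
    HasOrder e N (loc e h F) r := by
  intro x hx w hw hz
  have : truncL h w = 0 := by
    refine coord_ext (fun i hi => ?_) hz
    rw [coordL_truncL h _ hi, hw i (by omega), map_zero]
  rw [fderiv_loc h hF hx, this, map_zero]

theorem HasOrder.fderiv_fderiv {r : ℕ} {f : (Fin (N + 1) → E) × ℝ → G} (hr : HasOrder e N f r)
    (hf : ContDiffOn ℝ ∞ f (natTarget e N)) {x : (Fin (N + 1) → E) × ℝ} (hx : x ∈ natTarget e N)
    {w : (Fin (N + 1) → E) × ℝ} (hw : ∀ i ≤ r, coordL N i w = 0) (hz : w.2 = 0)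
    (a : (Fin (N + 1) → E) × ℝ) : fderiv ℝ (fderiv ℝ f) x w a = 0 := by
  have hx' := (isOpen_natTarget e N).mem_nhds hx
  have hc := hf.contDiffAt hx'
  rw [fderiv_fderiv_symm hc]
  have h1 : (fun y => fderiv ℝ f y w) =ᶠ[𝓝 x] fun _ => 0 := by
    filter_upwards [hx'] with y hy using hr y hy w hw hz
  have h2 : HasFDerivAt (fun y => fderiv ℝ f y w) _ x :=
    ((hc.fderiv_right (m := ∞) (by simp)).differentiableAt (by simp)).hasFDerivAt.clm_apply
      (hasFDerivAt_const w x)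
  have h3 := DFunLike.congr_fun (h2.unique ((hasFDerivAt_const (0 : G) x).congr_of_eventuallyEq h1))
    a
  simpa using h3

/-- The part of the total derivative that raises the order. -/
def shiftVec (w : (Fin (N + 1) → E) × ℝ) : (Fin (N + 1) → E) × ℝ :=
  (fun j => coordL N (j + 1) w, 0)

theorem coordL_shiftVec (w : (Fin (N + 1) → E) × ℝ) (i : ℕ) :
    coordL N i (shiftVec w) = coordL N (i + 1) w := by
  by_cases hi : i < N + 1
  · rw [coordL_of_lt hi]; rfl
  · rw [coordL_of_le (by omega), coordL_of_le (by omega)]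

theorem fderiv_locSpray (hk : k ≤ N) (hL : SmoothIn e L) {x : (Fin (N + 1) → E) × ℝ}
    (hx : x ∈ natTarget e N) {w : (Fin (N + 1) → E) × ℝ} (hw : ∀ i ≤ k, coordL N i w = 0)
    (hz : w.2 = 0) : fderiv ℝ (locSpray e hk L) x w = shiftVec w := by
  have h1 : HasFDerivAt (fun x : (Fin (N + 1) → E) × ℝ => fun j : Fin (N + 1) => coordL N (j + 1) x)
      (ContinuousLinearMap.pi fun j : Fin (N + 1) => coordL N (j + 1)) x :=
    hasFDerivAt_pi.2 fun j => (coordL (E := E) N (j + 1)).hasFDerivAt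
  have h2 := ((contDiffOn_loc hk hL).contDiffAt
    ((isOpen_natTarget e N).mem_nhds hx)).differentiableAt (by simp)
  have h3 : HasFDerivAt (locSpray e hk L) _ x := h1.prodMk h2.hasFDerivAt
  rw [h3.fderiv]
  exact Prod.ext rfl (hasOrder_loc hk hL x hx w hw hz)

/-- In a direction `w` that moves only coordinates above `r`, neither `f`, `df` nor `L` varies. The
sole contribution comes from the coefficients `q_{i+1}` of the spray, which turn `w` into its shift.
-/
theorem fderiv_locD (hk : k ≤ N) (hL : SmoothIn e L) {r : ℕ} (hkr : k ≤ r)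
    {f : (Fin (N + 1) → E) × ℝ → G} (hr : HasOrder e N f r)
    (hf : ContDiffOn ℝ ∞ f (natTarget e N)) {x : (Fin (N + 1) → E) × ℝ} (hx : x ∈ natTarget e N)
    {w : (Fin (N + 1) → E) × ℝ} (hw : ∀ i ≤ r, coordL N i w = 0) (hz : w.2 = 0) :
    fderiv ℝ (locD e hk L f) x w = fderiv ℝ f x (shiftVec w) := by
  have hx' := (isOpen_natTarget e N).mem_nhds hx
  have hc := hf.contDiffAt hx'
  have hl := contDiffOn_loc hk hL
  have hlc := hl.contDiffAt hx'
  have hw' : ∀ i ≤ k, coordL N i w = 0 := fun i hi => hw i (hi.trans hkr)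
  have h1 := ((hc.fderiv_right (m := ∞) (by simp)).differentiableAt (by simp)).hasFDerivAt
  have h2 := ((hlc.fderiv_right (m := ∞) (by simp)).differentiableAt (by simp)).hasFDerivAt
  have h3 := (((contDiffOn_locSpray hk hL).contDiffAt hx').differentiableAt (by simp)).hasFDerivAt
  have h4 : HasFDerivAt (locD e hk L f) _ x := (h1.clm_apply h3).sub
    ((h2.clm_apply (hasFDerivAt_const ((0 : Fin (N + 1) → E), (1 : ℝ)) x)).smul
      (hc.differentiableAt (by simp)).hasFDerivAt)
  rw [h4.fderiv]
  have e1 := hr.fderiv_fderiv hf hx hw hz (locSpray e hk L x)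
  have e2 := (hasOrder_loc hk hL).fderiv_fderiv hl hx hw' hz (0, 1)
  have e3 := hr x hx w hw hz
  have e4 := fderiv_locSpray hk hL hx hw' hz
  simp [e1, e2, e3, e4]

theorem hasOrder_locDerivQ (hk : k ≤ N) (hL : SmoothIn e L) (i : ℕ) :
    HasOrder e N (locDerivQ hk hL i).1 k := by
  intro x hx w hw hz
  have : (locDerivQ hk hL i).1 =ᶠ[𝓝 x] loc e hk (derivQ e L i) := by
    filter_upwards [(isOpen_natTarget e N).mem_nhds hx] with y hy using locDerivQ_apply hk hL i hy
  rw [this.fderiv_eq]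
  exact hasOrder_loc hk (smoothIn_derivQ hL i) x hx w hw hz

theorem fderiv_momentum (hk : k ≤ N) (hL : SmoothIn e L) (i : ℕ) {x : (Fin (N + 1) → E) × ℝ}
    (hx : x ∈ natTarget e N) (w : (Fin (N + 1) → E) × ℝ) :
    fderiv ℝ (momentum hk hL i).1 x w = fderiv ℝ (locDerivQ hk hL (i + 1)).1 x w -
      fderiv ℝ (locD e hk L (momentum hk hL (i + 1)).1) x w := by
  have h1 : (momentum hk hL i).1 =ᶠ[𝓝 x] (locDerivQ hk hL (i + 1)).1 -
      locD e hk L (momentum hk hL (i + 1)).1 := by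
    filter_upwards [(isOpen_natTarget e N).mem_nhds hx] with y hy
    rw [momentum_eq]
    change (locDerivQ hk hL (i + 1)).1 y - (locDLin hk hL (momentum hk hL (i + 1))).1 y = _
    rw [locDLin_apply hk hL _ hy]
    rfl
  rw [h1.fderiv_eq, fderiv_sub (differentiableAt_smoothFun _ hx)
    (((contDiffOn_locD hk hL (momentum hk hL (i + 1)).2.1).contDiffAt
      ((isOpen_natTarget e N).mem_nhds hx)).differentiableAt (by simp))]
  rfl

/-- The momentum `p_{k-1-j}` has order `k + j`, and its derivative with respect to `q_{k+j}` is the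
Hessian of `L`, up to sign. -/
theorem hasOrder_momentum (hk : k ≤ N) (hL : SmoothIn e L) : ∀ (j i : ℕ), i + j + 1 = k →
    HasOrder e N (momentum hk hL i).1 (k + j) ∧
    ∀ x ∈ natTarget e N, ∀ w, (∀ i < k + j, coordL N i w = 0) → w.2 = 0 →
      fderiv ℝ (momentum hk hL i).1 x w = (-1 : ℝ) ^ j • fderiv ℝ (locDerivQ hk hL k).1 x
        (singleL N k (coordL N (k + j) w))
  | 0, i, hi => by
    obtain rfl : k = i + 1 := by omega
    have h0 : ∀ x ∈ natTarget e N, ∀ w, fderiv ℝ (momentum hk hL i).1 x w =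
        fderiv ℝ (locDerivQ hk hL (i + 1)).1 x w := by
      intro x hx w
      have h1 : momentum hk hL i = locDerivQ hk hL (i + 1) := by
        rw [momentum_eq, momentum_of_le hk hL le_rfl, map_zero, sub_zero]
      rw [h1]
    refine ⟨fun x hx w hw hz => ?_, fun x hx w hw hz => ?_⟩
    · rw [h0 x hx]
      exact hasOrder_locDerivQ hk hL _ x hx w hw hz
    · rw [h0 x hx, pow_zero, one_smul, ← sub_eq_zero, ← map_sub]
      refine hasOrder_locDerivQ hk hL _ x hx _ (fun j hj => ?_) (by
        rw [Prod.snd_sub, hz, singleL_snd, sub_zero])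
      rw [map_sub, coordL_singleL (by omega)]
      split_ifs with h
      · rw [h]; exact sub_self _
      · rw [hw j (by omega), sub_zero]
  | j + 1, i, hi => by
    obtain ⟨h1, h2⟩ := hasOrder_momentum hk hL j (i + 1) (by omega)
    -- In `p_i = ∂L/∂q_{i+1} - D_L p_{i+1}` the first term has order `k`, hence is constant along
    -- `w`; each use of the recursion thus contributes a sign and a shift.
    have hs : ∀ x ∈ natTarget e N, ∀ w, (∀ i < k + (j + 1), coordL N i w = 0) → w.2 = 0 →
        fderiv ℝ (momentum hk hL i).1 x w =
          - fderiv ℝ (momentum hk hL (i + 1)).1 x (shiftVec w) := by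
      intro x hx w hw hz
      rw [fderiv_momentum hk hL i hx, hasOrder_locDerivQ hk hL _ x hx w
        (fun i hi => hw i (by omega)) hz, zero_sub, fderiv_locD hk hL (by omega) h1
        (momentum hk hL (i + 1)).2.1 hx (fun i hi => hw i (by omega)) hz]
    refine ⟨fun x hx w hw hz => ?_, fun x hx w hw hz => ?_⟩
    · rw [hs x hx w (fun i hi => hw i (by omega)) hz, h1 x hx _ (fun i hi => ?_) rfl, neg_zero]
      rw [coordL_shiftVec, hw _ (by omega)]
    · rw [hs x hx w hw hz, h2 x hx _ (fun i hi => ?_) rfl, coordL_shiftVec, pow_succ, mul_neg,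
        mul_one]
      · exact (neg_smul _ _).symm
      · rw [coordL_shiftVec, hw _ (by omega)]

/-- The Hessian of `L` with respect to `q_k`. -/
theorem fderiv_locDerivQ_single (hk : k ≤ N) (hL : SmoothIn e L) {x : (Fin (N + 1) → E) × ℝ}
    (hx : x ∈ natTarget e N) (u v : E) :
    fderiv ℝ (locDerivQ hk hL k).1 x (singleL N k u) v =
      fderiv ℝ (fderiv ℝ (localExpr e L)) (truncL hk x) (Pi.single (Fin.last k) u, 0)
        (Pi.single (Fin.last k) v, 0) := by
  have hx' : truncL hk x ∈ natTarget e k := hx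
  have ho := (isOpen_natTarget e k).mem_nhds hx'
  have h1 : (locDerivQ hk hL k).1 =ᶠ[𝓝 x] loc e hk (derivQ e L k) := by
    filter_upwards [(isOpen_natTarget e N).mem_nhds hx] with y hy using locDerivQ_apply hk hL k hy
  rw [h1.fderiv_eq, fderiv_loc hk (smoothIn_derivQ hL k) hx, truncL_singleL hk (by omega),
    singleL_apply (by omega)]
  have h2 : (fun y => derivQ e L k (natInv e k y) v) =ᶠ[𝓝 (truncL hk x)]
      fun y => fderiv ℝ (localExpr e L) y (Pi.single (Fin.last k) v, 0) := by
    filter_upwards [ho] with y hy using derivQ_natInv (by omega) hy v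
  have hc : ContDiffAt ℝ ∞ (localExpr e L) (truncL hk x) := ContDiffOn.contDiffAt hL ho
  have h3 := ((hc.fderiv_right (m := ∞) (by simp)).differentiableAt
    (by simp)).hasFDerivAt.clm_apply (hasFDerivAt_const
      ((Pi.single (Fin.last k) v : Fin (k + 1) → E), (0 : ℝ)) (truncL hk x))
  have h4 := ((smoothIn_derivQ hL k).differentiableAt hx').hasFDerivAt.clm_apply
    (hasFDerivAt_const v (truncL hk x))
  have h5 := DFunLike.congr_fun ((h4.congr_of_eventuallyEq h2.symm).unique h3)
    (Pi.single (Fin.last k) u, 0)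
  simp only [_root_.add_apply, ContinuousLinearMap.flip_apply, ContinuousLinearMap.comp_apply,
    _root_.zero_apply, map_zero, zero_add] at h5
  exact h5

theorem IsRegular.eq_zero (hreg : IsRegular L) (hk : k ≤ N) (hL : SmoothIn e L)
    {x : (Fin (N + 1) → E) × ℝ} (hx : x ∈ natTarget e N) {u : E}
    (hu : ∀ v, fderiv ℝ (locDerivQ hk hL k).1 x (singleL N k u) v = 0) : u = 0 := by
  have hx' : truncL hk x ∈ natTarget e k := hx
  refine hreg e (natInv e k (truncL hk x)) (natInv_mem hx') u fun v => ?_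
  have h1 : ((natInv e k (truncL hk x)).1.coords e.1, (natInv e k (truncL hk x)).2) =
    truncL hk x := natCoords_natInv hx'
  rw [h1, ← fderiv_locDerivQ_single hk hL hx, hu]

/-- The Hessian is symmetric, so it is nondegenerate in its other argument too. -/
theorem IsRegular.eq_zero' (hreg : IsRegular L) (hk : k ≤ N) (hL : SmoothIn e L)
    {x : (Fin (N + 1) → E) × ℝ} (hx : x ∈ natTarget e N) {v : E}
    (hv : ∀ u, fderiv ℝ (locDerivQ hk hL k).1 x (singleL N k u) v = 0) : v = 0 := by
  refine hreg.eq_zero hk hL hx fun u => ?_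
  have hc : ContDiffAt ℝ ∞ (localExpr e L) (truncL hk x) :=
    ContDiffOn.contDiffAt hL ((isOpen_natTarget e k).mem_nhds hx)
  rw [fderiv_locDerivQ_single hk hL hx, fderiv_fderiv_symm hc, ← fderiv_locDerivQ_single hk hL hx,
    hv]

end Order

/-! ### Regularity makes `dq_a, dp_a, dz` a coframe. -/

section SolutionOperator

variable {E : Type*} [NormedAddCommGroup E] [NormedSpace ℝ E]
  {Q : Type*} [TopologicalSpace Q] [ChartedSpace E Q] [IsManifold 𝓘(ℝ, E) ∞ Q]
  {e : atlas E Q} {k : ℕ} {L : Ext E Q k → ℝ}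

/-- Forward substitution: once the coordinates below `k + j` vanish, `dp_{k-1-j}(y)` is up to sign
the Hessian applied to `y_{k+j}`. The parameter `J` is kept because all `k` momenta are used for
injectivity, but only those with `a ≥ 1` for holonomy. -/
theorem IsRegular.coordL_eq_zero (hreg : IsRegular L) (hk : k ≤ 2 * k - 1) (hL : SmoothIn e L)
    {x : (Fin (2 * k - 1 + 1) → E) × ℝ} (hx : x ∈ natTarget e (2 * k - 1))
    {y : (Fin (2 * k - 1 + 1) → E) × ℝ} (hy : ∀ i < k, coordL _ i y = 0) (hz : y.2 = 0)
    {J : ℕ} (hJ : J ≤ k)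
    (hP : ∀ j < J, ∀ a, a + j + 1 = k → fderiv ℝ (momentum hk hL a).1 x y = 0) :
    ∀ i < k + J, coordL _ i y = 0 := by
  intro i
  induction i using Nat.strong_induction_on with
  | _ i ih =>
    intro hi
    by_cases hik : i < k
    · exact hy i hik
    obtain ⟨j, rfl⟩ := Nat.exists_eq_add_of_le (not_lt.1 hik)
    obtain ⟨a, ha⟩ : ∃ a, a + j + 1 = k := ⟨k - 1 - j, by omega⟩
    have h1 := (hasOrder_momentum hk hL j a ha).2 x hx y (fun i hi' => ih i hi' (by omega)) hz
    rw [hP j (by omega) a ha] at h1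
    have h2 := (smul_eq_zero.1 h1.symm).resolve_left (pow_ne_zero _ (by norm_num))
    exact hreg.eq_zero hk hL hx fun v => by rw [h2]; rfl

/-- Linear independence of the `dp_a` and `dq_a`. It allows coefficients to be compared in
identities of `1`-forms such as the contact equations. -/
theorem IsRegular.coeff_eq_zero (hreg : IsRegular L) (hk : k ≤ 2 * k - 1) (hL : SmoothIn e L)
    {x : (Fin (2 * k - 1 + 1) → E) × ℝ} (hx : x ∈ natTarget e (2 * k - 1))
    {d : ℕ → E} {g : ℕ → E →L[ℝ] ℝ}
    (h : ∀ w, ∑ a ∈ Finset.range k, fderiv ℝ (momentum hk hL a).1 x w (d a) =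
      ∑ a ∈ Finset.range k, g a (coordL (2 * k - 1) a w)) :
    ∀ a < k, d a = 0 ∧ g a = 0 := by
  have hd : ∀ a < k, d a = 0 := by
    intro a
    induction a using Nat.strong_induction_on with
    | _ a ih =>
      intro ha
      obtain ⟨j, hj⟩ : ∃ j, a + j + 1 = k := ⟨k - 1 - a, by omega⟩
      refine hreg.eq_zero' hk hL hx fun u => ?_
      have hc : ∀ i < k + j, coordL (2 * k - 1) i (singleL (2 * k - 1) (k + j) u) = 0 :=
        fun i hi => by rw [coordL_singleL (by omega), if_neg (by omega)]
      -- In the direction `q_{k+j}`, `j = k - 1 - a`, no `dq_b` with `b < k` and no `dp_b` with `b >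
      -- a` is seen, and `d b = 0` for `b < a` by induction. The Hessian term of `p_a` is isolated.
      have h1 := h (singleL _ (k + j) u)
      rw [Finset.sum_eq_zero (s := Finset.range k) (f := fun a => g a _) (fun b hb => by
        rw [hc b (by rw [Finset.mem_range] at hb; omega), map_zero]),
        Finset.sum_eq_single a] at h1
      · rw [(hasOrder_momentum hk hL j a hj).2 x hx _ hc (singleL_snd _ _),
          coordL_singleL (by omega), if_pos rfl, _root_.smul_apply] at h1
        exact (smul_eq_zero.1 h1).resolve_left (pow_ne_zero _ (by norm_num))
      · intro b hb hba
        rw [Finset.mem_range] at hb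
        rcases lt_or_gt_of_ne hba with hlt | hlt
        · rw [ih b hlt hb, map_zero]
        · obtain ⟨j', hj'⟩ : ∃ j', b + j' + 1 = k := ⟨k - 1 - b, by omega⟩
          rw [(hasOrder_momentum hk hL j' b hj').1 x hx _ (fun i hi => hc i (by omega))
            (singleL_snd _ _)]
          rfl
      · intro hn
        exact absurd (Finset.mem_range.2 ha) hn
  refine fun a ha => ⟨hd a ha, ?_⟩
  ext u
  have h1 := h (singleL _ a u)
  rw [Finset.sum_eq_zero (s := Finset.range k) (fun b hb => by
    rw [hd b (Finset.mem_range.1 hb), map_zero]), Finset.sum_eq_single a] at h1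
  · rw [coordL_singleL (by omega), if_pos rfl] at h1
    exact h1.symm
  · intro b _ hb
    rw [coordL_singleL (by omega), if_neg hb, map_zero]
  · intro hn
    exact absurd (Finset.mem_range.2 ha) hn

/-- The linear operator `y ↦ (y_a, dp_a(y), y_z)`, `a < k`. -/
def solOp (hk : k ≤ 2 * k - 1) (hL : SmoothIn e L) (x : (Fin (2 * k - 1 + 1) → E) × ℝ) :
    ((Fin (2 * k - 1 + 1) → E) × ℝ) →L[ℝ] (Fin k → E) × (Fin k → E →L[ℝ] ℝ) × ℝ :=
  (ContinuousLinearMap.pi fun a : Fin k => coordL (2 * k - 1) a).prod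
    ((ContinuousLinearMap.pi fun a : Fin k => fderiv ℝ (momentum hk hL a).1 x).prod
      (ContinuousLinearMap.snd ℝ _ ℝ))

theorem solOp_eq_iff (hk : k ≤ 2 * k - 1) (hL : SmoothIn e L)
    {x y : (Fin (2 * k - 1 + 1) → E) × ℝ} {b : Fin k → E} {c : Fin k → E →L[ℝ] ℝ} {z : ℝ} :
    solOp hk hL x y = (b, c, z) ↔ (∀ a : Fin k, coordL _ a y = b a) ∧
      (∀ a : Fin k, fderiv ℝ (momentum hk hL a).1 x y = c a) ∧ y.2 = z := by
  rw [Prod.ext_iff, Prod.ext_iff, funext_iff, funext_iff]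
  rfl

theorem solOp_injective (hreg : IsRegular L) (hk1 : 1 ≤ k) (hk : k ≤ 2 * k - 1)
    (hL : SmoothIn e L) {x : (Fin (2 * k - 1 + 1) → E) × ℝ} (hx : x ∈ natTarget e (2 * k - 1)) :
    Function.Injective (solOp hk hL x) := by
  refine (injective_iff_map_eq_zero _).2 fun y hy => ?_
  obtain ⟨h1, h2, h3⟩ := (solOp_eq_iff hk hL).1 hy
  refine coord_ext (fun i hi => ?_) h3
  rw [map_zero]
  exact hreg.coordL_eq_zero hk hL hx (fun i hi => h1 ⟨i, hi⟩) h3 le_rfl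
    (fun j _ a ha => h2 ⟨a, by omega⟩) i (by omega)

variable [FiniteDimensional ℝ E]

/-- Injectivity suffices, since both spaces have dimension `2k · dim E + 1`. -/
theorem exists_solOp_equiv (hreg : IsRegular L) (hk1 : 1 ≤ k) (hk : k ≤ 2 * k - 1)
    (hL : SmoothIn e L) {x : (Fin (2 * k - 1 + 1) → E) × ℝ} (hx : x ∈ natTarget e (2 * k - 1)) :
    ∃ A : ((Fin (2 * k - 1 + 1) → E) × ℝ) ≃L[ℝ] (Fin k → E) × (Fin k → E →L[ℝ] ℝ) × ℝ,
      (A : _ →L[ℝ] _) = solOp hk hL x := by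
  have hd : Module.finrank ℝ (E →L[ℝ] ℝ) = Module.finrank ℝ E := by
    rw [← LinearEquiv.finrank_eq (LinearMap.toContinuousLinearMap (𝕜 := ℝ) (E := E) (F' := ℝ)),
      Module.finrank_linearMap_self]
  have hf : Module.finrank ℝ ((Fin (2 * k - 1 + 1) → E) × ℝ) =
      Module.finrank ℝ ((Fin k → E) × (Fin k → E →L[ℝ] ℝ) × ℝ) := by
    rw [Module.finrank_prod, Module.finrank_prod, Module.finrank_prod, Module.finrank_pi_fintype,
      Module.finrank_pi_fintype, Module.finrank_pi_fintype, hd]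
    simp only [Finset.sum_const, Finset.card_univ, Fintype.card_fin, smul_eq_mul]
    rw [show 2 * k - 1 + 1 = k + k by omega]
    ring
  let A := LinearEquiv.ofInjectiveOfFinrankEq (solOp hk hL x).toLinearMap
    (solOp_injective hreg hk1 hk hL hx) hf
  exact ⟨A.toContinuousLinearEquiv, ContinuousLinearMap.ext fun _ => rfl⟩

/-- The solution of `solOp y = b`. -/
def solve (hk : k ≤ 2 * k - 1) (hL : SmoothIn e L) (x : (Fin (2 * k - 1 + 1) → E) × ℝ) :
    ((Fin k → E) × (Fin k → E →L[ℝ] ℝ) × ℝ) →L[ℝ] (Fin (2 * k - 1 + 1) → E) × ℝ :=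
  (solOp hk hL x).inverse

theorem solOp_solve (hreg : IsRegular L) (hk1 : 1 ≤ k) (hk : k ≤ 2 * k - 1)
    (hL : SmoothIn e L) {x : (Fin (2 * k - 1 + 1) → E) × ℝ} (hx : x ∈ natTarget e (2 * k - 1))
    (b : (Fin k → E) × (Fin k → E →L[ℝ] ℝ) × ℝ) :
    solOp hk hL x (solve hk hL x b) = b := by
  obtain ⟨A, hA⟩ := exists_solOp_equiv hreg hk1 hk hL hx
  rw [solve, ← hA, ContinuousLinearMap.inverse_equiv]
  exact A.apply_symm_apply b

/-- Inversion of continuous linear maps is smooth at invertible ones, and `solOp` depends smoothly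
on the point. -/
theorem contDiffOn_solve (hreg : IsRegular L) (hk1 : 1 ≤ k) (hk : k ≤ 2 * k - 1)
    (hL : SmoothIn e L) : ContDiffOn ℝ ∞ (solve hk hL) (natTarget e (2 * k - 1)) := by
  intro x hx
  obtain ⟨A, hA⟩ := exists_solOp_equiv hreg hk1 hk hL hx
  have h1 : ContDiffOn ℝ ∞ (solOp hk hL) (natTarget e (2 * k - 1)) := by
    refine contDiffOn_clm_apply.2 fun y => ?_
    refine contDiffOn_const.prodMk ((contDiffOn_pi.2 fun a => ?_).prodMk contDiffOn_const)
    exact ((momentum hk hL a).2.1.fderiv_of_isOpen (m := ∞) (isOpen_natTarget _ _)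
      (by simp)).clm_apply contDiffOn_const
  have h2 := contDiffAt_map_inverse (n := ∞) A
  rw [hA] at h2
  exact h2.comp_contDiffWithinAt x (h1 x hx)

end SolutionOperator

/-! ### The Reeb and contact equations as linear systems for `solOp`. -/

section FieldEquations

variable {E : Type*} [NormedAddCommGroup E] [NormedSpace ℝ E]
  {Q : Type*} [TopologicalSpace Q] [ChartedSpace E Q] [IsManifold 𝓘(ℝ, E) ∞ Q]
  {e : atlas E Q} {k : ℕ} {L : Ext E Q k → ℝ}

theorem smoothIn_comp_natCoords {G : Type*} [NormedAddCommGroup G] [NormedSpace ℝ G] {N : ℕ}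
    (f : SmoothFun e N G) : SmoothIn e (fun p => f.1 (natCoords e N p)) :=
  f.2.1.congr fun _ hx => congrArg f.1 (natCoords_natInv hx)

theorem diff_comp_natCoords {G : Type*} [NormedAddCommGroup G] [NormedSpace ℝ G] {N : ℕ}
    (f : SmoothFun e N G) {p : Ext E Q N} (hp : p ∈ natSource e N)
    (v : TangentSpace (extModel E N) p) : diff (extModel E N) (fun p => f.1 (natCoords e N p)) p v =
      fderiv ℝ f.1 (natCoords e N p) (dCoords e N p v) := by
  have h1 : (fun x => f.1 (natCoords e N (natInv e N x))) =ᶠ[𝓝 (natCoords e N p)] f.1 := by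
    filter_upwards [(isOpen_natTarget e N).mem_nhds (natCoords_mem hp)] with x hx
    rw [natCoords_natInv hx]
  rw [diff_eq (smoothIn_comp_natCoords f) hp, h1.fderiv_eq]

/-- That is, `dη_L = ∑ dq_a ∧ dp_a`, from `η_L = dz + ∑ (-p_a) dq_a`. -/
theorem extDerivOneForm_contactForm (hk : k ≤ 2 * k - 1) (hL : SmoothIn e L)
    {p : Ext E Q (2 * k - 1)} (hp : p ∈ natSource e (2 * k - 1))
    (u v : TangentSpace (extModel E (2 * k - 1)) p) :
    extDerivOneForm (extModel E (2 * k - 1)) (contactForm L) p u v = ∑ a ∈ Finset.range k,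
      (fderiv ℝ (momentum hk hL a).1 (natCoords e _ p) (dCoords e _ p v)
        (coordL _ a (dCoords e _ p u)) -
      fderiv ℝ (momentum hk hL a).1 (natCoords e _ p) (dCoords e _ p u)
        (coordL _ a (dCoords e _ p v))) := by
  rw [extDerivOneForm_sum _ (Finset.range k) (h₀ := fun p : Ext E Q (2 * k - 1) => p.2)
    (g := fun a p => (-momentum hk hL a).1 (natCoords e _ p)) (h := fun a => coordFun e _ a)
    (smoothIn_snd.contMDiffAt hp) (fun a _ => (smoothIn_comp_natCoords _).contMDiffAt hp)
    (fun a _ => (smoothIn_coordFun e _ a).contMDiffAt hp)]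
  · refine Finset.sum_congr rfl fun a _ => ?_
    have hn : ∀ w, fderiv ℝ (-momentum hk hL a).1 (natCoords e _ p) w =
        - fderiv ℝ (momentum hk hL a).1 (natCoords e _ p) w := fun w =>
      DFunLike.congr_fun (fderiv_neg (f := (momentum hk hL a).1)) w
    rw [diff_comp_natCoords _ hp, diff_comp_natCoords _ hp, diff_coordFun hp, diff_coordFun hp,
      hn, hn, _root_.neg_apply, _root_.neg_apply]
    ring
  · filter_upwards [eventually_natSource hp] with p' hp' w
    rw [contactForm_eq hk hL hp', diff_snd hp', sub_eq_add_neg, ← Finset.sum_neg_distrib]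
    refine congrArg₂ (· + ·) rfl (Finset.sum_congr rfl fun a _ => ?_)
    rw [diff_coordFun hp']
    rfl

theorem fderiv_loc_lagrangian {N : ℕ} (hk : k ≤ N) (hL : SmoothIn e L)
    {x : (Fin (N + 1) → E) × ℝ} (hx : x ∈ natTarget e N) (w : (Fin (N + 1) → E) × ℝ) :
    fderiv ℝ (loc e hk L) x w = ∑ i ∈ Finset.range (k + 1),
      (locDerivQ hk hL i).1 x (coordL N i w) + fderiv ℝ (loc e hk L) x (0, 1) * w.2 := by
  have hx' : truncL hk x ∈ natTarget e k := hx
  rw [fderiv_loc hk hL hx, fderiv_loc hk hL hx, Finset.sum_range]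
  conv_lhs => rw [eq_sum_single (truncL hk w)]
  rw [map_add, map_sum, map_smul, smul_eq_mul, mul_comm (truncL hk w).2]
  refine congrArg₂ (· + ·) (Finset.sum_congr rfl fun i _ => ?_) rfl
  rw [locDerivQ_apply hk hL _ hx, coordL_of_lt (by omega)]
  exact (derivQ_natInv i.2 hx' _).symm

theorem diff_energy (hk : k ≤ 2 * k - 1) (hL : SmoothIn e L) {p : Ext E Q (2 * k - 1)}
    (hp : p ∈ natSource e (2 * k - 1)) (v : TangentSpace (extModel E (2 * k - 1)) p) :
    diff (extModel E (2 * k - 1)) (energy L) p v = ∑ a ∈ Finset.range k,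
      (fderiv ℝ (momentum hk hL a).1 (natCoords e _ p) (dCoords e _ p v)
        (coordL _ (a + 1) (natCoords e _ p)) + (momentum hk hL a).1 (natCoords e _ p)
        (coordL _ (a + 1) (dCoords e _ p v))) -
      fderiv ℝ (loc e hk L) (natCoords e _ p) (dCoords e _ p v) := by
  let F : (Fin (2 * k - 1 + 1) → E) × ℝ → ℝ := fun x => ∑ a ∈ Finset.range k,
    (momentum hk hL a).1 x (coordL _ (a + 1) x) - loc e hk L x
  have hF : EqOn (fun x => energy L (natInv e _ x)) F (natTarget e _) := fun x hx => by
    change energy L (natInv e _ x) = _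
    rw [energy_eq hk hL (natInv_mem hx), natCoords_natInv hx]
  have hc : ∀ a, ContDiff ℝ ∞ fun x : (Fin (2 * k - 1 + 1) → E) × ℝ => coordL (2 * k - 1) a x :=
    fun a => (coordL (E := E) _ a).contDiff
  have hs : SmoothIn e (energy L) := by
    refine ContDiffOn.congr (f := F) ?_ hF
    exact (ContDiffOn.sum fun a _ => (momentum hk hL a).2.1.clm_apply (hc _).contDiffOn).sub
      (contDiffOn_loc hk hL)
  have hx := natCoords_mem hp
  have hx' := (isOpen_natTarget e _).mem_nhds hx
  rw [diff_eq hs hp, (hF.eventuallyEq_of_mem hx').fderiv_eq]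
  have hd : ∀ a, DifferentiableAt ℝ
      (fun x => (momentum hk hL a).1 x (coordL (2 * k - 1) (a + 1) x)) (natCoords e _ p) :=
    fun a => (differentiableAt_smoothFun _ hx).clm_apply ((hc _).differentiable (by simp) _)
  have h1 := (HasFDerivAt.fun_sum (u := Finset.range k) fun a _ => (hd a).hasFDerivAt).sub
    (((contDiffOn_loc hk hL).contDiffAt hx').differentiableAt (by simp)).hasFDerivAt
  refine (DFunLike.congr_fun h1.fderiv _).trans ?_
  rw [_root_.sub_apply, _root_.sum_apply]
  refine congrArg₂ (· - ·) (Finset.sum_congr rfl fun a _ => ?_) rfl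
  rw [fderiv_clm_apply_apply (differentiableAt_smoothFun _ hx)
    ((hc _).differentiable (by simp) _)]
  have : fderiv ℝ (fun x : (Fin (2 * k - 1 + 1) → E) × ℝ => coordL (2 * k - 1) (a + 1) x)
    (natCoords e _ p) = coordL (2 * k - 1) (a + 1) := (coordL (E := E) _ (a + 1)).fderiv
  rw [this]

/-- The values of `dp_a` on the contact Lagrangian field. -/
def momentumRate (hk : k ≤ 2 * k - 1) (hL : SmoothIn e L) (x : (Fin (2 * k - 1 + 1) → E) × ℝ)
    (a : ℕ) : E →L[ℝ] ℝ :=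
  -- For `a ≥ 1` the momentum `p_a` does not involve `q_{2k-1}`, so the component missing from the
  -- truncated spray is irrelevant. Since `p_0` may involve it, its rate has to be prescribed by the
  -- equation of motion.
  if a = 0 then (locDerivQ hk hL 0).1 x + fderiv ℝ (loc e hk L) x (0, 1) • (momentum hk hL 0).1 x
  else fderiv ℝ (momentum hk hL a).1 x (locSpray e hk L x)

/-- The recursion of the momenta summed by parts. It rewrites the `dq` part of `dE_L` as `∂L/∂z ·
θ_L` minus the rates, so that `dE_L + (∂L/∂z) η_L = ∑ (q_{a+1} dp_a - rate_a dq_a)`. -/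
theorem sum_momentum_succ (hk1 : 1 ≤ k) (hk : k ≤ 2 * k - 1) (hL : SmoothIn e L)
    {x : (Fin (2 * k - 1 + 1) → E) × ℝ} (hx : x ∈ natTarget e (2 * k - 1)) (w : ℕ → E) :
    ∑ a ∈ Finset.range k, (momentum hk hL a).1 x (w (a + 1)) -
      ∑ a ∈ Finset.range (k + 1), (locDerivQ hk hL a).1 x (w a) =
    fderiv ℝ (loc e hk L) x (0, 1) * ∑ a ∈ Finset.range k, (momentum hk hL a).1 x (w a) -
      ∑ a ∈ Finset.range k, momentumRate hk hL x a (w a) := by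
  have h1 : ∀ a, (momentum hk hL a).1 x = (locDerivQ hk hL (a + 1)).1 x -
      (fderiv ℝ (momentum hk hL (a + 1)).1 x (locSpray e hk L x) -
        fderiv ℝ (loc e hk L) x (0, 1) • (momentum hk hL (a + 1)).1 x) := by
    intro a
    rw [momentum_eq hk hL a]
    change (locDerivQ hk hL (a + 1)).1 x - (locDLin hk hL (momentum hk hL (a + 1))).1 x = _
    rw [locDLin_apply hk hL _ hx]
    rfl
  obtain ⟨m, rfl⟩ : ∃ m, k = m + 1 := ⟨k - 1, by omega⟩
  have h2 : ∀ a, momentumRate hk hL x (a + 1) =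
      fderiv ℝ (momentum hk hL (a + 1)).1 x (locSpray e hk L x) := fun a => if_neg (by omega)
  have h3 : momentumRate hk hL x 0 = (locDerivQ hk hL 0).1 x +
      fderiv ℝ (loc e hk L) x (0, 1) • (momentum hk hL 0).1 x := if_pos rfl
  -- The boundary term of the summation by parts vanishes because `p_k = 0`.
  have h4 : (momentum hk hL (m + 1)).1 = 0 := by rw [momentum_of_le hk hL le_rfl]; rfl
  rw [Finset.sum_congr rfl (fun a _ => by rw [h1 a]), Finset.sum_range_succ' _ (m + 1),
    Finset.sum_range_succ' (fun a => (momentum hk hL a).1 x (w a)),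
    Finset.sum_range_succ' (fun a => momentumRate hk hL x a (w a))]
  simp only [_root_.sub_apply, _root_.add_apply, _root_.smul_apply, Finset.sum_sub_distrib, h2, h3,
    smul_eq_mul, Finset.mul_sum, mul_add]
  rw [Finset.sum_range_succ (fun a => fderiv ℝ (momentum hk hL (a + 1)).1 x (locSpray e hk L x)
      (w (a + 1))), Finset.sum_range_succ (fun a => fderiv ℝ (loc e hk L) x (0, 1) *
      (momentum hk hL (a + 1)).1 x (w (a + 1))), h4]
  have h5 : fderiv ℝ (0 : (Fin (2 * (m + 1) - 1 + 1) → E) × ℝ → E →L[ℝ] ℝ) x = 0 := by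
    simp
  rw [h5]
  simp only [_root_.zero_apply, Pi.zero_apply, mul_zero]
  ring

/-- The Reeb equations in coordinates. -/
theorem reeb_iff (hreg : IsRegular L) (hk : k ≤ 2 * k - 1) (hL : SmoothIn e L)
    {p : Ext E Q (2 * k - 1)} (hp : p ∈ natSource e (2 * k - 1))
    (v : TangentSpace (extModel E (2 * k - 1)) p) :
    (extDerivOneForm (extModel E (2 * k - 1)) (contactForm L) p v = 0 ∧ contactForm L p v = 1) ↔
      solOp hk hL (natCoords e _ p) (dCoords e _ p v) = (0, 0, 1) := by
  have hx := natCoords_mem hp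
  rw [contactForm_eq hk hL hp, solOp_eq_iff]
  constructor
  · rintro ⟨h1, h2⟩
    have h3 := hreg.coeff_eq_zero hk hL hx (d := fun a => coordL _ a (dCoords e _ p v))
      (g := fun a => fderiv ℝ (momentum hk hL a).1 (natCoords e _ p) (dCoords e _ p v))
      (fun w => by
        obtain ⟨w', rfl⟩ := dCoords_surjective hp w
        rw [← sub_eq_zero, ← Finset.sum_sub_distrib, ← extDerivOneForm_contactForm hk hL hp v w',
          h1]
        rfl)
    refine ⟨fun a => (h3 a a.2).1, fun a => (h3 a a.2).2, ?_⟩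
    rwa [Finset.sum_eq_zero (fun a ha => by
      rw [(h3 a (Finset.mem_range.1 ha)).1, map_zero]), sub_zero] at h2
  · rintro ⟨h1, h2, h3⟩
    have h1' : ∀ a ∈ Finset.range k, coordL _ a (dCoords e _ p v) = 0 := fun a ha =>
      h1 ⟨a, Finset.mem_range.1 ha⟩
    have h2' : ∀ a ∈ Finset.range k,
        fderiv ℝ (momentum hk hL a).1 (natCoords e _ p) (dCoords e _ p v) = 0 := fun a ha =>
      h2 ⟨a, Finset.mem_range.1 ha⟩
    constructor
    · ext w
      refine (extDerivOneForm_contactForm hk hL hp v w).trans (Finset.sum_eq_zero fun a ha => ?_)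
      rw [h1' a ha, h2' a ha, map_zero, _root_.zero_apply, sub_zero]
    · rw [h3, Finset.sum_eq_zero (fun a ha => by rw [h1' a ha, map_zero]), sub_zero]

/-- The derivative of the energy along the Reeb field. -/
theorem diff_energy_reeb (hk1 : 1 ≤ k) (hk : k ≤ 2 * k - 1) (hL : SmoothIn e L)
    {p : Ext E Q (2 * k - 1)} (hp : p ∈ natSource e (2 * k - 1))
    {v : TangentSpace (extModel E (2 * k - 1)) p}
    (hv : solOp hk hL (natCoords e _ p) (dCoords e _ p v) = (0, 0, 1)) :
    diff (extModel E (2 * k - 1)) (energy L) p v =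
      - fderiv ℝ (loc e hk L) (natCoords e _ p) (0, 1) := by
  have hx := natCoords_mem hp
  obtain ⟨h1, h2, h3⟩ := (solOp_eq_iff hk hL).1 hv
  have h1' : ∀ a ∈ Finset.range k, coordL _ a (dCoords e _ p v) = 0 := fun a ha =>
    h1 ⟨a, Finset.mem_range.1 ha⟩
  have h2' : ∀ a ∈ Finset.range k,
      fderiv ℝ (momentum hk hL a).1 (natCoords e _ p) (dCoords e _ p v) = 0 := fun a ha =>
    h2 ⟨a, Finset.mem_range.1 ha⟩
  have h4 := sum_momentum_succ hk1 hk hL hx (fun a => coordL _ a (dCoords e _ p v))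
  rw [Finset.sum_eq_zero (f := fun a => momentumRate hk hL _ a _)
      (fun a ha => by rw [h1' a ha, map_zero]),
    Finset.sum_eq_zero (f := fun a => (momentum hk hL a).1 _ (coordL _ a _))
      (fun a ha => by rw [h1' a ha, map_zero])] at h4
  rw [diff_energy hk hL hp, fderiv_loc_lagrangian hk hL hx, h3, Finset.sum_add_distrib,
    Finset.sum_eq_zero (fun a ha => by rw [h2' a ha]; rfl)]
  linarith

/-- The contact Lagrangian equations in coordinates. -/
theorem contact_iff (hreg : IsRegular L) (hk1 : 1 ≤ k) (hk : k ≤ 2 * k - 1) (hL : SmoothIn e L)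
    {p : Ext E Q (2 * k - 1)} (hp : p ∈ natSource e (2 * k - 1))
    {R v : TangentSpace (extModel E (2 * k - 1)) p}
    (hR : solOp hk hL (natCoords e _ p) (dCoords e _ p R) = (0, 0, 1)) :
    (extDerivOneForm (extModel E (2 * k - 1)) (contactForm L) p v =
      diff (extModel E (2 * k - 1)) (energy L) p
        - diff (extModel E (2 * k - 1)) (energy L) p R • contactForm L p ∧
      contactForm L p v = -energy L p) ↔
      solOp hk hL (natCoords e _ p) (dCoords e _ p v) =
        (fun a : Fin k => coordL _ (a + 1) (natCoords e _ p),
          fun a : Fin k => momentumRate hk hL (natCoords e _ p) a,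
          loc e hk L (natCoords e _ p)) := by
  have hx := natCoords_mem hp
  have key : ∀ w : TangentSpace (extModel E (2 * k - 1)) p,
      diff (extModel E (2 * k - 1)) (energy L) p w
        - diff (extModel E (2 * k - 1)) (energy L) p R * contactForm L p w =
      ∑ a ∈ Finset.range k, (fderiv ℝ (momentum hk hL a).1 (natCoords e _ p) (dCoords e _ p w)
        (coordL _ (a + 1) (natCoords e _ p)) -
          momentumRate hk hL (natCoords e _ p) a (coordL _ a (dCoords e _ p w))) := by
    intro w
    rw [diff_energy_reeb hk1 hk hL hp hR, diff_energy hk hL hp, contactForm_eq hk hL hp,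
      fderiv_loc_lagrangian hk hL hx, Finset.sum_add_distrib, Finset.sum_sub_distrib]
    have h4 := sum_momentum_succ hk1 hk hL hx (fun a => coordL _ a (dCoords e _ p w))
    linear_combination h4
  rw [contactForm_eq hk hL hp, energy_eq hk hL hp, solOp_eq_iff]
  constructor
  · rintro ⟨h1, h2⟩
    have h3 := hreg.coeff_eq_zero hk hL hx
      (d := fun a => coordL _ a (dCoords e _ p v) - coordL _ (a + 1) (natCoords e _ p))
      (g := fun a => fderiv ℝ (momentum hk hL a).1 (natCoords e _ p) (dCoords e _ p v) -
        momentumRate hk hL (natCoords e _ p) a)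
      (fun w => by
        obtain ⟨w', rfl⟩ := dCoords_surjective hp w
        have h4 := (extDerivOneForm_contactForm hk hL hp v w').symm.trans
          ((DFunLike.congr_fun h1 w').trans (key w'))
        rw [Finset.sum_sub_distrib, Finset.sum_sub_distrib] at h4
        simp only [map_sub, _root_.sub_apply, Finset.sum_sub_distrib]
        linear_combination h4)
    refine ⟨fun a => sub_eq_zero.1 (h3 a a.2).1, fun a => sub_eq_zero.1 (h3 a a.2).2, ?_⟩
    rw [Finset.sum_congr rfl (fun a ha => by
      rw [sub_eq_zero.1 (h3 a (Finset.mem_range.1 ha)).1])] at h2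
    linear_combination h2
  · rintro ⟨h1, h2, h3⟩
    have h1' : ∀ a ∈ Finset.range k,
        coordL _ a (dCoords e _ p v) = coordL _ (a + 1) (natCoords e _ p) := fun a ha =>
      h1 ⟨a, Finset.mem_range.1 ha⟩
    have h2' : ∀ a ∈ Finset.range k,
        fderiv ℝ (momentum hk hL a).1 (natCoords e _ p) (dCoords e _ p v) =
          momentumRate hk hL (natCoords e _ p) a := fun a ha => h2 ⟨a, Finset.mem_range.1 ha⟩
    constructor
    · ext w
      refine (extDerivOneForm_contactForm hk hL hp v w).trans (Eq.trans ?_ (key w).symm)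
      exact Finset.sum_congr rfl fun a ha => by rw [h1' a ha, h2' a ha]
    · rw [h3, Finset.sum_congr rfl (fun a ha => by rw [h1' a ha])]
      ring

end FieldEquations

/-! ### Existence, uniqueness and smoothness of the Reeb and contact fields. -/

section Fields

variable {E : Type*} [NormedAddCommGroup E] [NormedSpace ℝ E]
  {Q : Type*} [TopologicalSpace Q] [ChartedSpace E Q] [IsManifold 𝓘(ℝ, E) ∞ Q]

/-- A vector field is smooth if its components in natural coordinates are. -/
theorem isSmoothField_of_dCoords {r : ℕ} {X : Field E Q r}
    (h : ∀ e : atlas E Q, ∃ f : (Fin (r + 1) → E) × ℝ → (Fin (r + 1) → E) × ℝ,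
      ContDiffOn ℝ ∞ f (natTarget e r) ∧
        ∀ p ∈ natSource e r, dCoords e r p (X p) = f (natCoords e r p)) :
    IsSmoothField (extModel E r) X := by
  intro p₀
  refine (Bundle.contMDiffAt_section p₀).2 ?_
  obtain ⟨f, hf, hX⟩ := h (baseChart p₀)
  have hp₀ := mem_natSource_baseChart p₀
  have h1 : ContMDiffAt (extModel E r) 𝓘(ℝ, (Fin (r + 1) → E) × ℝ) ∞
      (f ∘ natCoords (baseChart p₀) r) p₀ :=
    ContMDiffAt.comp p₀ (hf.contDiffAt ((isOpen_natTarget _ _).mem_nhds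
      (natCoords_mem hp₀))).contMDiffAt (contMDiffAt_natCoords hp₀)
  refine h1.congr_of_eventuallyEq ?_
  have hs : ∀ᶠ p in 𝓝 p₀, p ∈ (chartAt (ModelProd (Fin (r + 1) → E) ℝ) p₀).source :=
    chart_source_mem_nhds (ModelProd (Fin (r + 1) → E) ℝ) p₀
  filter_upwards [eventually_natSource hp₀, hs] with p hp hps
  refine Eq.trans ?_ (hX p hp)
  -- The trivialization of the tangent bundle at `p₀` is the differential of the preferred chart,
  -- that is, `dCoords (baseChart p₀)`.
  have h2 := TangentBundle.continuousLinearMapAt_trivializationAt (I := extModel E r) hps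
  have h3 := Bundle.Trivialization.continuousLinearMapAt_apply_of_mem (R := ℝ)
    (trivializationAt ((Fin (r + 1) → E) × ℝ) (TangentSpace (extModel E r)) p₀) (b := p)
    (by simpa using hps) (X p)
  rw [← h3, h2]
  rfl

variable [FiniteDimensional ℝ E] {k : ℕ} {L : Ext E Q k → ℝ}

theorem eq_solve_iff {e : atlas E Q} (hreg : IsRegular L) (hk1 : 1 ≤ k) (hk : k ≤ 2 * k - 1)
    (hL : SmoothIn e L) {x : (Fin (2 * k - 1 + 1) → E) × ℝ} (hx : x ∈ natTarget e (2 * k - 1))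
    {y : (Fin (2 * k - 1 + 1) → E) × ℝ} {b : (Fin k → E) × (Fin k → E →L[ℝ] ℝ) × ℝ} :
    solOp hk hL x y = b ↔ y = solve hk hL x b := by
  constructor
  · intro h
    exact solOp_injective hreg hk1 hk hL hx (h.trans (solOp_solve hreg hk1 hk hL hx b).symm)
  · rintro rfl
    exact solOp_solve hreg hk1 hk hL hx b

/-- A pointwise linear problem which in natural coordinates is solved by `solve` has a unique
solution, and it is smooth. -/
theorem exists_unique_field (hreg : IsRegular L) (hk1 : 1 ≤ k) (hk : k ≤ 2 * k - 1)
    (hL : ∀ e, SmoothIn e L) {P : ∀ p : Ext E Q (2 * k - 1), TangentSpace (extModel E _) p → Prop}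
    {b : atlas E Q → (Fin (2 * k - 1 + 1) → E) × ℝ → (Fin k → E) × (Fin k → E →L[ℝ] ℝ) × ℝ}
    (hb : ∀ e, ContDiffOn ℝ ∞ (b e) (natTarget e (2 * k - 1)))
    (hP : ∀ e p, p ∈ natSource e (2 * k - 1) → ∀ v, P p v ↔
      solOp hk (hL e) (natCoords e _ p) (dCoords e _ p v) = b e (natCoords e _ p)) :
    ∃ X : Field E Q (2 * k - 1), IsSmoothField (extModel E (2 * k - 1)) X ∧ (∀ p, P p (X p)) ∧
      ∀ Y : Field E Q (2 * k - 1), (∀ p, P p (Y p)) → Y = X := by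
  have h1 : ∀ p : Ext E Q (2 * k - 1), ∃ v : TangentSpace (extModel E _) p, P p v := fun p => by
    have hp := mem_natSource_baseChart p
    obtain ⟨v, hv⟩ := dCoords_surjective hp
      (solve hk (hL (baseChart p)) (natCoords _ _ p) (b (baseChart p) (natCoords _ _ p)))
    exact ⟨v, (hP _ p hp v).2 ((eq_solve_iff hreg hk1 hk _ (natCoords_mem hp)).2 hv)⟩
  choose X hX using h1
  refine ⟨X, isSmoothField_of_dCoords fun e => ⟨fun x => solve hk (hL e) x (b e x),
    (contDiffOn_solve hreg hk1 hk (hL e)).clm_apply (hb e), fun p hp => ?_⟩, hX, fun Y hY => ?_⟩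
  · exact (eq_solve_iff hreg hk1 hk _ (natCoords_mem hp)).1 ((hP e p hp _).1 (hX p))
  · funext p
    have hp := mem_natSource_baseChart p
    exact dCoords_injective hp (solOp_injective hreg hk1 hk (hL _) (natCoords_mem hp)
      (((hP _ p hp _).1 (hY p)).trans ((hP _ p hp _).1 (hX p)).symm))

theorem exists_unique_reebField (hreg : IsRegular L) (hk1 : 1 ≤ k) (hk : k ≤ 2 * k - 1)
    (hL : ∀ e, SmoothIn e L) :
    ∃! R : Field E Q (2 * k - 1),
      IsSmoothField (extModel E (2 * k - 1)) R ∧ IsReebField L R := by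
  obtain ⟨R, h1, h2, h3⟩ := exists_unique_field hreg hk1 hk hL
    (b := fun _ _ => (0, 0, 1)) (fun _ => contDiffOn_const)
    (fun e p hp v => reeb_iff hreg hk (hL e) hp v)
  exact ⟨R, ⟨h1, h2⟩, fun Y hY => h3 Y hY.2⟩

/-- The right-hand side of the contact Lagrangian equations in coordinates. -/
def contactRhs {e : atlas E Q} (hk : k ≤ 2 * k - 1) (hL : SmoothIn e L)
    (x : (Fin (2 * k - 1 + 1) → E) × ℝ) : (Fin k → E) × (Fin k → E →L[ℝ] ℝ) × ℝ :=
  (fun a : Fin k => coordL _ (a + 1) x, fun a : Fin k => momentumRate hk hL x a, loc e hk L x)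

theorem contDiffOn_contactRhs {e : atlas E Q} (hk : k ≤ 2 * k - 1) (hL : SmoothIn e L) :
    ContDiffOn ℝ ∞ (contactRhs hk hL) (natTarget e (2 * k - 1)) := by
  have ho := isOpen_natTarget e (2 * k - 1)
  refine (contDiffOn_pi.2 fun a => (coordL (E := E) _ _).contDiff.contDiffOn).prodMk
    ((contDiffOn_pi.2 fun a => ?_).prodMk (contDiffOn_loc hk hL))
  by_cases ha : (a : ℕ) = 0
  · simp only [momentumRate, if_pos ha]
    exact (locDerivQ hk hL 0).2.1.add ((((contDiffOn_loc hk hL).fderiv_of_isOpen (m := ∞) ho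
      (by simp)).clm_apply contDiffOn_const).smul (momentum hk hL 0).2.1)
  · simp only [momentumRate, if_neg ha]
    exact ((momentum hk hL a).2.1.fderiv_of_isOpen (m := ∞) ho (by simp)).clm_apply
      (contDiffOn_locSpray hk hL)

theorem contactField_iff {e : atlas E Q} (hreg : IsRegular L) (hk1 : 1 ≤ k) (hk : k ≤ 2 * k - 1)
    (hL : SmoothIn e L) {R : Field E Q (2 * k - 1)} (hR : IsReebField L R)
    {p : Ext E Q (2 * k - 1)} (hp : p ∈ natSource e (2 * k - 1))
    (v : TangentSpace (extModel E (2 * k - 1)) p) :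
    (extDerivOneForm (extModel E (2 * k - 1)) (contactForm L) p v =
      diff (extModel E (2 * k - 1)) (energy L) p
        - diff (extModel E (2 * k - 1)) (energy L) p (R p) • contactForm L p ∧
      contactForm L p v = -energy L p) ↔
      solOp hk hL (natCoords e _ p) (dCoords e _ p v) = contactRhs hk hL (natCoords e _ p) :=
  contact_iff hreg hk1 hk hL hp ((reeb_iff hreg hk hL hp _).1 (hR p))

theorem exists_unique_contactField (hreg : IsRegular L) (hk1 : 1 ≤ k) (hk : k ≤ 2 * k - 1)
    (hL : ∀ e, SmoothIn e L) {R : Field E Q (2 * k - 1)} (hR : IsReebField L R) :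
    ∃ X : Field E Q (2 * k - 1), IsSmoothField (extModel E (2 * k - 1)) X ∧
      IsContactLagrangianField L R X ∧
      ∀ Y : Field E Q (2 * k - 1), IsContactLagrangianField L R Y → Y = X :=
  exists_unique_field hreg hk1 hk hL (fun e => contDiffOn_contactRhs hk (hL e))
    (fun e _ hp v => contactField_iff hreg hk1 hk (hL e) hR hp v)

/-- The contact Lagrangian field in coordinates. -/
def contactVec {e : atlas E Q} (hk : k ≤ 2 * k - 1) (hL : SmoothIn e L)
    (x : (Fin (2 * k - 1 + 1) → E) × ℝ) : (Fin (2 * k - 1 + 1) → E) × ℝ :=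
  solve hk hL x (contactRhs hk hL x)

theorem contDiffOn_contactVec {e : atlas E Q} (hreg : IsRegular L) (hk1 : 1 ≤ k)
    (hk : k ≤ 2 * k - 1) (hL : SmoothIn e L) :
    ContDiffOn ℝ ∞ (contactVec hk hL) (natTarget e (2 * k - 1)) :=
  (contDiffOn_solve hreg hk1 hk hL).clm_apply (contDiffOn_contactRhs hk hL)

theorem dCoords_contactField {e : atlas E Q} (hreg : IsRegular L) (hk1 : 1 ≤ k)
    (hk : k ≤ 2 * k - 1) (hL : SmoothIn e L) {R X : Field E Q (2 * k - 1)} (hR : IsReebField L R)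
    (hX : IsContactLagrangianField L R X) {p : Ext E Q (2 * k - 1)}
    (hp : p ∈ natSource e (2 * k - 1)) :
    dCoords e _ p (X p) = contactVec hk hL (natCoords e _ p) :=
  (eq_solve_iff hreg hk1 hk hL (natCoords_mem hp)).1
    ((contactField_iff hreg hk1 hk hL hR hp _).1 (hX p))

/-- The contact Lagrangian field is a semispray determined by one further equation. -/
theorem eq_contactVec_iff {e : atlas E Q} (hreg : IsRegular L) (hk1 : 1 ≤ k)
    (hk : k ≤ 2 * k - 1) (hL : SmoothIn e L) {x y : (Fin (2 * k - 1 + 1) → E) × ℝ}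
    (hx : x ∈ natTarget e (2 * k - 1)) :
    y = contactVec hk hL x ↔ (∀ i < 2 * k - 1, coordL _ i y = coordL _ (i + 1) x) ∧
      y.2 = loc e hk L x ∧ fderiv ℝ (momentum hk hL 0).1 x y =
        (locDerivQ hk hL 0).1 x + fderiv ℝ (loc e hk L) x (0, 1) • (momentum hk hL 0).1 x := by
  rw [contactVec, ← eq_solve_iff hreg hk1 hk hL hx, contactRhs, solOp_eq_iff]
  have h0 : momentumRate hk hL x 0 = (locDerivQ hk hL 0).1 x +
      fderiv ℝ (loc e hk L) x (0, 1) • (momentum hk hL 0).1 x := if_pos rfl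
  have hs : ∀ a, a ≠ 0 → momentumRate hk hL x a =
      fderiv ℝ (momentum hk hL a).1 x (locSpray e hk L x) := fun a ha => if_neg ha
  constructor
  · rintro ⟨h1, h2, h3⟩
    refine ⟨fun i hi => ?_, h3, (h2 ⟨0, hk1⟩).trans h0⟩
    -- The difference with the spray is killed by `dq_a` for `a < k`, by `dz` and by `dp_a` for `a ≥
    -- 1`. Taking `J = k - 1` gives the vanishing of all its components below `2k - 1`.
    have h4 := hreg.coordL_eq_zero hk hL hx (y := y - locSpray e hk L x)
      (fun i hi => by rw [map_sub, coordL_locSpray, sub_eq_zero]; exact h1 ⟨i, hi⟩)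
      (by rw [Prod.snd_sub, h3]; exact sub_self _) (J := k - 1) (by omega)
      (fun j hj a ha => by
        rw [map_sub, sub_eq_zero, ← hs a (by omega)]
        exact h2 ⟨a, by omega⟩) i (by omega)
    rwa [map_sub, coordL_locSpray, sub_eq_zero] at h4
  · rintro ⟨h1, h2, h3⟩
    refine ⟨fun a => h1 a (by omega), fun a => ?_, h2⟩
    by_cases ha : (a : ℕ) = 0
    · rw [ha, h0, h3]
    · obtain ⟨j, hj⟩ : ∃ j, (a : ℕ) + j + 1 = k := ⟨k - 1 - a, by omega⟩
      rw [hs a ha, ← sub_eq_zero, ← map_sub]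
      -- Here `y` and the spray may differ only along `q_{2k-1}`, which exceeds the order `k + j` of
      -- `p_a` because `a ≥ 1`.
      refine (hasOrder_momentum hk hL j a hj).1 x hx _ (fun i hi => ?_) ?_
      · rw [map_sub, coordL_locSpray, sub_eq_zero]
        exact h1 i (by omega)
      · rw [Prod.snd_sub, h2]
        exact sub_self _

end Fields

/-! ### Curves, their prolongations and tangency in natural coordinates. -/

section Curves

variable {E : Type*} [NormedAddCommGroup E] [NormedSpace ℝ E]
  {Q : Type*} [TopologicalSpace Q] [ChartedSpace E Q] [IsManifold 𝓘(ℝ, E) ∞ Q]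

/-- Bootstrapping: if `u` is `C^n`, then its derivative, the composite of `f` with `u`, is `C^n`,
and so `u` is `C^{n+1}`. -/
theorem contDiffOn_of_hasDerivAt {V : Type*} [NormedAddCommGroup V] [NormedSpace ℝ V]
    {f : V → V} {U : Set V} (hf : ContDiffOn ℝ ∞ f U) {u : ℝ → V} {s : Set ℝ} (hs : IsOpen s)
    (hu : ∀ t ∈ s, u t ∈ U) (h : ∀ t ∈ s, HasDerivAt u (f (u t)) t) : ContDiffOn ℝ ∞ u s := by
  refine contDiffOn_infty.2 fun n => ?_
  induction n with
  | zero => exact contDiffOn_zero.2 fun t ht => (h t ht).continuousAt.continuousWithinAt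
  | succ n ih =>
    rw [Nat.cast_add, Nat.cast_one, contDiffOn_succ_iff_deriv_of_isOpen hs]
    refine ⟨fun t ht => (h t ht).differentiableAt.differentiableWithinAt, by simp, ?_⟩
    exact ((hf.of_le (by exact_mod_cast le_top)).comp ih hu).congr fun t ht => (h t ht).deriv

/-- Tangency of a curve to a vector, in natural coordinates. -/
theorem hasMFDerivAt_iff {r : ℕ} {e : atlas E Q} {σ : ℝ → Ext E Q r} {t : ℝ}
    (ht : σ t ∈ natSource e r) (v : TangentSpace (extModel E r) (σ t)) :
    HasMFDerivAt 𝓘(ℝ, ℝ) (extModel E r) σ t ((1 : ℝ →L[ℝ] ℝ).smulRight v) ↔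
      ContinuousAt σ t ∧ HasDerivAt (fun τ => natCoords e r (σ τ)) (dCoords e r (σ t) v) t := by
  have key : ∀ v : TangentSpace (extModel E r) (σ t),
      HasMFDerivAt 𝓘(ℝ, ℝ) (extModel E r) σ t ((1 : ℝ →L[ℝ] ℝ).smulRight v) →
      HasDerivAt (fun τ => natCoords e r (σ τ)) (dCoords e r (σ t) v) t := by
    intro v h
    let D : ℝ →L[ℝ] (Fin (r + 1) → E) × ℝ :=
      ContinuousLinearMap.toSpanSingleton ℝ (dCoords e r (σ t) v)
    have h1 := HasMFDerivAt.comp t (mdifferentiableAt_natCoords ht).hasMFDerivAt h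
    have hD : (mfderiv (extModel E r) 𝓘(ℝ, (Fin (r + 1) → E) × ℝ) (natCoords e r) (σ t)).comp
        ((1 : ℝ →L[ℝ] ℝ).smulRight v) = D := ContinuousLinearMap.ext_ring
      ((congrArg (dCoords e r (σ t)) (one_smul ℝ v)).trans (one_smul ℝ _).symm)
    have h2 : HasMFDerivAt 𝓘(ℝ, ℝ) 𝓘(ℝ, (Fin (r + 1) → E) × ℝ)
        (fun τ => natCoords e r (σ τ)) t D := hD ▸ h1
    exact hasDerivAt_iff_hasFDerivAt.2 h2.hasFDerivAt
  -- Continuity is needed to keep the curve in the chart domain nearby, outside which the values of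
  -- the coordinates carry no information.
  refine ⟨fun h => ⟨h.continuousAt, key v h⟩, fun ⟨hc, h⟩ => ?_⟩
  have hx := natCoords_mem ht
  have h1 : HasMFDerivAt 𝓘(ℝ, ℝ) 𝓘(ℝ, (Fin (r + 1) → E) × ℝ) (fun τ => natCoords e r (σ τ)) t _ :=
    h.hasFDerivAt.hasMFDerivAt
  have h2 := (HasMFDerivAt.comp t (mdifferentiableAt_natInv hx).hasMFDerivAt h1)
  have h3 := h2.congr_of_eventuallyEq (f₁ := σ) (by
    filter_upwards [hc.eventually (eventually_natSource ht)] with τ hτ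
    exact (natInv_natCoords hτ).symm)
  have h4 : MDifferentiableAt 𝓘(ℝ, ℝ) (extModel E r) σ t := h3.mdifferentiableAt
  have h5 := h4.hasMFDerivAt
  let w : TangentSpace (extModel E r) (σ t) := mfderiv 𝓘(ℝ, ℝ) (extModel E r) σ t (1 : ℝ)
  have h6 : mfderiv 𝓘(ℝ, ℝ) (extModel E r) σ t = (1 : ℝ →L[ℝ] ℝ).smulRight w :=
    ContinuousLinearMap.ext_ring (by
      change w = (1 : ℝ) • w
      rw [one_smul])
  rw [h6] at h5
  have h7 : w = v := dCoords_injective ht ((key w h5).unique h)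
  rwa [h7] at h5

theorem smoothNearZero_shift {c : ℝ → Q} {s : Set ℝ} (hs : IsOpen s)
    (hc : ContMDiffOn 𝓘(ℝ, ℝ) 𝓘(ℝ, E) ∞ c s) {t : ℝ} (ht : t ∈ s) :
    SmoothNearZero E (fun τ => c (t + τ)) := by
  have h1 : ContinuousAt (fun τ : ℝ => t + τ) 0 := by fun_prop
  have h2 : ∀ᶠ τ in 𝓝 (0 : ℝ), t + τ ∈ s := h1.eventually (hs.mem_nhds (by simpa using ht))
  filter_upwards [h2] with τ hτ
  have h3 : ContMDiffAt 𝓘(ℝ, ℝ) 𝓘(ℝ, ℝ) ∞ (fun τ : ℝ => t + τ) τ :=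
    ContDiffAt.contMDiffAt (by fun_prop)
  exact ContMDiffAt.comp τ (hc.contMDiffAt (hs.mem_nhds hτ)) h3

theorem base_lift {r : ℕ} (c : ℝ → Q) (t : ℝ) : (TJet.lift E r c t).base = c t := by
  rw [TJet.lift, TJet.base_ofCurve, add_zero]

theorem lift_mem_natSource {r : ℕ} {e : atlas E Q} {c : ℝ → Q} {t z : ℝ} :
    ((TJet.lift E r c t, z) : Ext E Q r) ∈ natSource e r ↔ c t ∈ e.1.source := by
  change (TJet.lift E r c t).base ∈ e.1.source ↔ _
  rw [base_lift]

theorem coords_lift {r : ℕ} {e : atlas E Q} {c : ℝ → Q} {s : Set ℝ} (hs : IsOpen s)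
    (hc : ContMDiffOn 𝓘(ℝ, ℝ) 𝓘(ℝ, E) ∞ c s) {t : ℝ} (ht : t ∈ s) (hct : c t ∈ e.1.source)
    (j : Fin (r + 1)) :
    (TJet.lift E r c t).coords e.1 j = iteratedDeriv j (fun τ => e.1 (c τ)) t := by
  have h := smoothNearZero_shift hs hc ht
  rw [TJet.lift, TJet.ofCurve_eq h, TJet.coords_mk e.2 ⟨_, h⟩ (by simpa using hct)]
  change iteratedDeriv j (fun τ => e.1 (c (t + τ))) 0 = _
  have := congrFun (iteratedDeriv_comp_const_add (j : ℕ) (fun τ => e.1 (c τ)) t) 0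
  simpa using this

theorem coordL_lift {r : ℕ} {e : atlas E Q} {c : ℝ → Q} {s : Set ℝ} (hs : IsOpen s)
    (hc : ContMDiffOn 𝓘(ℝ, ℝ) 𝓘(ℝ, E) ∞ c s) {t : ℝ} (ht : t ∈ s) (hct : c t ∈ e.1.source) (z : ℝ)
    {i : ℕ} (hi : i < r + 1) :
    coordL r i (natCoords e r (TJet.lift E r c t, z)) = iteratedDeriv i (fun τ => e.1 (c τ)) t := by
  rw [coordL_of_lt hi]
  exact coords_lift hs hc ht hct ⟨i, hi⟩

theorem isOpen_curveDomain {e : atlas E Q} {c : ℝ → Q} {s : Set ℝ} (hs : IsOpen s)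
    (hc : ContinuousOn c s) : IsOpen (s ∩ c ⁻¹' e.1.source) :=
  hc.isOpen_inter_preimage hs e.1.open_source

theorem contDiffOn_chart_comp {e : atlas E Q} {c : ℝ → Q} {s : Set ℝ}
    (hc : ContMDiffOn 𝓘(ℝ, ℝ) 𝓘(ℝ, E) ∞ c s) :
    ContDiffOn ℝ ∞ (fun τ => e.1 (c τ)) (s ∩ c ⁻¹' e.1.source) := fun t ht => by
  have h := ContMDiffAt.comp_contMDiffWithinAt (s := s ∩ c ⁻¹' e.1.source) t
    (contMDiffAt_of_mem_maximalAtlas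
      (IsManifold.subset_maximalAtlas (n := ∞) (I := 𝓘(ℝ, E)) e.2) ht.2)
    ((hc t ht.1).mono inter_subset_left)
  exact h.contDiffWithinAt

theorem hasDerivAt_natCoords_lift {r : ℕ} {e : atlas E Q} {c : ℝ → Q} {z : ℝ → ℝ} {s : Set ℝ}
    (hs : IsOpen s) (hc : ContMDiffOn 𝓘(ℝ, ℝ) 𝓘(ℝ, E) ∞ c s) {t : ℝ} (ht : t ∈ s)
    (hct : c t ∈ e.1.source) {z' : ℝ} (hz : HasDerivAt z z' t) :
    HasDerivAt (fun τ => natCoords e r (TJet.lift E r c τ, z τ))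
      (fun j : Fin (r + 1) => iteratedDeriv (j + 1) (fun τ => e.1 (c τ)) t, z') t := by
  have ho := isOpen_curveDomain (e := e) hs hc.continuousOn
  have hu := contDiffOn_chart_comp (e := e) hc
  have h1 : (fun τ => natCoords e r (TJet.lift E r c τ, z τ)) =ᶠ[𝓝 t]
      fun τ => ((fun j : Fin (r + 1) => iteratedDeriv j (fun τ => e.1 (c τ)) τ), z τ) := by
    filter_upwards [ho.mem_nhds ⟨ht, hct⟩] with τ hτ
    exact Prod.ext (funext fun j => coords_lift hs hc hτ.1 hτ.2 j) rfl
  refine HasDerivAt.congr_of_eventuallyEq ?_ h1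
  refine HasDerivAt.prodMk (hasDerivAt_pi.2 fun j => ?_) hz
  rw [iteratedDeriv_succ]
  exact (((contDiffOn_iteratedDeriv ho hu j).contDiffAt (ho.mem_nhds ⟨ht, hct⟩)).differentiableAt
    (by simp)).hasDerivAt

theorem continuousAt_of_natCoords {r : ℕ} {e : atlas E Q} {σ : ℝ → Ext E Q r} {t : ℝ}
    (ht : ∀ᶠ τ in 𝓝 t, σ τ ∈ natSource e r)
    (h : ContinuousAt (fun τ => natCoords e r (σ τ)) t) : ContinuousAt σ t := by
  have h1 := ContinuousAt.comp (f := fun τ => natCoords e r (σ τ))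
    (contMDiffAt_natInv (natCoords_mem ht.self_of_nhds)).continuousAt h
  refine h1.congr ?_
  filter_upwards [ht] with τ hτ using natInv_natCoords hτ

/-- A curve whose coordinates satisfy `q_i' = q_{i+1}` and are smooth is a prolongation. -/
theorem isProlongationOn_of_coords {r : ℕ} {σ : ℝ → Ext E Q r} {s : Set ℝ} (hs : IsOpen s)
    (hσ : ContinuousOn σ s)
    (h : ∀ (e : atlas E Q), ∀ s' ⊆ s, IsOpen s' → (∀ t ∈ s', σ t ∈ natSource e r) →
      ContDiffOn ℝ ∞ (fun t => natCoords e r (σ t)) s' ∧ ∀ t ∈ s', ∀ i < r,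
        HasDerivAt (fun t => coordL r i (natCoords e r (σ t)))
          (coordL r (i + 1) (natCoords e r (σ t))) t) :
    IsProlongationOn σ (fun t => (σ t).1.base) (fun t => (σ t).2) s := by
  have h0 : ∀ t ∈ s, ∃ e : atlas E Q, ∃ s' ⊆ s, IsOpen s' ∧ t ∈ s' ∧
      ∀ t ∈ s', σ t ∈ natSource e r := fun t ht =>
    ⟨baseChart (σ t), s ∩ σ ⁻¹' natSource _ r, inter_subset_left,
      hσ.isOpen_inter_preimage hs (isOpen_natSource _ r), ⟨ht, mem_natSource_baseChart _⟩,
      fun _ h => h.2⟩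
  have hc : ContMDiffOn 𝓘(ℝ, ℝ) 𝓘(ℝ, E) ∞ (fun t => (σ t).1.base) s := by
    intro t ht
    obtain ⟨e, s', hss, hs', hts, hes⟩ := h0 t ht
    have h1 := (h e s' hss hs' hes).1.contDiffAt (hs'.mem_nhds hts)
    have h2 : ContDiffAt ℝ ∞ (fun t => (natCoords e r (σ t)).1 0) t :=
      (contDiff_apply ℝ E (0 : Fin (r + 1))).contDiffAt.comp t (contDiff_fst.contDiffAt.comp t h1)
    have h3 : ContMDiffAt 𝓘(ℝ, ℝ) 𝓘(ℝ, E) ∞ (fun t => e.1.symm ((natCoords e r (σ t)).1 0)) t :=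
      ContMDiffAt.comp t (contMDiffAt_symm_of_mem_maximalAtlas
        (IsManifold.subset_maximalAtlas (n := ∞) (I := 𝓘(ℝ, E)) e.2)
        (natCoords_mem (hes t hts))) h2.contMDiffAt
    refine (h3.congr_of_eventuallyEq ?_).contMDiffWithinAt
    filter_upwards [hs'.mem_nhds hts] with τ hτ
    rw [natCoords_zero (hes τ hτ)]
    exact (e.1.left_inv (hes τ hτ)).symm
  refine ⟨hc, fun t ht => ?_, fun t ht => ?_⟩
  · obtain ⟨e, s', hss, hs', hts, hes⟩ := h0 t ht
    have h1 := (h e s' hss hs' hes).1.contDiffAt (hs'.mem_nhds hts)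
    exact (contDiff_snd.contDiffAt.comp t h1).contDiffWithinAt
  · obtain ⟨e, s', hss, hs', hts, hes⟩ := h0 t ht
    -- The relations `q_i' = q_{i+1}` identify each coordinate with an iterated derivative of the
    -- base curve, hence with the coordinate of its lift.
    have h1 : ∀ i, i < r + 1 → ∀ τ ∈ s', iteratedDeriv i (fun t => e.1 (σ t).1.base) τ =
        coordL r i (natCoords e r (σ τ)) := by
      intro i
      induction i with
      | zero =>
        intro _ τ hτ
        rw [iteratedDeriv_zero, ← natCoords_zero (hes τ hτ), coordL_of_lt (by omega)]
        rfl
      | succ i ih =>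
        intro hi τ hτ
        rw [iteratedDeriv_succ, (Filter.eventuallyEq_of_mem (hs'.mem_nhds hτ)
          (ih (by omega))).deriv_eq]
        exact ((h e s' hss hs' hes).2 τ hτ i (by omega)).deriv
    refine natCoords_inj (hes t hts) (lift_mem_natSource.2 (hes t hts)) ?_
    refine coord_ext (fun i hi => ?_) rfl
    rw [coordL_lift hs hc ht (hes t hts) _ hi, h1 i hi t hts]

end Curves

/-! ### Integral curves of the contact field and the Herglotz equations. -/

section IntegralCurves

variable {E : Type*} [NormedAddCommGroup E] [NormedSpace ℝ E] [FiniteDimensional ℝ E]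
  {Q : Type*} [TopologicalSpace Q] [ChartedSpace E Q] [IsManifold 𝓘(ℝ, E) ∞ Q]
  {k : ℕ} {L : Ext E Q k → ℝ}

/-- Along a prolongation, the equation of the contact Lagrangian field in coordinates is the
Herglotz equation, together with the equation for `z`. -/
theorem contactVec_lift_iff {e : atlas E Q} (hreg : IsRegular L) (hk1 : 1 ≤ k)
    (hk : k ≤ 2 * k - 1) (hL : SmoothIn e L) {c : ℝ → Q} {s : Set ℝ} (hs : IsOpen s)
    (hc : ContMDiffOn 𝓘(ℝ, ℝ) 𝓘(ℝ, E) ∞ c s) {t : ℝ} (ht : t ∈ s) (hct : c t ∈ e.1.source)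
    (z z' : ℝ) :
    ((fun j : Fin (2 * k - 1 + 1) => iteratedDeriv (j + 1) (fun τ => e.1 (c τ)) t), z') =
      contactVec hk hL (natCoords e _ (TJet.lift E (2 * k - 1) c t, z)) ↔
    herglotzExpr e L (TJet.lift E (2 * k) c t, z) = 0 ∧ z' = L (TJet.lift E k c t, z) := by
  have hp : ((TJet.lift E (2 * k - 1) c t, z) : Ext E Q _) ∈ natSource e _ :=
    lift_mem_natSource.2 hct
  have hP : ((TJet.lift E (2 * k) c t, z) : Ext E Q _) ∈ natSource e _ :=
    lift_mem_natSource.2 hct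
  have hx := natCoords_mem hp
  have hxl : loc e hk L (natCoords e _ (TJet.lift E (2 * k - 1) c t, z)) =
      L (TJet.lift E k c t, z) := loc_natCoords hk L hp
  have hi : ∀ i < 2 * k - 1 + 1, coordL (2 * k - 1) i
      ((fun j : Fin (2 * k - 1 + 1) => iteratedDeriv (j + 1) (fun τ => e.1 (c τ)) t), z') =
      iteratedDeriv (i + 1) (fun τ => e.1 (c τ)) t := fun i hi => coordL_of_lt hi _
  rw [eq_contactVec_iff hreg hk1 hk hL hx, hxl]
  -- When `z' = L`, the velocity of the prolongation to order `2k - 1` is the truncated total vector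
  -- at the lift of order `2k`, so it can serve as `y` in `herglotzExpr_eq`.
  have key : z' = L (TJet.lift E k c t, z) → herglotzExpr e L (TJet.lift E (2 * k) c t, z) = _ :=
    fun hz => herglotzExpr_eq hk hL hP
      (x := natCoords e _ (TJet.lift E (2 * k - 1) c t, z))
      (natCoords_extProj (by omega) hP)
      (y := ((fun j : Fin (2 * k - 1 + 1) => iteratedDeriv (j + 1) (fun τ => e.1 (c τ)) t), z'))
      (fun i hi' => by rw [hi i hi', coordL_lift hs hc ht hct _ (by omega)]) hz
  constructor
  · rintro ⟨-, hz, h⟩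
    refine ⟨?_, hz⟩
    rw [key hz, h, ← locDerivQ_apply hk hL 0 hx]
    abel
  · rintro ⟨h, hz⟩
    refine ⟨fun i hi' => ?_, hz, ?_⟩
    · rw [hi i (by omega), coordL_lift hs hc ht hct _ (by omega)]
    · rw [key hz, ← locDerivQ_apply hk hL 0 hx, sub_eq_zero] at h
      rw [h]
      abel

variable {R X : Field E Q (2 * k - 1)}

/-- Smoothness of the field gives smoothness of the curve, and its components below the top one are
those of a semispray. -/
theorem isProlongationOn_of_isMIntegralCurveOn (hreg : IsRegular L) (hk1 : 1 ≤ k)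
    (hk : k ≤ 2 * k - 1) (hL : ∀ e, SmoothIn e L) (hR : IsReebField L R)
    (hX : IsContactLagrangianField L R X) {σ : ℝ → Ext E Q (2 * k - 1)} {s : Set ℝ}
    (hs : IsOpen s) (hσ : IsMIntegralCurveOn (I := extModel E (2 * k - 1)) σ X s) :
    IsProlongationOn σ (fun t => (σ t).1.base) (fun t => (σ t).2) s := by
  have h0 : ∀ t ∈ s, HasMFDerivAt 𝓘(ℝ, ℝ) (extModel E (2 * k - 1)) σ t
      ((1 : ℝ →L[ℝ] ℝ).smulRight (X (σ t))) := fun t ht =>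
    (hσ t ht).hasMFDerivAt (hs.mem_nhds ht)
  refine isProlongationOn_of_coords hs
    (fun t ht => (h0 t ht).continuousAt.continuousWithinAt) fun e s' hss hs' hes => ?_
  have h1 : ∀ t ∈ s', HasDerivAt (fun t => natCoords e _ (σ t))
      (contactVec hk (hL e) (natCoords e _ (σ t))) t := fun t ht => by
    rw [← dCoords_contactField hreg hk1 hk (hL e) hR hX (hes t ht)]
    exact ((hasMFDerivAt_iff (hes t ht) _).1 (h0 t (hss ht))).2
  refine ⟨contDiffOn_of_hasDerivAt (contDiffOn_contactVec hreg hk1 hk (hL e)) hs'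
    (fun t ht => natCoords_mem (hes t ht)) h1, fun t ht i hi => ?_⟩
  have h2 := (coordL (E := E) (2 * k - 1) i).hasFDerivAt.comp_hasDerivAt t (h1 t ht)
  have h3 := ((eq_contactVec_iff hreg hk1 hk (hL e) (natCoords_mem (hes t ht))).1 rfl).1 i hi
  exact h2.congr_deriv h3

/-- The velocity of a prolongation is `(q_1, …, q_{2k}, z')` in coordinates, so tangency to the
contact field is decided by `contactVec_lift_iff`, chart by chart. -/
theorem isMIntegralCurveOn_iff (hreg : IsRegular L) (hk1 : 1 ≤ k)
    (hk : k ≤ 2 * k - 1) (hL : ∀ e, SmoothIn e L) (hR : IsReebField L R)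
    (hX : IsContactLagrangianField L R X) {σ : ℝ → Ext E Q (2 * k - 1)} {s : Set ℝ}
    (hs : IsOpen s) : IsMIntegralCurveOn (I := extModel E (2 * k - 1)) σ X s ↔
      ∃ (c : ℝ → Q) (z : ℝ → ℝ), IsProlongationOn σ c z s ∧ SatisfiesHerglotzOn L c z s := by
  have key : ∀ (c : ℝ → Q) (z : ℝ → ℝ), IsProlongationOn σ c z s → ∀ t ∈ s,
      ∀ e : atlas E Q, c t ∈ e.1.source → ∀ z', HasDerivAt z z' t →
      HasDerivAt (fun τ => natCoords e _ (σ τ))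
        ((fun j : Fin (2 * k - 1 + 1) => iteratedDeriv (j + 1) (fun τ => e.1 (c τ)) t), z') t ∧
      ContinuousAt σ t := by
    rintro c z ⟨hc, hz, hσ⟩ t ht e hct z' hz'
    have h1 := hasDerivAt_natCoords_lift (r := 2 * k - 1) hs hc ht hct hz'
    have h2 : (fun τ => natCoords e _ (σ τ)) =ᶠ[𝓝 t]
        fun τ => natCoords e _ (TJet.lift E (2 * k - 1) c τ, z τ) := by
      filter_upwards [hs.mem_nhds ht] with τ hτ
      rw [hσ τ hτ]
    have h3 := h1.congr_of_eventuallyEq h2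
    refine ⟨h3, continuousAt_of_natCoords (e := e) ?_ h3.continuousAt⟩
    filter_upwards [(isOpen_curveDomain (e := e) hs hc.continuousOn).mem_nhds ⟨ht, hct⟩] with τ hτ
    rw [hσ τ hτ.1]
    exact lift_mem_natSource.2 hτ.2
  constructor
  · intro h
    have hp := isProlongationOn_of_isMIntegralCurveOn hreg hk1 hk hL hR hX hs h
    refine ⟨_, _, hp, fun t ht => ?_⟩
    have hz : HasDerivAt (fun t => (σ t).2) (deriv (fun t => (σ t).2) t) t :=
      ((hp.2.1.contDiffAt (hs.mem_nhds ht)).differentiableAt (by simp)).hasDerivAt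
    have h1 : ∀ e : atlas E Q, (σ t).1.base ∈ e.1.source → _ := fun e hct => by
      have h2 := ((hasMFDerivAt_iff (e := e) hct _).1 ((h t ht).hasMFDerivAt (hs.mem_nhds ht))).2
      rw [dCoords_contactField hreg hk1 hk (hL e) hR hX hct] at h2
      have h3 := (key _ _ hp t ht e hct _ hz).1.unique h2
      rw [hp.2.2 t ht] at h3
      exact (contactVec_lift_iff hreg hk1 hk (hL e) hs hp.1 ht hct _ _).1 h3
    refine ⟨fun e hct => (h1 e hct).1, ?_⟩
    rw [← (h1 (baseChart (σ t)) (mem_natSource_baseChart (σ t))).2]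
    exact hz
  · rintro ⟨c, z, hp, hh⟩ t ht
    -- One chart around each point suffices in this direction, tangency being a chart-independent
    -- condition.
    let e := baseChart (σ t)
    have hes : σ t ∈ natSource e _ := mem_natSource_baseChart (σ t)
    have hct : c t ∈ e.1.source := by
      have := hes
      rw [hp.2.2 t ht] at this
      exact lift_mem_natSource.1 this
    obtain ⟨h1, h2⟩ := hh t ht
    obtain ⟨h3, h4⟩ := key c z hp t ht e hct _ h2
    have h5 := (contactVec_lift_iff hreg hk1 hk (hL e) hs hp.1 ht hct (z t) _).2 ⟨h1 e hct, rfl⟩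
    rw [← hp.2.2 t ht, ← dCoords_contactField hreg hk1 hk (hL e) hR hX hes] at h5
    rw [h5] at h3
    exact ((hasMFDerivAt_iff hes _).2 ⟨h4, h3⟩).hasMFDerivWithinAt

end IntegralCurves

end HOContact

end

theorem mainTheorem3 {E : Type*} [NormedAddCommGroup E] [NormedSpace ℝ E] [FiniteDimensional ℝ E]
    {Q : Type*} [TopologicalSpace Q] [ChartedSpace E Q] [IsManifold 𝓘(ℝ, E) ∞ Q]
    (k : ℕ) (hk : 1 ≤ k) (L : HOContact.Ext E Q k → ℝ)
    (hL : ContMDiff (HOContact.extModel E k) 𝓘(ℝ, ℝ) ∞ L) (hreg : HOContact.IsRegular L) :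
    (∃! R : HOContact.Field E Q (2 * k - 1),
      HOContact.IsSmoothField (HOContact.extModel E (2 * k - 1)) R ∧ HOContact.IsReebField L R) ∧
    ∀ R : HOContact.Field E Q (2 * k - 1),
      HOContact.IsSmoothField (HOContact.extModel E (2 * k - 1)) R → HOContact.IsReebField L R →
      ∃ X : HOContact.Field E Q (2 * k - 1),
        HOContact.IsSmoothField (HOContact.extModel E (2 * k - 1)) X ∧
        HOContact.IsContactLagrangianField L R X ∧
        (∀ Y : HOContact.Field E Q (2 * k - 1),
          HOContact.IsSmoothField (HOContact.extModel E (2 * k - 1)) Y →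
          HOContact.IsContactLagrangianField L R Y → Y = X) ∧
        HOContact.IsHolonomicField X ∧
        ∀ (σ : ℝ → HOContact.Ext E Q (2 * k - 1)) (s : Set ℝ), IsOpen s → s.OrdConnected →
          (IsMIntegralCurveOn (I := HOContact.extModel E (2 * k - 1)) σ X s ↔
            ∃ (c : ℝ → Q) (z : ℝ → ℝ), HOContact.IsProlongationOn σ c z s ∧
              HOContact.SatisfiesHerglotzOn L c z s) := by
  have hk' : k ≤ 2 * k - 1 := by omega
  have hs : ∀ e, HOContact.SmoothIn e L := fun e => HOContact.ContMDiff.smoothIn hL e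
  refine ⟨HOContact.exists_unique_reebField hreg hk hk' hs, fun R _ hR => ?_⟩
  obtain ⟨X, h1, h2, h3⟩ := HOContact.exists_unique_contactField hreg hk hk' hs hR
  exact ⟨X, h1, h2, fun Y _ hY => h3 Y hY,
    fun σ s hs' _ h => ⟨_, _,
      HOContact.isProlongationOn_of_isMIntegralCurveOn hreg hk hk' hs hR h2 hs' h⟩,
    fun σ s hs' _ => HOContact.isMIntegralCurveOn_iff hreg hk hk' hs hR h2 hs'⟩
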